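/- Consider the third-order flow equation of the Kaup--Newell system (TOFKN) $$q_t+q_{xxx}-3\mathrm i(|q|^2q_x)_x-\tfrac32(|q|^4q)_x=0,\qquad (x,t)\in\mathbb R^2. \tag{1}$$ Let $q:\mathbb R^2\to\mathbb C$ be a classical solution of (1) ($q,q_x,q_{xx},q_{xxx},q_t$ exist and are continuous) with zero boundary conditions: $q,q_x,q_{xx}\to0$ as $x\to\pm\infty$, locally uniformly in $t$, and $q(\cdot,t),q_x(\cdot,t)\in L^1(\mathbb R)$ for every $t$. **Scattering data.** Put $\sigma_3=\mathrm{diag}(1,-1)$, $Q=\begin{pmatrix}0&q\\-q^*&0\end{pmatrix}$, $\theta(\lambda)=\theta(\lambda;x,t)=\lambda^2(x+4\lambda^4t)$, $\Sigma=\mathbb R\cup\mathrm i\mathbb R$, $D^{\pm}=\{\lambda\in\mathbb C:\pm\mathrm{Re}\lambda\,\mathrm{Im}\lambda>0\}$; $'$ denotes $\partial/\partial\lambda$ and ${}^*$ complex conjugation. Let $\psi_\pm(\lambda;x,t)=(\psi_{\pm1},\psi_{\pm2})$ be the Jost solutions of $\psi_x=\lambda(\mathrm i\lambda\sigma_3+Q)\psi$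 with $\psi_\pm \mathrm e^{-\mathrm i\theta\sigma_3}\to I$ as $x\to\pm\infty$, where the columns $\psi_{+1},\psi_{-2}$ are considered for $\lambda\in D^+\cup\Sigma$ and $\psi_{+2},\psi_{-1}$ for $\lambda\in D^-\cup\Sigma$. The scattering coefficients $$s_{11}=\det(\psi_{+1},\psi_{-2}),\quad s_{12}=\det(\psi_{+2},\psi_{-2}),\quad s_{21}=\det(\psi_{-1},\psi_{+1}),\quad s_{22}=\det(\psi_{-1},\psi_{+2})$$ do not depend on $(x,t)$. Assume: * $s_{11}$ and $s_{22}$ have no zeros on $\Sigma$, and $q$ is reflectionless: $\rho=s_{21}/s_{11}=0$ and $\tilde\rho=s_{12}/s_{22}=0$ on $\Sigma$; * the zeros of $s_{11}$ in the open first quadrant are $N$ distinct points $\lambda_1,\dots,\lambda_N$, and they are double: $s_{11}(\lambda_n)=s_{11}'(\lambda_n)=0\ne s_{11}''(\lambda_n)$. For $\lambda_0\in\Lambda=\{\pm\lambda_n,\pm\lambda_n^*\}_{n=1}^N$ let $b[\lambda_0],d[\lambda_0]$ be the constants (independent of $x,t$) with, at $\lambda=\lambda_0$, $$\psi_{+1}=b\,\psi_{-2},\quad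 \psi_{+1}'-b\,\psi_{-2}'=d\,\psi_{-2}\quad(\lambda_0\in D^+);\qquad \psi_{+2}=b\,\psi_{-1},\quad \psi_{+2}'-b\,\psi_{-1}'=d\,\psi_{-1}\quad(\lambda_0\in D^-),$$ and put $$A[\lambda_0]=\frac{2b[\lambda_0]}{s''(\lambda_0)},\qquad B[\lambda_0]=\frac{d[\lambda_0]}{b[\lambda_0]}-\frac{s'''(\lambda_0)}{3s''(\lambda_0)},$$ with $s=s_{11}$ if $\lambda_0\in D^+$ and $s=s_{22}$ if $\lambda_0\in D^-$. **Matrices.** Let $\zeta_n=\lambda_n$ and $\zeta_{N+n}=-\lambda_n$ for $1\le n\le N$, and for $1\le n\le 2N$ $$C_n(\lambda)=\frac{A[\zeta_n]}{\lambda-\zeta_n}\mathrm e^{-2\mathrm i\theta(\zeta_n)},\quad \widetilde C_n(\lambda)=\frac{A[\zeta_n^*]}{\lambda-\zeta_n^*}\mathrm e^{2\mathrm i\theta(\zeta_n^*)},\quad D_n=B[\zeta_n]-2\mathrm i\theta'(\zeta_n),\quad \widetilde D_n=B[\zeta_n^*]+2\mathrm i\theta'(\zeta_n^*).$$ Let $\alpha=(\alpha^{(1)},\alpha^{(2)})$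 be the row vector with $\alpha^{(1)}_n=A[\zeta_n^*]\mathrm e^{2\mathrm i\theta(\zeta_n^*)}\widetilde D_n$, $\alpha^{(2)}_n=A[\zeta_n^*]\mathrm e^{2\mathrm i\theta(\zeta_n^*)}$, and $\tau$ the column vector whose first $2N$ entries are $1$ and whose last $2N$ entries are $0$. With $e_{ns}=\zeta_n^*-\zeta_s$ and $f_{sj}=\zeta_s-\zeta_j^*$, let $G,\widetilde G$ be the $4N\times4N$ matrices with $2N\times2N$ blocks $$g^{(1,1)}_{n,j}=\sum_{s=1}^{2N}C_s(\zeta_n^*)\widetilde C_j(\zeta_s)\Big[-\tfrac1{f_{sj}}\big(\widetilde D_j+\tfrac2{f_{sj}}\big)+\big(D_s+\tfrac1{e_{ns}}\big)\big(\widetilde D_j+\tfrac1{f_{sj}}\big)\Big],$$ $$g^{(1,2)}_{n,j}=\sum_{s=1}^{2N}C_s(\zeta_n^*)\widetilde C_j(\zeta_s)\Big[-\tfrac1{f_{sj}}+D_s+\tfrac1{e_{ns}}\Big],$$ $$g^{(2,1)}_{n,j}=\sum_{s=1}^{2N}\frac{C_s(\zeta_n^*)\widetilde C_j(\zeta_s)}{e_{ns}}\Big[\tfrac1{f_{sj}}\big(\widetilde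 D_j+\tfrac2{f_{sj}}\big)-\big(D_s+\tfrac2{e_{ns}}\big)\big(\widetilde D_j+\tfrac1{f_{sj}}\big)\Big],$$ $$g^{(2,2)}_{n,j}=\sum_{s=1}^{2N}\frac{C_s(\zeta_n^*)\widetilde C_j(\zeta_s)}{e_{ns}}\Big[\tfrac1{f_{sj}}-\big(D_s+\tfrac2{e_{ns}}\big)\Big],$$ $$\tilde g^{(1,1)}_{n,j}=\zeta_n^*\sum_{s=1}^{2N}\frac{C_s(\zeta_n^*)\widetilde C_j(\zeta_s)}{\zeta_s}\Big[-\tfrac1{f_{sj}}\big(\widetilde D_j+\tfrac2{f_{sj}}\big)+\tfrac{\zeta_s}{\zeta_j^*}\big(D_s+\tfrac1{e_{ns}}-\tfrac1{\zeta_s}\big)\big(\widetilde D_j+\tfrac1{f_{sj}}-\tfrac1{\zeta_j^*}\big)\Big],$$ $$\tilde g^{(1,2)}_{n,j}=\zeta_n^*\sum_{s=1}^{2N}\frac{C_s(\zeta_n^*)\widetilde C_j(\zeta_s)}{\zeta_s}\Big[-\tfrac1{f_{sj}}+\tfrac{\zeta_s}{\zeta_j^*}\big(D_s+\tfrac1{e_{ns}}-\tfrac1{\zeta_s}\big)\Big],$$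 $$\tilde g^{(2,1)}_{n,j}=\sum_{s=1}^{2N}\frac{C_s(\zeta_n^*)\widetilde C_j(\zeta_s)}{e_{ns}}\Big[\tfrac1{f_{sj}}\big(\widetilde D_j+\tfrac2{f_{sj}}\big)-\tfrac{\zeta_s}{\zeta_j^*}\big(D_s+\tfrac2{e_{ns}}\big)\big(\widetilde D_j+\tfrac1{f_{sj}}-\tfrac1{\zeta_j^*}\big)\Big],$$ $$\tilde g^{(2,2)}_{n,j}=\sum_{s=1}^{2N}\frac{C_s(\zeta_n^*)\widetilde C_j(\zeta_s)}{e_{ns}}\Big[\tfrac1{f_{sj}}-\tfrac{\zeta_s}{\zeta_j^*}\big(D_s+\tfrac2{e_{ns}}\big)\Big],$$ and let $$R=\begin{pmatrix}0&\alpha\\ \tau&I-G\end{pmatrix},\qquad \widetilde R=\begin{pmatrix}0&\alpha\\ \tau&I-\widetilde G\end{pmatrix}.$$ **Theorem.** For all $(x,t)\in\mathbb R^2$, $\det(I-G)\ne0$, $\det(I-\widetilde G)\ne0$, each of $\det R$ and $\det\widetilde R$ vanishes exactly where $q$ vanishes, and $$q(x,t)=2\mathrm i\,\frac{\det(I-G)}{\det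 R}\left(\frac{\det\widetilde R}{\det(I-\widetilde G)}\right)^2,$$ where at the zeros of $q$ the right-hand side, formally $0/0$, is read as $0$. -/

import Mathlib

open Filter Topology MeasureTheory ComplexConjugate

namespace TOFKN

noncomputable section

/-! ### The equation and the zero boundary conditions -/

/-- The `m`-th partial derivative of `q` with respect to `x`. -/
def dx (q : ℝ → ℝ → ℂ) (m : ℕ) (x t : ℝ) : ℂ := iteratedDeriv m (fun y => q y t) x

/-- The partial derivative of `q` with respect to `t`. -/
def dt (q : ℝ → ℝ → ℂ) (x t : ℝ) : ℂ := deriv (fun s => q x s) t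

/-- Classical solutions of the third-order flow equation of the Kaup-Newell system,
`q_t + q_xxx - 3i (|q|² q_x)_x - (3/2) (|q|⁴ q)_x = 0`: the partial derivatives
`q_x`, `q_xx`, `q_xxx`, `q_t` exist and are continuous on the plane, and the equation holds
at every point. -/
structure IsSolution (q : ℝ → ℝ → ℂ) : Prop where
  contDiff_x : ∀ t, ContDiff ℝ 3 (fun x => q x t)
  differentiable_t : ∀ x, Differentiable ℝ (fun t => q x t)
  continuous_dx : ∀ m ≤ 3, Continuous (fun p : ℝ × ℝ => dx q m p.1 p.2)
  continuous_dt : Continuous (fun p : ℝ × ℝ => dt q p.1 p.2)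
  eqn : ∀ x t,
    dt q x t + dx q 3 x t
      - 3 * Complex.I * deriv (fun y => (‖q y t‖ : ℂ) ^ 2 * dx q 1 y t) x
      - 3 / 2 * deriv (fun y => (‖q y t‖ : ℂ) ^ 4 * q y t) x = 0

/-- Zero boundary conditions as `x → ±∞`: `q`, `q_x`, `q_xx` tend to zero, locally uniformly
in `t`, and `q(·, t)`, `q_x(·, t)` are integrable over the line for each `t`. -/
structure ZeroBoundary (q : ℝ → ℝ → ℂ) : Prop where
  tendsto_zero : ∀ m ≤ 2,
    TendstoLocallyUniformly (fun x t : ℝ => dx q m x t) (fun _ => 0) (cocompact ℝ)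
  integrable : ∀ m ≤ 1, ∀ t, Integrable (fun x => dx q m x t)

/-! ### Direct scattering -/

def sigma3 : Matrix (Fin 2) (Fin 2) ℂ := !![1, 0; 0, -1]

/-- The potential matrix `Q`. -/
def potential (q : ℝ → ℝ → ℂ) (x t : ℝ) : Matrix (Fin 2) (Fin 2) ℂ :=
  !![0, q x t; -conj (q x t), 0]

/-- The matrix `X = λ (i λ σ₃ + Q)` of the spatial part `Ψ_x = X Ψ` of the Lax pair
(the spectral parameter `λ` is called `k`). -/
def laxX (q : ℝ → ℝ → ℂ) (k : ℂ) (x t : ℝ) : Matrix (Fin 2) (Fin 2) ℂ :=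
  k • ((Complex.I * k) • sigma3 + potential q x t)

/-- The phase `θ(λ; x, t) = λ² (x + 4 λ⁴ t)`. -/
def theta (k : ℂ) (x t : ℝ) : ℂ := k ^ 2 * (x + 4 * k ^ 4 * t)

/-- `f` solves `f_x = X f` and is asymptotic to the `i`-th column of `exp (i θ σ₃)` as
`x → +∞` (`l = atTop`) or `x → -∞` (`l = atBot`). -/
def IsJost (q : ℝ → ℝ → ℂ) (l : Filter ℝ) (i : Fin 2) (k : ℂ) (t : ℝ)
    (f : ℝ → Fin 2 → ℂ) : Prop :=
  (∀ x, HasDerivAt f ((laxX q k x t).mulVec (f x)) x) ∧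
    Tendsto (fun x => Complex.exp (-(Complex.I * theta k x t * sigma3 i i)) • f x) l
      (𝓝 (Pi.single i 1))

/-- The columns of the Jost solutions. The characterization `IsJost` determines the columns
`ψ₊₁`, `ψ₋₂` uniquely for `Re λ Im λ ≥ 0` and `ψ₊₂`, `ψ₋₁` for `Re λ Im λ ≤ 0`,
which is where they are used. -/
def jost (q : ℝ → ℝ → ℂ) (l : Filter ℝ) (i : Fin 2) (k : ℂ) (x t : ℝ) : Fin 2 → ℂ :=
  Classical.epsilon (IsJost q l i k t) x

/-- `ψ₊₁` -/
def psiP1 (q : ℝ → ℝ → ℂ) (k : ℂ) (x t : ℝ) : Fin 2 → ℂ := jost q atTop 0 k x t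

/-- `ψ₊₂` -/
def psiP2 (q : ℝ → ℝ → ℂ) (k : ℂ) (x t : ℝ) : Fin 2 → ℂ := jost q atTop 1 k x t

/-- `ψ₋₁` -/
def psiM1 (q : ℝ → ℝ → ℂ) (k : ℂ) (x t : ℝ) : Fin 2 → ℂ := jost q atBot 0 k x t

/-- `ψ₋₂` -/
def psiM2 (q : ℝ → ℝ → ℂ) (k : ℂ) (x t : ℝ) : Fin 2 → ℂ := jost q atBot 1 k x t

/-- The determinant of the matrix with columns `a`, `b`. -/
def wronskian (a b : Fin 2 → ℂ) : ℂ := a 0 * b 1 - a 1 * b 0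

/-! The scattering coefficients. The Wronskians of Jost solutions do not depend on `(x, t)`;
they are taken at `(0, 0)`. -/

def s11 (q : ℝ → ℝ → ℂ) (k : ℂ) : ℂ := wronskian (psiP1 q k 0 0) (psiM2 q k 0 0)

def s12 (q : ℝ → ℝ → ℂ) (k : ℂ) : ℂ := wronskian (psiP2 q k 0 0) (psiM2 q k 0 0)

def s21 (q : ℝ → ℝ → ℂ) (k : ℂ) : ℂ := wronskian (psiM1 q k 0 0) (psiP1 q k 0 0)

def s22 (q : ℝ → ℝ → ℂ) (k : ℂ) : ℂ := wronskian (psiM1 q k 0 0) (psiP2 q k 0 0)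

/-- The continuous spectrum `Σ = ℝ ∪ iℝ`. -/
def contSpec : Set ℂ := {k | k.im = 0 ∨ k.re = 0}

/-- The reflection coefficient `ρ`. -/
def rho (q : ℝ → ℝ → ℂ) (k : ℂ) : ℂ := s21 q k / s11 q k

/-- The reflection coefficient `ρ̃`. -/
def rhoTilde (q : ℝ → ℝ → ℂ) (k : ℂ) : ℂ := s12 q k / s22 q k

/-- The open first quadrant. -/
def firstQuadrant : Set ℂ := {k | 0 < k.re ∧ 0 < k.im}

/-- `D⁺ = {Re λ Im λ > 0}` -/
def DPlus : Set ℂ := {k | 0 < k.re * k.im}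

/-! ### Norming constants

They are used at the points of the discrete spectrum: zeros of `s₁₁` in `D⁺`,
zeros of `s₂₂` in `D⁻ = {Re λ Im λ < 0}`. -/

open Classical in
/-- `b[λ]`: the constant, independent of `x` and `t`, with `ψ₊₁ = b ψ₋₂` in `D⁺` and
`ψ₊₂ = b ψ₋₁` in `D⁻`. -/
def normB (q : ℝ → ℝ → ℂ) (k : ℂ) : ℂ :=
  if k ∈ DPlus then
    Classical.epsilon fun b : ℂ => ∀ x t, psiP1 q k x t = b • psiM2 q k x t
  else
    Classical.epsilon fun b : ℂ => ∀ x t, psiP2 q k x t = b • psiM1 q k x t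

open Classical in
/-- `d[λ]`: the constant, independent of `x` and `t`, with `ψ₊₁' - b ψ₋₂' = d ψ₋₂` in `D⁺` and
`ψ₊₂' - b ψ₋₁' = d ψ₋₁` in `D⁻`, the prime being the derivative with respect to `λ`. -/
def normD (q : ℝ → ℝ → ℂ) (k : ℂ) : ℂ :=
  if k ∈ DPlus then
    Classical.epsilon fun d : ℂ => ∀ x t,
      deriv (fun l => psiP1 q l x t) k - normB q k • deriv (fun l => psiM2 q l x t) k
        = d • psiM2 q k x t
  else
    Classical.epsilon fun d : ℂ => ∀ x t,
      deriv (fun l => psiP2 q l x t) k - normB q k • deriv (fun l => psiM1 q l x t) k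
        = d • psiM1 q k x t

open Classical in
/-- `A[λ]` -/
def constA (q : ℝ → ℝ → ℂ) (k : ℂ) : ℂ :=
  if k ∈ DPlus then 2 * normB q k / iteratedDeriv 2 (s11 q) k
  else 2 * normB q k / iteratedDeriv 2 (s22 q) k

open Classical in
/-- `B[λ]` -/
def constB (q : ℝ → ℝ → ℂ) (k : ℂ) : ℂ :=
  if k ∈ DPlus then
    normD q k / normB q k - iteratedDeriv 3 (s11 q) k / (3 * iteratedDeriv 2 (s11 q) k)
  else
    normD q k / normB q k - iteratedDeriv 3 (s22 q) k / (3 * iteratedDeriv 2 (s22 q) k)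

/-! ### The determinants

`A`, `B` are the norming constants as functions on the discrete spectrum and
`z` lists the points `ζ_n` (`n` in a finite index type `ι`, later with `2N` elements). -/

/-- The points `ζ_n`: first `λ_1, …, λ_N`, then `-λ_1, …, -λ_N`. -/
def zeta {N : ℕ} (lam : Fin N → ℂ) : Fin N ⊕ Fin N → ℂ :=
  Sum.elim lam (fun n => -lam n)

/-- `θ'`, the derivative of `θ` with respect to `λ`. -/
def thetaDeriv (k : ℂ) (x t : ℝ) : ℂ := deriv (fun l => theta l x t) k

section Determinants

variable {ι : Type} [Fintype ι] [DecidableEq ι] (A B : ℂ → ℂ) (z : ι → ℂ) (x t : ℝ)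

/-- `C_n(λ)` -/
def coefC (n : ι) (k : ℂ) : ℂ :=
  A (z n) / (k - z n) * Complex.exp (-(2 * Complex.I * theta (z n) x t))

/-- `C̃_n(λ)` -/
def coefCt (n : ι) (k : ℂ) : ℂ :=
  A (conj (z n)) / (k - conj (z n)) * Complex.exp (2 * Complex.I * theta (conj (z n)) x t)

/-- `D_n` -/
def coefD (n : ι) : ℂ := B (z n) - 2 * Complex.I * thetaDeriv (z n) x t

/-- `D̃_n` -/
def coefDt (n : ι) : ℂ := B (conj (z n)) + 2 * Complex.I * thetaDeriv (conj (z n)) x t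

/-- The row vector `α = (α⁽¹⁾, α⁽²⁾)`. -/
def alpha : ι ⊕ ι → ℂ :=
  Sum.elim
    (fun n => A (conj (z n)) * Complex.exp (2 * Complex.I * theta (conj (z n)) x t)
      * coefDt B z x t n)
    (fun n => A (conj (z n)) * Complex.exp (2 * Complex.I * theta (conj (z n)) x t))

/-- The column vector `τ`. -/
def tau : ι ⊕ ι → ℂ := Sum.elim (fun _ => 1) (fun _ => 0)

def g11 (n j : ι) : ℂ :=
  ∑ s, coefC A z x t s (conj (z n)) * coefCt A z x t j (z s) *
    (-(1 / (z s - conj (z j))) * (coefDt B z x t j + 2 / (z s - conj (z j)))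
      + (coefD B z x t s + 1 / (conj (z n) - z s))
        * (coefDt B z x t j + 1 / (z s - conj (z j))))

def g12 (n j : ι) : ℂ :=
  ∑ s, coefC A z x t s (conj (z n)) * coefCt A z x t j (z s) *
    (-(1 / (z s - conj (z j))) + (coefD B z x t s + 1 / (conj (z n) - z s)))

def g21 (n j : ι) : ℂ :=
  ∑ s, coefC A z x t s (conj (z n)) * coefCt A z x t j (z s) / (conj (z n) - z s) *
    (1 / (z s - conj (z j)) * (coefDt B z x t j + 2 / (z s - conj (z j)))
      - (coefD B z x t s + 2 / (conj (z n) - z s))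
        * (coefDt B z x t j + 1 / (z s - conj (z j))))

def g22 (n j : ι) : ℂ :=
  ∑ s, coefC A z x t s (conj (z n)) * coefCt A z x t j (z s) / (conj (z n) - z s) *
    (1 / (z s - conj (z j)) - (coefD B z x t s + 2 / (conj (z n) - z s)))

/-- The matrix `G`. -/
def matG : Matrix (ι ⊕ ι) (ι ⊕ ι) ℂ :=
  Matrix.fromBlocks (Matrix.of (g11 A B z x t)) (Matrix.of (g12 A B z x t))
    (Matrix.of (g21 A B z x t)) (Matrix.of (g22 A B z x t))

def gt11 (n j : ι) : ℂ :=
  conj (z n) * ∑ s, coefC A z x t s (conj (z n)) * coefCt A z x t j (z s) / z s *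
    (-(1 / (z s - conj (z j))) * (coefDt B z x t j + 2 / (z s - conj (z j)))
      + z s / conj (z j) * (coefD B z x t s + 1 / (conj (z n) - z s) - 1 / z s)
        * (coefDt B z x t j + 1 / (z s - conj (z j)) - 1 / conj (z j)))

def gt12 (n j : ι) : ℂ :=
  conj (z n) * ∑ s, coefC A z x t s (conj (z n)) * coefCt A z x t j (z s) / z s *
    (-(1 / (z s - conj (z j)))
      + z s / conj (z j) * (coefD B z x t s + 1 / (conj (z n) - z s) - 1 / z s))

def gt21 (n j : ι) : ℂ :=
  ∑ s, coefC A z x t s (conj (z n)) * coefCt A z x t j (z s) / (conj (z n) - z s) *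
    (1 / (z s - conj (z j)) * (coefDt B z x t j + 2 / (z s - conj (z j)))
      - z s / conj (z j) * (coefD B z x t s + 2 / (conj (z n) - z s))
        * (coefDt B z x t j + 1 / (z s - conj (z j)) - 1 / conj (z j)))

def gt22 (n j : ι) : ℂ :=
  ∑ s, coefC A z x t s (conj (z n)) * coefCt A z x t j (z s) / (conj (z n) - z s) *
    (1 / (z s - conj (z j))
      - z s / conj (z j) * (coefD B z x t s + 2 / (conj (z n) - z s)))

/-- The matrix `G̃`. -/
def matGt : Matrix (ι ⊕ ι) (ι ⊕ ι) ℂ :=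
  Matrix.fromBlocks (Matrix.of (gt11 A B z x t)) (Matrix.of (gt12 A B z x t))
    (Matrix.of (gt21 A B z x t)) (Matrix.of (gt22 A B z x t))

/-- The bordered matrix `(0, α; τ, I - H)`. -/
def bordered (H : Matrix (ι ⊕ ι) (ι ⊕ ι) ℂ) : Matrix (Unit ⊕ (ι ⊕ ι)) (Unit ⊕ (ι ⊕ ι)) ℂ :=
  Matrix.fromBlocks 0 (Matrix.replicateRow Unit (alpha A B z x t))
    (Matrix.replicateCol Unit tau) (1 - H)

/-- The matrix `R`. -/
def matR : Matrix (Unit ⊕ (ι ⊕ ι)) (Unit ⊕ (ι ⊕ ι)) ℂ :=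
  bordered A B z x t (matG A B z x t)

/-- The matrix `R̃`. -/
def matRt : Matrix (Unit ⊕ (ι ⊕ ι)) (Unit ⊕ (ι ⊕ ι)) ℂ :=
  bordered A B z x t (matGt A B z x t)

end Determinants

end

end TOFKN

open TOFKN

/-!
The determinant formula for reflectionless solutions whose scattering coefficient `s₁₁` has double
zeros is obtained from a Riemann-Hilbert problem whose solution is rational.

*Jost solutions.* At a fixed time, the first column of a Jost solution is `e^{iθ} (a, λ c)`, where
`a` and `c` are functions of `x` and `z = λ²`. A change of unknowns turns the spatial equation into
a Volterra equation that is solved by a Neumann series, uniformly in a closed half-plane of `z`;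
this yields continuity up to the boundary, holomorphy inside, and the behaviour at infinity, namely
`a` has a nonzero limit and `2iz c - r a → 0` with `r = -q^*` (`exists_halfJost_atTop`,
`exists_halfJost_atBot`). Since `q` solves the flow equation, the curvature of the Lax pair vanishes
(`IsSolution.hasDerivAt_laxT`), and the temporal part of the pair carries Jost solutions to Jost
solutions (`IsSolution.exists_isJost`). Hence Wronskians of Jost solutions are constant, and at a
double zero of `s₁₁` there are norming constants `b` and `d` that do not depend on `(x, t)`
(`exists_jost_eq_smul`, `exists_deriv_jost_eq_smul`).

*Riemann-Hilbert problem.* For a reflectionless `q` the quotient of the column `ψ₊₁` by `s₁₁` and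
the column `ψ₋₁` agree on `ℝ ∪ iℝ`, up to exponential factors, so they are one meromorphic function
(`differentiableAt_glue`). Together with the conjugate column it forms a matrix `m` of determinant
`1` with double poles at the discrete spectrum. The double zeros of `s₁₁` and the norming constants
determine the principal parts of each column in terms of values and derivatives of the other one
(`residueCondition_of_double_zero`). At infinity `m` tends to `diag (e, e^*)` with `|e| = 1`, and
the coefficient of `1/λ` in `m₁₂` is `(i/2) q e^*`; at the origin `m₁₁ = 1` and `m₁₂ = 0`
(`exists_isSolRHP`).

*Linear systems.* By Liouville's theorem, an entry of a row of `m` is the sum of a constant and its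
principal parts. Evaluation at the poles gives a linear system for the values and derivatives `X`
of the first entry at the points `ζ_n^*`: it reads `(I - G) X = e τ` if the constants are the limits
at infinity, and `(I - G̃) X = τ` if they are the values at the origin (`matG_mulVec`,
`matGt_mulVec`, `IsRow.system_matG`, `IsRow.system_matGt`). A vector in the kernel of one of the
two matrices would yield a bounded row with the same residue conditions that vanishes at infinity or
at the origin. The product of that row with `m⁻¹` is entire and bounded, hence zero
(`IsSolRHP.jet_eq_zero`), so the determinants do not vanish. The number `α X` is the coefficient of
`1/λ` in `m₁₂`, and by the Schur complement it is expressed by the bordered determinants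
(`det_bordered`):
`det R / det (I - G) = -(i/2) q (e^*)²` and `det R̃ / det (I - G̃) = -(i/2) q e^*`.
The unknown phase `e` cancels in the combination of these two identities that gives `q`
(`IsSolRHP.conclusion`).
-/

namespace TOFKN

/-! ### Linear systems of ordinary differential equations -/

/-- The sum of the norms of the entries, a bound for the operator norm on `Fin 2 → ℂ`. -/
noncomputable def entryNorm (A : Matrix (Fin 2) (Fin 2) ℂ) : ℝ := ∑ i, ∑ j, ‖A i j‖

lemma entryNorm_nonneg (A : Matrix (Fin 2) (Fin 2) ℂ) : 0 ≤ entryNorm A := by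
  unfold entryNorm; positivity

lemma norm_mulVec_le (A : Matrix (Fin 2) (Fin 2) ℂ) (v : Fin 2 → ℂ) :
    ‖A.mulVec v‖ ≤ entryNorm A * ‖v‖ := by
  refine (pi_norm_le_iff_of_nonneg (mul_nonneg (entryNorm_nonneg A) (norm_nonneg v))).2 fun i => ?_
  have h1 : ‖A.mulVec v i‖ ≤ ∑ j, ‖A i j‖ * ‖v‖ := by
    refine (norm_sum_le (E := ℂ) Finset.univ (fun j => A i j * v j)).trans
      (Finset.sum_le_sum fun j _ => ?_)
    rw [norm_mul]
    exact mul_le_mul_of_nonneg_left (norm_le_pi_norm v j) (norm_nonneg _)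
  refine h1.trans ?_
  rw [← Finset.sum_mul]
  refine mul_le_mul_of_nonneg_right ?_ (norm_nonneg v)
  exact Finset.single_le_sum (f := fun i => ∑ j, ‖A i j‖) (fun i _ => by positivity)
    (Finset.mem_univ i)

lemma continuous_entryNorm : Continuous entryNorm := by
  unfold entryNorm
  fun_prop

lemma norm_le_of_hasDerivAt_forward {A : ℝ → Matrix (Fin 2) (Fin 2) ℂ} {f g : ℝ → Fin 2 → ℂ}
    {t₀ τ K ε : ℝ} (hK : 0 ≤ K) (hε : 0 ≤ ε)
    (hf : ∀ s, HasDerivAt f ((A s).mulVec (f s) + g s) s)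
    (hA : ∀ s, |s - t₀| ≤ τ → entryNorm (A s) ≤ K) (hg : ∀ s, |s - t₀| ≤ τ → ‖g s‖ ≤ ε)
    {s : ℝ} (hs : s ∈ Set.Icc t₀ (t₀ + τ)) :
    ‖f s‖ ≤ (‖f t₀‖ + ε) * Real.exp ((K + 1) * τ) := by
  have h := norm_le_gronwallBound_of_norm_deriv_right_le (f := f)
    (f' := fun s => (A s).mulVec (f s) + g s) (δ := ‖f t₀‖) (K := K + 1) (ε := ε) (a := t₀)
    (b := t₀ + τ) (fun s _ => (hf s).continuousAt.continuousWithinAt)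
    (fun s _ => (hf s).hasDerivWithinAt) le_rfl (fun s hs => by
      have hs' : |s - t₀| ≤ τ := by rw [abs_le]; constructor <;> linarith [hs.1, hs.2]
      calc ‖(A s).mulVec (f s) + g s‖ ≤ entryNorm (A s) * ‖f s‖ + ‖g s‖ :=
            (norm_add_le _ _).trans (add_le_add_left (norm_mulVec_le _ _) _)
        _ ≤ (K + 1) * ‖f s‖ + ε := by
            have := hA s hs'
            have := hg s hs'
            have := norm_nonneg (f s)
            nlinarith) s hs
  refine h.trans ?_
  rw [gronwallBound_of_K_ne_0 (by linarith)]
  have h1 : Real.exp ((K + 1) * (s - t₀)) ≤ Real.exp ((K + 1) * τ) := by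
    apply Real.exp_le_exp.2
    have := hs.2
    nlinarith
  have h2 : ε / (K + 1) * (Real.exp ((K + 1) * (s - t₀)) - 1)
      ≤ ε * Real.exp ((K + 1) * τ) := by
    have h3 : ε / (K + 1) ≤ ε := div_le_self hε (by linarith)
    have h4 : (0 : ℝ) < Real.exp ((K + 1) * (s - t₀)) := Real.exp_pos _
    have h5 : 0 ≤ ε / (K + 1) := by positivity
    nlinarith
  nlinarith [norm_nonneg (f t₀)]

/-- Grönwall's inequality for an inhomogeneous linear system, in both time directions. -/
lemma norm_le_of_hasDerivAt {A : ℝ → Matrix (Fin 2) (Fin 2) ℂ} {f g : ℝ → Fin 2 → ℂ}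
    {t₀ τ K ε : ℝ} (hK : 0 ≤ K) (hε : 0 ≤ ε)
    (hf : ∀ s, HasDerivAt f ((A s).mulVec (f s) + g s) s)
    (hA : ∀ s, |s - t₀| ≤ τ → entryNorm (A s) ≤ K) (hg : ∀ s, |s - t₀| ≤ τ → ‖g s‖ ≤ ε)
    {s : ℝ} (hs : |s - t₀| ≤ τ) :
    ‖f s‖ ≤ (‖f t₀‖ + ε) * Real.exp ((K + 1) * τ) := by
  rw [abs_le] at hs
  rcases le_total t₀ s with h | h
  · exact norm_le_of_hasDerivAt_forward hK hε hf hA hg ⟨h, by linarith⟩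
  · have hf' : ∀ s, HasDerivAt (fun s => f (-s))
        ((-(A (-s))).mulVec (f (-s)) + -g (-s)) s := fun s => by
      refine ((hf (-s)).scomp s (hasDerivAt_neg s)).congr_deriv ?_
      rw [Matrix.neg_mulVec, neg_one_smul, neg_add]
    have := norm_le_of_hasDerivAt_forward (A := fun s => -(A (-s))) (f := fun s => f (-s))
      (g := fun s => -g (-s)) (t₀ := -t₀) (τ := τ) (s := -s) hK hε hf' (fun s hs => by
        have : entryNorm (-(A (-s))) = entryNorm (A (-s)) := by simp [entryNorm]
        rw [this]
        refine hA _ ?_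
        rw [← abs_neg]; convert hs using 2; ring)
      (fun s hs => by
        rw [norm_neg]
        refine hg _ ?_
        rw [← abs_neg]; convert hs using 2; ring) ⟨by linarith, by linarith⟩
    simpa using this

lemma exists_entryNorm_le {A : ℝ → Matrix (Fin 2) (Fin 2) ℂ} (hA : Continuous A) (t₀ τ : ℝ) :
    ∃ K, 0 ≤ K ∧ ∀ s, |s - t₀| ≤ τ → entryNorm (A s) ≤ K := by
  obtain ⟨K, hK⟩ := (isCompact_Icc (a := t₀ - τ) (b := t₀ + τ)).exists_bound_of_continuousOn
    (f := fun s => entryNorm (A s)) (continuous_entryNorm.comp hA).continuousOn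
  refine ⟨max K 0, le_max_right _ _, fun s hs => ?_⟩
  rw [abs_le] at hs
  exact (le_abs_self _).trans ((hK s ⟨by linarith, by linarith⟩).trans (le_max_left _ _))

lemma linearODE_unique {A : ℝ → Matrix (Fin 2) (Fin 2) ℂ} (hA : Continuous A)
    {f g : ℝ → Fin 2 → ℂ} (hf : ∀ s, HasDerivAt f ((A s).mulVec (f s)) s)
    (hg : ∀ s, HasDerivAt g ((A s).mulVec (g s)) s) {t₀ : ℝ} (h : f t₀ = g t₀) : f = g := by
  funext s
  obtain ⟨K, hK, hAK⟩ := exists_entryNorm_le hA t₀ |s - t₀|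
  have := norm_le_of_hasDerivAt (A := A) (f := fun s => f s - g s) (g := fun _ => 0) hK le_rfl
    (fun s => ((hf s).sub (hg s)).congr_deriv (by
      rw [Matrix.mulVec_sub, add_zero])) hAK (by simp) (le_refl |s - t₀|)
  rw [← sub_eq_zero, ← norm_le_zero_iff]
  simpa [h] using this

/-- Global solvability of linear systems with continuous coefficients, by Picard iteration. -/
lemma linearODE_exists {A : ℝ → Matrix (Fin 2) (Fin 2) ℂ} (hA : Continuous A) (v : Fin 2 → ℂ) :
    ∃ f : ℝ → Fin 2 → ℂ, f 0 = v ∧ ∀ s, HasDerivAt f ((A s).mulVec (f s)) s := by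
  -- the terms of the Picard series
  let y : ℕ → ℝ → Fin 2 → ℂ := fun n => Nat.rec (fun _ => v)
    (fun _ f t => ∫ s in (0 : ℝ)..t, (A s).mulVec (f s)) n
  have hy1 : ∀ n t, y (n + 1) t = ∫ s in (0 : ℝ)..t, (A s).mulVec (y n s) := fun n t => rfl
  have hcont : ∀ n, Continuous (y n) := by
    intro n
    induction n with
    | zero => exact continuous_const
    | succ n ih =>
      exact intervalIntegral.continuous_primitive
        (fun a b => (hA.matrix_mulVec ih).intervalIntegrable a b) 0
  have hder : ∀ n t, HasDerivAt (y (n + 1)) ((A t).mulVec (y n t)) t := fun n t =>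
    intervalIntegral.integral_hasDerivAt_right ((hA.matrix_mulVec (hcont n)).intervalIntegrable _ _)
      ((hA.matrix_mulVec (hcont n)).stronglyMeasurableAtFilter _ _)
      (hA.matrix_mulVec (hcont n)).continuousAt
  have hbound : ∀ τ K : ℝ, 0 ≤ K → (∀ s, |s - 0| ≤ τ → entryNorm (A s) ≤ K) →
      ∀ n t, |t| ≤ τ → ‖y n t‖ ≤ ‖v‖ * (K ^ n * |t| ^ n / n.factorial) := by
    intro τ K hK hAK n
    induction n with
    | zero => intro t _; simp [y]
    | succ n ih =>
      intro t ht
      rw [hy1, intervalIntegral.norm_intervalIntegral_eq]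
      have hle : ∀ s ∈ Set.uIoc 0 t, |s| ≤ |t| := by
        intro s hs
        rcases Set.mem_uIoc.1 hs with h | h
        · rw [abs_of_pos h.1, abs_of_pos (h.1.trans_le h.2)]; exact h.2
        · rw [abs_of_nonpos h.2, abs_of_neg (h.1.trans_le h.2)]; linarith [h.1]
      calc ‖∫ s in Set.uIoc 0 t, (A s).mulVec (y n s)‖
          ≤ ∫ s in Set.uIoc 0 t, K * ‖v‖ * K ^ n / n.factorial * |s - 0| ^ n := by
            refine norm_integral_le_of_norm_le ?_ ?_
            · refine (Continuous.integrableOn_Icc (a := -|t|) (b := |t|) (by fun_prop)).mono_set ?_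
              intro s hs
              exact abs_le.1 (hle s hs)
            · refine (ae_restrict_iff' measurableSet_uIoc).2 (ae_of_all _ fun s hs => ?_)
              have hs1 := (hle s hs).trans ht
              calc ‖(A s).mulVec (y n s)‖ ≤ entryNorm (A s) * ‖y n s‖ := norm_mulVec_le _ _
                _ ≤ K * (‖v‖ * (K ^ n * |s| ^ n / n.factorial)) :=
                  mul_le_mul (hAK s (by simpa using hs1)) (ih s hs1) (norm_nonneg _) hK
                _ = _ := by rw [sub_zero]; ring
        _ = _ := by
            rw [integral_const_mul, integral_pow_abs_sub_uIoc, Nat.factorial_succ]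
            push_cast
            field_simp
            ring_nf
  have hsum : ∀ τ K : ℝ, Summable fun n : ℕ => ‖v‖ * (K ^ n * τ ^ n / n.factorial) := by
    intro τ K
    have := (Real.summable_pow_div_factorial (K * τ)).mul_left ‖v‖
    simpa [mul_pow] using this
  have hys : ∀ t, Summable fun n => y n t := fun t => by
    obtain ⟨K, hK, hAK⟩ := exists_entryNorm_le hA 0 |t|
    exact Summable.of_norm_bounded (hsum |t| K) fun n => hbound |t| K hK hAK n t le_rfl
  refine ⟨fun t => ∑' n, y n t, ?_, fun t => ?_⟩
  · refine (tsum_eq_single 0 fun n hn => ?_).trans rfl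
    obtain ⟨m, rfl⟩ := Nat.exists_eq_succ_of_ne_zero hn
    simp [hy1]
  · set τ := |t| + 1 with hτ
    obtain ⟨K, hK, hAK⟩ := exists_entryNorm_le hA 0 τ
    let y' : ℕ → ℝ → Fin 2 → ℂ := fun n t => Nat.casesOn n 0 fun m => (A t).mulVec (y m t)
    let u : ℕ → ℝ := fun n => Nat.casesOn n 0 fun m => K * (‖v‖ * (K ^ m * τ ^ m / m.factorial))
    have hu : Summable u := (summable_nat_add_iff 1).1 ((hsum τ K).mul_left K)
    have h := hasDerivAt_tsum_of_isPreconnected (g := y) (g' := y') (u := u) (y₀ := t) (y := t)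
      (t := Set.Ioo (-τ) τ) hu isOpen_Ioo isPreconnected_Ioo (fun n s _ => by
        cases n with
        | zero => exact hasDerivAt_const s v
        | succ n => exact hder n s) (fun n s hs => by
        cases n with
        | zero => simp [y', u]
        | succ n =>
          have hs1 : |s| ≤ τ := abs_le.2 ⟨hs.1.le, hs.2.le⟩
          refine (norm_mulVec_le _ _).trans (mul_le_mul (hAK s (by simpa using hs1))
            ((hbound τ K hK hAK n s hs1).trans ?_) (norm_nonneg _) hK)
          gcongr) ⟨by linarith [neg_abs_le t], by linarith [le_abs_self t]⟩ (hys t)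
      ⟨by linarith [neg_abs_le t], by linarith [le_abs_self t]⟩
    refine h.congr_deriv ?_
    have hy's : Summable fun n => y' n t :=
      Summable.of_norm_bounded hu (fun n => by
        cases n with
        | zero => simp [y', u]
        | succ n =>
          have hs1 : |t| ≤ τ := by linarith
          refine (norm_mulVec_le _ _).trans (mul_le_mul (hAK t (by simpa using hs1))
            ((hbound τ K hK hAK n t hs1).trans ?_) (norm_nonneg _) hK)
          gcongr)
    rw [hy's.tsum_eq_zero_add]
    refine (zero_add _).trans ?_
    exact ((LinearMap.toContinuousLinearMap (Matrix.mulVecLin (A t))).map_tsum (hys t)).symm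

/-- Solutions of linear systems depend continuously on a parameter. -/
lemma linearODE_tendsto {ι : Type*} {l : Filter ι} {A : ι → ℝ → Matrix (Fin 2) (Fin 2) ℂ}
    {A₀ : ℝ → Matrix (Fin 2) (Fin 2) ℂ} (hA₀ : Continuous A₀)
    (hA : ∀ τ, ∀ ε > 0, ∀ᶠ i in l, ∀ s, |s| ≤ τ → entryNorm (A i s - A₀ s) ≤ ε)
    {f : ι → ℝ → Fin 2 → ℂ} {f₀ : ℝ → Fin 2 → ℂ}
    (hf : ∀ᶠ i in l, ∀ s, HasDerivAt (f i) ((A i s).mulVec (f i s)) s)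
    (hf₀ : ∀ s, HasDerivAt f₀ ((A₀ s).mulVec (f₀ s)) s)
    (h0 : Tendsto (fun i => f i 0) l (𝓝 (f₀ 0))) (s : ℝ) :
    Tendsto (fun i => f i s) l (𝓝 (f₀ s)) := by
  obtain ⟨K, hK, hAK⟩ := exists_entryNorm_le hA₀ 0 |s|
  have hc : Continuous f₀ := continuous_iff_continuousAt.2 fun s => (hf₀ s).continuousAt
  obtain ⟨M, hM⟩ := (isCompact_Icc (a := -|s|) (b := |s|)).exists_bound_of_continuousOn
    (f := f₀) hc.continuousOn
  have hM0 : 0 ≤ M := (norm_nonneg _).trans (hM 0 ⟨by simp, by simp⟩)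
  set C := Real.exp ((K + 1 + 1) * |s|) with hC
  have hCpos : 0 < C := Real.exp_pos _
  rw [Metric.tendsto_nhds] at h0 ⊢
  intro ε hε
  have hε1 : 0 < ε / (4 * C) := by positivity
  have hδ : 0 < min 1 (ε / (4 * C * (M + 1))) := by positivity
  filter_upwards [hA |s| _ hδ, h0 _ hε1, hf] with i hi hi0 hfi
  have hb := norm_le_of_hasDerivAt (A := A i) (f := fun s => f i s - f₀ s)
    (g := fun s => (A i s - A₀ s).mulVec (f₀ s)) (t₀ := 0) (τ := |s|) (K := K + 1)
    (ε := ε / (4 * C)) (s := s) (by linarith) hε1.le (fun s => ((hfi s).sub (hf₀ s)).congr_deriv (by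
      rw [Matrix.mulVec_sub, Matrix.sub_mulVec]; abel))
    (fun s' hs' => by
      have h1 := hAK s' hs'
      have h2 := (hi s' (by simpa using hs')).trans (min_le_left _ _)
      have h3 : entryNorm (A i s') ≤ entryNorm (A i s' - A₀ s') + entryNorm (A₀ s') := by
        simp only [entryNorm, ← Finset.sum_add_distrib]
        refine Finset.sum_le_sum fun a _ => Finset.sum_le_sum fun b _ => ?_
        rw [Matrix.sub_apply]
        simpa using norm_add_le (A i s' a b - A₀ s' a b) (A₀ s' a b)
      linarith)
    (fun s' hs' => by
      rw [sub_zero] at hs'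
      refine (norm_mulVec_le _ _).trans ?_
      calc entryNorm (A i s' - A₀ s') * ‖f₀ s'‖ ≤ ε / (4 * C * (M + 1)) * (M + 1) := by
            refine mul_le_mul ((hi s' hs').trans (min_le_right _ _)) ?_ (norm_nonneg _)
              (by positivity)
            linarith [hM s' (abs_le.1 hs')]
        _ = ε / (4 * C) := by field_simp) (by simp)
  rw [dist_eq_norm] at hi0 ⊢
  refine hb.trans_lt ?_
  calc (‖f i 0 - f₀ 0‖ + ε / (4 * C)) * C < (ε / (4 * C) + ε / (4 * C)) * C := by gcongr
    _ = ε / 2 := by field_simp; norm_num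
    _ < ε := by linarith

/-! ### Volterra integral operators on a half-line -/

/-- The closed upper half-plane, in which the square `z = λ²` of the spectral parameter of the
first column of `ψ₊` varies. -/
def upperClosed : Set ℂ := {z | 0 ≤ z.im}

/-- The open upper half-plane. -/
def upperOpen : Set ℂ := {z | 0 < z.im}

lemma isOpen_upperOpen : IsOpen upperOpen := isOpen_lt continuous_const Complex.continuous_im

lemma upperOpen_subset : upperOpen ⊆ upperClosed :=
  fun z (hz : 0 < z.im) => (le_of_lt hz : 0 ≤ z.im)

/-- Holomorphic dependence of an integral on a parameter, under domination of the integrand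
alone: the Cauchy estimate dominates the derivative. -/
lemma differentiableOn_integral_of_dominated {α : Type*} [MeasurableSpace α] {μ : Measure α}
    {U : Set ℂ} (hU : IsOpen U) {F : ℂ → α → ℂ} {b : α → ℝ}
    (hmeas : ∀ z ∈ U, AEStronglyMeasurable (F z) μ)
    (hdiff : ∀ᵐ y ∂μ, DifferentiableOn ℂ (fun z => F z y) U)
    (hbound : ∀ᵐ y ∂μ, ∀ z ∈ U, ‖F z y‖ ≤ b y) (hb : Integrable b μ) :
    DifferentiableOn ℂ (fun z => ∫ y, F z y ∂μ) U := by
  intro z₀ hz₀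
  obtain ⟨r, hr, hrU⟩ := Metric.isOpen_iff.1 hU z₀ hz₀
  have hr2 : 0 < r / 2 := by positivity
  have hmeas' : AEStronglyMeasurable (fun y => deriv (fun z => F z y) z₀) μ := by
    have htend : Tendsto (fun n : ℕ => z₀ + ((r / 2 / (n + 1) : ℝ) : ℂ)) atTop (𝓝[≠] z₀) := by
      rw [tendsto_nhdsWithin_iff]
      constructor
      · have h1 : Tendsto (fun n : ℕ => r / 2 / ((n : ℝ) + 1)) atTop (𝓝 0) :=
          tendsto_const_nhds.div_atTop (tendsto_atTop_add_const_right _ _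
            tendsto_natCast_atTop_atTop)
        have h2 := (Complex.continuous_ofReal.tendsto 0).comp h1
        simpa using h2.const_add z₀
      · refine Eventually.of_forall fun n => ?_
        have : (r / 2 / ((n : ℝ) + 1)) ≠ 0 := by positivity
        simpa using Complex.ofReal_ne_zero.2 this
    refine aestronglyMeasurable_of_tendsto_ae atTop
      (f := fun (n : ℕ) y => slope (fun z => F z y) z₀ (z₀ + ((r / 2 / (n + 1) : ℝ) : ℂ)))
      (fun n => ?_) ?_
    · simp only [slope_def_field, div_eq_mul_inv _ (_ - z₀)]
      refine AEStronglyMeasurable.mul_const ((hmeas _ (hrU ?_)).sub (hmeas _ hz₀)) _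
      rw [Metric.mem_ball, dist_eq_norm, add_sub_cancel_left, Complex.norm_real,
        Real.norm_of_nonneg (by positivity)]
      calc r / 2 / ((n : ℝ) + 1) ≤ r / 2 :=
            div_le_self hr2.le (by linarith [n.cast_nonneg (α := ℝ)])
        _ < r := by linarith
    · filter_upwards [hdiff] with y hy
      exact (hasDerivAt_iff_tendsto_slope.1
        ((hy z₀ hz₀).differentiableAt (hU.mem_nhds hz₀)).hasDerivAt).comp htend
  have := (hasDerivAt_integral_of_dominated_loc_of_deriv_le (μ := μ) (F := F) (x₀ := z₀)
    (s := Metric.ball z₀ (r / 2)) (bound := fun y => b y / (r / 2))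
    (F' := fun z y => deriv (fun z => F z y) z) (Metric.ball_mem_nhds _ hr2)
    (by filter_upwards [hU.mem_nhds hz₀] with z hz using hmeas z hz)
    (hb.mono' (hmeas z₀ hz₀) (hbound.mono fun y hy => hy z₀ hz₀)) hmeas' ?_ (hb.div_const _) ?_).2
  · exact this.differentiableAt.differentiableWithinAt
  · filter_upwards [hdiff, hbound] with y hy hby z hz
    have hsub : Metric.closedBall z (r / 2) ⊆ U := fun w hw => hrU (by
      rw [Metric.mem_ball] at hz ⊢
      rw [Metric.mem_closedBall] at hw
      linarith [dist_triangle w z z₀])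
    refine Complex.norm_deriv_le_of_forall_mem_sphere_norm_le hr2 ?_
      fun w hw => hby w (hsub (Metric.sphere_subset_closedBall hw))
    refine DifferentiableOn.diffContOnCl ?_
    exact hy.mono (Metric.closure_ball_subset_closedBall.trans hsub)
  · filter_upwards [hdiff] with y hy z hz
    exact ((hy z (hrU (Metric.ball_subset_ball (by linarith) hz))).differentiableAt
      (hU.mem_nhds (hrU (Metric.ball_subset_ball (by linarith) hz)))).hasDerivAt

lemma hasDerivAt_integral_Ioi {E : Type*} [NormedAddCommGroup E] [NormedSpace ℝ E]
    [CompleteSpace E] {h : ℝ → E} (hc : Continuous h)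
    (hi : ∀ x, IntegrableOn h (Set.Ioi x)) (x : ℝ) :
    HasDerivAt (fun x => ∫ y in Set.Ioi x, h y) (-h x) x := by
  have h1 : (fun x => ∫ y in Set.Ioi x, h y)
      = fun x => (∫ y in Set.Ioi (0 : ℝ), h y) - ∫ y in (0 : ℝ)..x, h y := by
    funext x
    rw [← intervalIntegral.integral_interval_add_Ioi (hi 0) (hi x), add_sub_cancel_left]
  rw [h1]
  refine ((hasDerivAt_const x _).sub (intervalIntegral.integral_hasDerivAt_right
    (hc.intervalIntegrable _ _) (hc.stronglyMeasurableAtFilter _ _) hc.continuousAt)).congr_deriv ?_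
  rw [zero_sub]

/-- The operator `f ↦ ∫_x^∞ e^{iκz(y-x)} g(y) f(y, z) dy`. -/
noncomputable def volt (κ : ℝ) (g : ℝ → ℂ) (f : ℝ → ℂ → ℂ) (x : ℝ) (z : ℂ) : ℂ :=
  ∫ y in Set.Ioi x, Complex.exp (Complex.I * κ * z * (y - x)) * g y * f y z

/-- Bounded functions on the line times the closed upper half-plane, jointly continuous and
holomorphic in the open upper half-plane. -/
structure IsReg (f : ℝ → ℂ → ℂ) : Prop where
  bdd : ∃ C, ∀ x, ∀ z ∈ upperClosed, ‖f x z‖ ≤ C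
  cont : ContinuousOn (fun p : ℝ × ℂ => f p.1 p.2) (Set.univ ×ˢ upperClosed)
  diff : ∀ x, DifferentiableOn ℂ (f x) upperOpen

lemma norm_exp_le_one {κ : ℝ} (hκ : 0 ≤ κ) {z : ℂ} (hz : z ∈ upperClosed) {x y : ℝ} (h : x ≤ y) :
    ‖Complex.exp (Complex.I * κ * z * (y - x))‖ ≤ 1 := by
  rw [Complex.norm_exp]
  have : (Complex.I * κ * z * (y - x)).re = -(κ * z.im * (y - x)) := by
    simp [Complex.mul_re, Complex.mul_im]
  rw [this]
  apply Real.exp_le_one_iff.2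
  have hz' : 0 ≤ z.im := hz
  have : 0 ≤ κ * z.im * (y - x) := mul_nonneg (mul_nonneg hκ hz') (by linarith)
  linarith

lemma IsReg.continuous_left {f : ℝ → ℂ → ℂ} (hf : IsReg f) {z : ℂ} (hz : z ∈ upperClosed) :
    Continuous fun x => f x z := by
  have : Continuous fun x : ℝ => ((x, z) : ℝ × ℂ) := by fun_prop
  exact hf.cont.comp_continuous this fun x => ⟨trivial, hz⟩

lemma IsReg.continuousOn_right {f : ℝ → ℂ → ℂ} (hf : IsReg f) (x : ℝ) :
    ContinuousOn (f x) upperClosed := by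
  have : Continuous fun z : ℂ => ((x, z) : ℝ × ℂ) := by fun_prop
  exact hf.cont.comp this.continuousOn fun z hz => ⟨trivial, hz⟩

lemma isReg_one : IsReg fun _ _ => 1 :=
  ⟨⟨1, by simp⟩, continuousOn_const, fun _ => differentiableOn_const _⟩

section Volt

variable {κ : ℝ} {g : ℝ → ℂ} {f : ℝ → ℂ → ℂ}

lemma norm_volt_integrand_le (hκ : 0 ≤ κ) {z : ℂ} (hz : z ∈ upperClosed) {x y : ℝ} (h : x ≤ y) :
    ‖Complex.exp (Complex.I * κ * z * (y - x)) * g y * f y z‖ ≤ ‖g y‖ * ‖f y z‖ := by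
  rw [norm_mul, norm_mul]
  have := norm_exp_le_one hκ hz h
  have h2 : 0 ≤ ‖g y‖ * ‖f y z‖ := by positivity
  nlinarith

lemma norm_volt_le (hκ : 0 ≤ κ) {z : ℂ} (hz : z ∈ upperClosed) {x : ℝ} {b : ℝ → ℝ}
    (hb : IntegrableOn (fun y => ‖g y‖ * b y) (Set.Ioi x)) (hfb : ∀ y, x ≤ y → ‖f y z‖ ≤ b y) :
    ‖volt κ g f x z‖ ≤ ∫ y in Set.Ioi x, ‖g y‖ * b y := by
  refine norm_integral_le_of_norm_le hb ?_
  refine (ae_restrict_iff' measurableSet_Ioi).2 (ae_of_all _ fun y hy => ?_)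
  exact (norm_volt_integrand_le hκ hz (le_of_lt hy)).trans
    (mul_le_mul_of_nonneg_left (hfb y (le_of_lt hy)) (norm_nonneg _))

lemma norm_volt_le_const (hκ : 0 ≤ κ) (hg : Integrable g) {z : ℂ} (hz : z ∈ upperClosed) {x : ℝ}
    {C : ℝ} (hfb : ∀ y, x ≤ y → ‖f y z‖ ≤ C) :
    ‖volt κ g f x z‖ ≤ (∫ y in Set.Ioi x, ‖g y‖) * C := by
  rw [← integral_mul_const]
  exact norm_volt_le hκ hz (hg.norm.mul_const C).integrableOn hfb

lemma integral_Ioi_norm_le (hg : Integrable g) (x : ℝ) :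
    ∫ y in Set.Ioi x, ‖g y‖ ≤ ∫ y, ‖g y‖ :=
  setIntegral_le_integral hg.norm (ae_of_all _ fun _ => norm_nonneg _)

lemma continuous_volt_integrand (hgc : Continuous g) (hf : IsReg f) {z : ℂ} (hz : z ∈ upperClosed)
    (x : ℝ) : Continuous fun y : ℝ => Complex.exp (Complex.I * κ * z * (y - x)) * g y * f y z := by
  have := hf.continuous_left hz
  fun_prop

lemma integrableOn_volt_integrand (hκ : 0 ≤ κ) (hgc : Continuous g) (hg : Integrable g)
    (hf : IsReg f) {z : ℂ} (hz : z ∈ upperClosed) (x : ℝ) :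
    IntegrableOn (fun y : ℝ => Complex.exp (Complex.I * κ * z * (y - x)) * g y * f y z)
      (Set.Ioi x) := by
  obtain ⟨C, hC⟩ := hf.bdd
  refine Integrable.mono' (hg.norm.mul_const C).integrableOn
    (continuous_volt_integrand hgc hf hz x).aestronglyMeasurable ?_
  refine (ae_restrict_iff' measurableSet_Ioi).2 (ae_of_all _ fun y hy => ?_)
  exact (norm_volt_integrand_le hκ hz (le_of_lt hy)).trans
    (mul_le_mul_of_nonneg_left (hC y z hz) (norm_nonneg _))

lemma IsReg.volt (hκ : 0 ≤ κ) (hgc : Continuous g) (hg : Integrable g) (hf : IsReg f) :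
    IsReg (volt κ g f) := by
  obtain ⟨C, hC⟩ := hf.bdd
  have hC0 : 0 ≤ C := (norm_nonneg _).trans (hC 0 0 (by simp [upperClosed]))
  refine ⟨⟨(∫ y, ‖g y‖) * C, fun x z hz => ?_⟩, ?_, fun x => ?_⟩
  · exact (norm_volt_le_const hκ hg hz fun y _ => hC y z hz).trans
      (mul_le_mul_of_nonneg_right (integral_Ioi_norm_le hg x) hC0)
  · rintro ⟨x₀, z₀⟩ ⟨-, hz₀⟩
    have heq : (fun p : ℝ × ℂ => TOFKN.volt κ g f p.1 p.2) = fun p : ℝ × ℂ => ∫ y : ℝ,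
        (Set.Ioi p.1).indicator (fun y : ℝ =>
          Complex.exp (Complex.I * κ * p.2 * (y - p.1)) * g y * f y p.2) y := by
      funext p
      rw [integral_indicator measurableSet_Ioi]; rfl
    rw [heq]
    refine tendsto_integral_filter_of_dominated_convergence (fun y => ‖g y‖ * C) ?_ ?_
      (hg.norm.mul_const C) ?_
    · filter_upwards [self_mem_nhdsWithin] with p hp
      exact ((continuous_volt_integrand hgc hf hp.2 p.1).aestronglyMeasurable).indicator
        measurableSet_Ioi
    · filter_upwards [self_mem_nhdsWithin] with p hp
      refine ae_of_all _ fun y => ?_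
      by_cases hy : y ∈ Set.Ioi p.1
      · rw [Set.indicator_of_mem hy]
        exact (norm_volt_integrand_le hκ hp.2 (le_of_lt hy)).trans
          (mul_le_mul_of_nonneg_left (hC y _ hp.2) (norm_nonneg _))
      · rw [Set.indicator_of_notMem hy, norm_zero]; positivity
    · have hne : ∀ᵐ y : ℝ, y ≠ x₀ := by
        rw [ae_iff]; simp
      filter_upwards [hne] with y hy
      have hlim : Tendsto (fun p : ℝ × ℂ =>
          Complex.exp (Complex.I * κ * p.2 * (y - p.1)) * g y * f y p.2)
          (𝓝[Set.univ ×ˢ upperClosed] (x₀, z₀))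
          (𝓝 (Complex.exp (Complex.I * κ * z₀ * (y - x₀)) * g y * f y z₀)) := by
        refine Tendsto.mul (Tendsto.mul_const _ ?_) ?_
        · have : Continuous fun p : ℝ × ℂ => Complex.exp (Complex.I * κ * p.2 * (y - p.1)) := by
            fun_prop
          exact (this.tendsto (x₀, z₀)).mono_left nhdsWithin_le_nhds
        · have h1 := hf.continuousOn_right y z₀ hz₀
          refine h1.tendsto.comp ?_
          refine tendsto_nhdsWithin_iff.2 ⟨(continuous_snd.tendsto (x₀, z₀)).mono_left
            nhdsWithin_le_nhds, ?_⟩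
          filter_upwards [self_mem_nhdsWithin] with p hp using hp.2
      have hfst : Tendsto (fun p : ℝ × ℂ => p.1) (𝓝[Set.univ ×ˢ upperClosed] (x₀, z₀)) (𝓝 x₀) :=
        (continuous_fst.tendsto (x₀, z₀)).mono_left nhdsWithin_le_nhds
      rcases lt_or_gt_of_ne hy with h | h
      · rw [Set.indicator_of_notMem (by simpa using h.le)]
        refine tendsto_const_nhds.congr' ?_
        filter_upwards [hfst.eventually (lt_mem_nhds h)] with p hp
        rw [Set.indicator_of_notMem (by simpa using hp.le)]
      · rw [Set.indicator_of_mem (by simpa using h)]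
        refine hlim.congr' ?_
        filter_upwards [hfst.eventually (gt_mem_nhds h)] with p hp
        rw [Set.indicator_of_mem (by simpa using hp)]
  · refine differentiableOn_integral_of_dominated isOpen_upperOpen (b := fun y => ‖g y‖ * C)
      (fun z hz => (continuous_volt_integrand hgc hf (upperOpen_subset hz) x).aestronglyMeasurable)
      (ae_of_all _ fun y => ?_) ?_ (hg.norm.mul_const C).integrableOn
    · refine DifferentiableOn.mul (DifferentiableOn.mul ?_ (differentiableOn_const _)) (hf.diff y)
      exact Differentiable.differentiableOn (by fun_prop)
    · refine (ae_restrict_iff' measurableSet_Ioi).2 (ae_of_all _ fun y hy z hz => ?_)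
      exact (norm_volt_integrand_le hκ (upperOpen_subset hz) (le_of_lt hy)).trans
        (mul_le_mul_of_nonneg_left (hC y z (upperOpen_subset hz)) (norm_nonneg _))

lemma hasDerivAt_volt (hκ : 0 ≤ κ) (hgc : Continuous g) (hg : Integrable g) (hf : IsReg f) {z : ℂ}
    (hz : z ∈ upperClosed) (x : ℝ) :
    HasDerivAt (fun x => volt κ g f x z)
      (-(Complex.I * κ * z) * volt κ g f x z - g x * f x z) x := by
  have hsplit : ∀ x y : ℝ, Complex.exp (Complex.I * κ * z * (y - x)) * g y * f y z
      = Complex.exp (-(Complex.I * κ * z * x))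
        * (Complex.exp (Complex.I * κ * z * (y - (0 : ℝ))) * g y * f y z) := fun x y => by
    rw [← mul_assoc, ← mul_assoc, ← Complex.exp_add]
    congr 3; push_cast; ring
  have heq : (fun x => volt κ g f x z) = fun x : ℝ => Complex.exp (-(Complex.I * κ * z * x))
      * ∫ y in Set.Ioi x, Complex.exp (Complex.I * κ * z * (y - (0 : ℝ))) * g y * f y z := by
    funext x
    rw [← integral_const_mul]
    exact integral_congr_ae (ae_of_all _ fun y => hsplit x y)
  have hi : ∀ x, IntegrableOn (fun y : ℝ =>
      Complex.exp (Complex.I * κ * z * (y - (0 : ℝ))) * g y * f y z) (Set.Ioi x) := fun x => by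
    have h1 := (integrableOn_volt_integrand hκ hgc hg hf hz x).const_mul
      (Complex.exp (Complex.I * κ * z * x))
    refine h1.congr (ae_of_all _ fun y => ?_)
    change _ * (_ * _ * _) = _
    rw [hsplit x y, ← mul_assoc, ← Complex.exp_add]
    simp
  have h1 := hasDerivAt_integral_Ioi (continuous_volt_integrand hgc hf hz 0) hi x
  have h2 : HasDerivAt (fun x : ℝ => Complex.exp (-(Complex.I * κ * z * x)))
      (Complex.exp (-(Complex.I * κ * z * x)) * (-(Complex.I * κ * z))) x := by
    have h3 : HasDerivAt (fun x : ℝ => -(Complex.I * κ * z * x)) (-(Complex.I * κ * z * 1)) x :=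
      ((Complex.ofRealCLM.hasDerivAt (x := x)).const_mul _).neg
    rw [mul_one] at h3
    exact h3.cexp
  have hv := congrFun heq x
  rw [hv, heq]
  refine (h2.mul h1).congr_deriv ?_
  have h4 := hsplit x x
  simp only [sub_self, mul_zero, Complex.exp_zero, one_mul] at h4
  rw [h4]; ring

lemma tendsto_volt_atTop (hκ : 0 ≤ κ) (hg : Integrable g) (hf : IsReg f) {z : ℂ}
    (hz : z ∈ upperClosed) : Tendsto (fun x => volt κ g f x z) atTop (𝓝 0) := by
  obtain ⟨C, hC⟩ := hf.bdd
  have h1 : Tendsto (fun x => (∫ y in Set.Ioi x, ‖g y‖) * C) atTop (𝓝 0) := by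
    simpa using (tendsto_integral_Ioi_zero (f := fun y => ‖g y‖) (μ := volume)
      (tendsto_id (α := ℝ))).mul_const C
  exact squeeze_zero_norm (fun x => norm_volt_le_const hκ hg hz fun y _ => hC y z hz) h1

lemma volt_sub (hκ : 0 ≤ κ) (hgc : Continuous g) (hg : Integrable g) {f₁ f₂ : ℝ → ℂ → ℂ}
    (h1 : IsReg f₁) (h2 : IsReg f₂) {z : ℂ} (hz : z ∈ upperClosed) (x : ℝ) :
    volt κ g (fun x z => f₁ x z - f₂ x z) x z = volt κ g f₁ x z - volt κ g f₂ x z := by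
  unfold volt
  rw [← integral_sub (integrableOn_volt_integrand hκ hgc hg h1 hz x)
    (integrableOn_volt_integrand hκ hgc hg h2 hz x)]
  simp only [mul_sub]

lemma volt_add (hκ : 0 ≤ κ) (hgc : Continuous g) (hg : Integrable g) {f₁ f₂ : ℝ → ℂ → ℂ}
    (h1 : IsReg f₁) (h2 : IsReg f₂) {z : ℂ} (hz : z ∈ upperClosed) (x : ℝ) :
    volt κ g (fun x z => f₁ x z + f₂ x z) x z = volt κ g f₁ x z + volt κ g f₂ x z := by
  unfold volt
  rw [← integral_add (integrableOn_volt_integrand hκ hgc hg h1 hz x)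
    (integrableOn_volt_integrand hκ hgc hg h2 hz x)]
  simp only [mul_add]

end Volt

lemma IsReg.add {f₁ f₂ : ℝ → ℂ → ℂ} (h1 : IsReg f₁) (h2 : IsReg f₂) :
    IsReg fun x z => f₁ x z + f₂ x z := by
  obtain ⟨C₁, hC₁⟩ := h1.bdd
  obtain ⟨C₂, hC₂⟩ := h2.bdd
  exact ⟨⟨C₁ + C₂, fun x z hz => (norm_add_le _ _).trans (add_le_add (hC₁ x z hz) (hC₂ x z hz))⟩,
    h1.cont.add h2.cont, fun x => (h1.diff x).add (h2.diff x)⟩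

lemma IsReg.neg {f : ℝ → ℂ → ℂ} (h : IsReg f) : IsReg fun x z => -f x z := by
  obtain ⟨C, hC⟩ := h.bdd
  exact ⟨⟨C, fun x z hz => by rw [norm_neg]; exact hC x z hz⟩, h.cont.neg, fun x => (h.diff x).neg⟩

lemma IsReg.congr {f₁ f₂ : ℝ → ℂ → ℂ} (h1 : IsReg f₁)
    (h : ∀ x, ∀ z ∈ upperClosed, f₂ x z = f₁ x z) : IsReg f₂ := by
  obtain ⟨C, hC⟩ := h1.bdd
  exact ⟨⟨C, fun x z hz => by rw [h x z hz]; exact hC x z hz⟩,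
    h1.cont.congr fun p hp => h p.1 p.2 hp.2,
    fun x => (h1.diff x).congr fun z hz => h x z (upperOpen_subset hz)⟩

/-- Multiplication by a bounded continuous function of `x` preserves regularity. -/
lemma IsReg.mul_left {f : ℝ → ℂ → ℂ} (h : IsReg f) {e : ℝ → ℂ} (he : Continuous e) {K : ℝ}
    (hK : ∀ x, ‖e x‖ ≤ K) : IsReg fun x z => e x * f x z := by
  obtain ⟨C, hC⟩ := h.bdd
  refine ⟨⟨K * C, fun x z hz => ?_⟩, ?_, fun x => (h.diff x).const_mul _⟩
  · rw [norm_mul]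
    exact mul_le_mul (hK x) (hC x z hz) (norm_nonneg _) ((norm_nonneg _).trans (hK x))
  · exact ((he.comp continuous_fst).continuousOn).mul h.cont

/-! ### The Volterra equation of the Jost functions -/

section VolterraEquation

variable {p s : ℝ → ℂ}

/-- The terms of the Neumann series of `A = 1 + ∫_x^∞ p ∫_y^∞ e^{2iz(w-y)} s A`. -/
noncomputable def neumannTerm (p s : ℝ → ℂ) : ℕ → ℝ → ℂ → ℂ
  | 0 => fun _ _ => 1
  | n + 1 => volt 0 p (volt 2 s (neumannTerm p s n))

lemma isReg_neumannTerm (hpc : Continuous p) (hp : Integrable p) (hsc : Continuous s)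
    (hs : Integrable s) (n : ℕ) : IsReg (neumannTerm p s n) := by
  induction n with
  | zero => exact isReg_one
  | succ n ih => exact (ih.volt zero_le_two hsc hs).volt le_rfl hpc hp

/-- The weight `exp (μ ∫_x^∞ |s|)` turns the Volterra operator into a contraction. -/
lemma integral_Ioi_mul_exp_tail_le (hsc : Continuous s) (hs : Integrable s) {μ : ℝ} (hμ : 0 < μ)
    (x : ℝ) :
    IntegrableOn (fun y => ‖s y‖ * Real.exp (μ * ∫ w in Set.Ioi y, ‖s w‖)) (Set.Ioi x) ∧
    ∫ y in Set.Ioi x, ‖s y‖ * Real.exp (μ * ∫ w in Set.Ioi y, ‖s w‖)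
      ≤ Real.exp (μ * ∫ w in Set.Ioi x, ‖s w‖) / μ := by
  have hder : ∀ y ∈ Set.Ici x, HasDerivAt
      (fun y => -(Real.exp (μ * ∫ w in Set.Ioi y, ‖s w‖) / μ))
      (‖s y‖ * Real.exp (μ * ∫ w in Set.Ioi y, ‖s w‖)) y := fun y _ => by
    have h1 := hasDerivAt_integral_Ioi hsc.norm (fun x => hs.norm.integrableOn) y
    refine ((((h1.const_mul μ).exp).div_const μ).neg).congr_deriv ?_
    field_simp
  have hlim : Tendsto (fun y => -(Real.exp (μ * ∫ w in Set.Ioi y, ‖s w‖) / μ)) atTop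
      (𝓝 (-(Real.exp (μ * 0) / μ))) := by
    have h1 := tendsto_integral_Ioi_zero (f := fun y => ‖s y‖) (μ := volume) (tendsto_id (α := ℝ))
    exact (((Real.continuous_exp.tendsto _).comp (h1.const_mul μ)).div_const μ).neg
  have hpos : ∀ y ∈ Set.Ioi x, 0 ≤ ‖s y‖ * Real.exp (μ * ∫ w in Set.Ioi y, ‖s w‖) :=
    fun y _ => by positivity
  refine ⟨integrableOn_Ioi_deriv_of_nonneg' hder hpos hlim, ?_⟩
  rw [integral_Ioi_of_hasDerivAt_of_nonneg' hder hpos hlim]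
  have : 0 < Real.exp (μ * 0) / μ := by positivity
  linarith

/-- Exponential weights in the tail of `‖s‖` make the Neumann series converge geometrically,
without any smallness of `p` and `s`: integration against `‖s‖` gains the factor `1/μ`, which
beats `∫ ‖p‖ ≤ μ/2`. -/
lemma norm_neumannTerm_le (hp : Integrable p) (hsc : Continuous s)
    (hs : Integrable s) (n : ℕ) (x : ℝ) {z : ℂ} (hz : z ∈ upperClosed) :
    ‖neumannTerm p s n x z‖ ≤ (1 / 2) ^ n *
      Real.exp (2 * ((∫ y, ‖p y‖) + 1) * ∫ w in Set.Ioi x, ‖s w‖) := by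
  have hI : 0 ≤ ∫ y, ‖p y‖ := integral_nonneg fun _ => norm_nonneg _
  set μ := 2 * ((∫ y, ‖p y‖) + 1) with hμ
  have hμ0 : 0 < μ := by positivity
  induction n generalizing x with
  | zero =>
    simp only [neumannTerm, norm_one, pow_zero, one_mul]
    apply Real.one_le_exp
    have : 0 ≤ ∫ w in Set.Ioi x, ‖s w‖ := integral_nonneg fun _ => norm_nonneg _
    positivity
  | succ n ih =>
    have h1 : ∀ y, ‖volt 2 s (neumannTerm p s n) y z‖ ≤
        (1 / 2) ^ n * (Real.exp (μ * ∫ w in Set.Ioi y, ‖s w‖) / μ) := fun y => by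
      obtain ⟨hint, hle⟩ := integral_Ioi_mul_exp_tail_le hsc hs hμ0 y
      refine (norm_volt_le (b := fun y => (1 / 2) ^ n * Real.exp (μ * ∫ w in Set.Ioi y, ‖s w‖))
        zero_le_two hz ?_ fun y _ => ih y).trans ?_
      · refine (hint.const_mul ((1 / 2) ^ n)).congr (ae_of_all _ fun y => ?_)
        ring
      · refine le_trans (le_of_eq ?_) (mul_le_mul_of_nonneg_left hle (by positivity))
        rw [← integral_const_mul]
        exact integral_congr_ae (ae_of_all _ fun y => by ring)
    have hmono : ∀ y, x ≤ y → ∫ w in Set.Ioi y, ‖s w‖ ≤ ∫ w in Set.Ioi x, ‖s w‖ := fun y hy =>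
      setIntegral_mono_set hs.norm.integrableOn (ae_of_all _ fun _ => norm_nonneg _)
        (Set.Ioi_subset_Ioi hy).eventuallyLE
    have h2 : ∀ y, x ≤ y → ‖volt 2 s (neumannTerm p s n) y z‖ ≤
        (1 / 2) ^ n * (Real.exp (μ * ∫ w in Set.Ioi x, ‖s w‖) / μ) := fun y hy => by
      refine (h1 y).trans ?_
      have := hmono y hy
      gcongr
    refine (norm_volt_le_const le_rfl hp hz h2).trans ?_
    have h3 : (∫ y in Set.Ioi x, ‖p y‖) ≤ μ / 2 := by
      have := integral_Ioi_norm_le hp x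
      rw [hμ]; linarith
    refine (mul_le_mul_of_nonneg_right h3 (by positivity)).trans (le_of_eq ?_)
    field_simp
    ring

/-- Solution of the Volterra system `A = 1 - ∫_x^∞ p V`, `V = -∫_x^∞ e^{2iz(y-x)} s A`. -/
theorem exists_volterra (hpc : Continuous p) (hp : Integrable p) (hsc : Continuous s)
    (hs : Integrable s) : ∃ A V : ℝ → ℂ → ℂ, IsReg A ∧ IsReg V ∧
      (∀ x, ∀ z ∈ upperClosed, A x z = 1 - volt 0 p V x z) ∧
      (∀ x, ∀ z, V x z = -volt 2 s A x z) := by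
  have hI : 0 ≤ ∫ y, ‖p y‖ := integral_nonneg fun _ => norm_nonneg _
  set μ := 2 * ((∫ y, ‖p y‖) + 1) with hμ
  set C := Real.exp (μ * ∫ y, ‖s y‖) with hC
  have hd : ∀ n x, ∀ z ∈ upperClosed, ‖neumannTerm p s n x z‖ ≤ (1 / 2) ^ n * C :=
    fun n x z hz => by
      refine (norm_neumannTerm_le hp hsc hs n x hz).trans ?_
      have := integral_Ioi_norm_le hs x
      have : 0 ≤ μ := by positivity
      rw [hC, ← hμ]
      gcongr
  have hreg := isReg_neumannTerm hpc hp hsc hs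
  have hsum : Summable fun n : ℕ => (1 / 2 : ℝ) ^ n * C :=
    (summable_geometric_of_lt_one (by norm_num) (by norm_num)).mul_right C
  set A : ℝ → ℂ → ℂ := fun x z => ∑' n, neumannTerm p s n x z with hA
  set S : ℕ → ℝ → ℂ → ℂ := fun N x z => ∑ n ∈ Finset.range N, neumannTerm p s n x z with hS
  have hunif : TendstoUniformlyOn (fun N (q : ℝ × ℂ) => S N q.1 q.2) (fun q => A q.1 q.2) atTop
      (Set.univ ×ˢ upperClosed) :=
    tendstoUniformlyOn_tsum_nat hsum fun n q hq => hd n q.1 q.2 hq.2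
  have hSreg : ∀ N, IsReg (S N) := by
    intro N
    induction N with
    | zero => exact ⟨⟨0, by simp [hS]⟩, by simpa [hS] using continuousOn_const,
        fun x => by simp [hS]⟩
    | succ N ih =>
      refine (ih.add (hreg N)).congr fun x z _ => ?_
      simp only [hS, Finset.sum_range_succ]
  have hAreg : IsReg A := by
    refine ⟨⟨∑' n : ℕ, (1 / 2 : ℝ) ^ n * C, fun x z hz => tsum_of_norm_bounded hsum.hasSum
      fun n => hd n x z hz⟩,
      hunif.continuousOn (Eventually.of_forall fun N => (hSreg N).cont).frequently,
      fun x => ?_⟩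
    have h1 : TendstoUniformlyOn (fun N z => S N x z) (A x) atTop upperOpen := by
      have := hunif.comp (fun z : ℂ => ((x, z) : ℝ × ℂ))
      exact this.mono fun z hz => ⟨trivial, upperOpen_subset hz⟩
    exact h1.tendstoLocallyUniformlyOn.differentiableOn
      (Eventually.of_forall fun N => (hSreg N).diff x) isOpen_upperOpen
  have hVreg : IsReg (volt 2 s A) := hAreg.volt zero_le_two hsc hs
  -- the recursion of the partial sums, which becomes the Volterra equation in the limit
  have hstep : ∀ N x, ∀ z ∈ upperClosed,
      S (N + 1) x z = 1 + volt 0 p (volt 2 s (S N)) x z := by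
    intro N
    induction N with
    | zero => intro x z _; simp [hS, neumannTerm, volt]
    | succ N ih =>
      intro x z hz
      have h1 : S (N + 2) x z = S (N + 1) x z + neumannTerm p s (N + 1) x z :=
        Finset.sum_range_succ _ _
      have h2 : volt 2 s (S (N + 1))
          = fun x z => volt 2 s (fun x z => S N x z + neumannTerm p s N x z) x z := by
        have : S (N + 1) = fun x z => S N x z + neumannTerm p s N x z := by
          funext x z; exact Finset.sum_range_succ _ _
        rw [this]
      have h3 : volt 0 p (volt 2 s (S (N + 1))) x z = volt 0 p (fun x z =>
          volt 2 s (S N) x z + volt 2 s (neumannTerm p s N) x z) x z := by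
        rw [h2]
        refine integral_congr_ae (ae_of_all _ fun y => ?_)
        simp only
        rw [volt_add zero_le_two hsc hs (hSreg N) (hreg N) hz]
      rw [h1, ih x z hz, h3, volt_add le_rfl hpc hp ((hSreg N).volt zero_le_two hsc hs)
        ((hreg N).volt zero_le_two hsc hs) hz]
      simp only [neumannTerm]
      ring
  refine ⟨A, fun x z => -volt 2 s A x z, hAreg, hVreg.neg, fun x z hz => ?_, fun _ _ => rfl⟩
  have hneg : volt 0 p (fun x z => -volt 2 s A x z) x z = -volt 0 p (volt 2 s A) x z := by
    unfold volt
    rw [← integral_neg]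
    refine integral_congr_ae (ae_of_all _ fun y => ?_)
    ring
  rw [hneg, sub_neg_eq_add]
  have hpt : Tendsto (fun N => S (N + 1) x z) atTop (𝓝 (A x z)) :=
    (hunif.tendsto_at (x := (x, z)) ⟨trivial, hz⟩).comp (tendsto_add_atTop_nat 1)
  refine tendsto_nhds_unique hpt ?_
  simp only [fun N => hstep N x z hz]
  refine Tendsto.const_add _ ?_
  rw [Metric.tendsto_nhds]
  intro ε hε
  have hJ : 0 ≤ ∫ y, ‖s y‖ := integral_nonneg fun _ => norm_nonneg _
  set K := ((∫ y, ‖p y‖) + 1) * ((∫ y, ‖s y‖) + 1) with hK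
  have hK0 : 0 < K := by positivity
  filter_upwards [(Metric.tendstoUniformlyOn_iff.1 hunif) (ε / K) (by positivity)] with N hN
  have hdiffreg : IsReg fun x z => S N x z - A x z := by
    simpa only [sub_eq_add_neg] using (hSreg N).add hAreg.neg
  have h1 : ∀ y, volt 2 s (fun x z => S N x z - A x z) y z
      = volt 2 s (S N) y z - volt 2 s A y z := fun y =>
    volt_sub zero_le_two hsc hs (hSreg N) hAreg hz y
  have h2 : ∀ y, x ≤ y → ‖volt 2 s (S N) y z - volt 2 s A y z‖
      ≤ (∫ y, ‖s y‖) * (ε / K) := fun y _ => by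
    rw [← h1]
    refine (norm_volt_le_const (C := ε / K) zero_le_two hs hz fun w _ => ?_).trans
      (mul_le_mul_of_nonneg_right (integral_Ioi_norm_le hs y) (by positivity))
    have := hN (w, z) ⟨trivial, hz⟩
    rw [dist_comm, dist_eq_norm] at this
    exact this.le
  have h3 := norm_volt_le_const (f := fun x z => volt 2 s (S N) x z - volt 2 s A x z)
    (κ := 0) le_rfl hp hz h2
  rw [volt_sub le_rfl hpc hp ((hSreg N).volt zero_le_two hsc hs) hVreg hz] at h3
  rw [dist_eq_norm]
  refine h3.trans_lt ?_
  calc (∫ y in Set.Ioi x, ‖p y‖) * ((∫ y, ‖s y‖) * (ε / K))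
      ≤ (∫ y, ‖p y‖) * ((∫ y, ‖s y‖) * (ε / K)) :=
        mul_le_mul_of_nonneg_right (integral_Ioi_norm_le hp x) (by positivity)
    _ < K * (ε / K) := by
        have : 0 < ε / K := by positivity
        have h5 : (∫ y, ‖p y‖) * (∫ y, ‖s y‖) < K := by rw [hK]; nlinarith
        nlinarith
    _ = ε := by field_simp

/-- A form of the Riemann-Lebesgue lemma in the closed half-plane. The amplitude `A` may depend
on `z` as long as it is bounded together with its derivative `p V`, uniformly in `z`. -/
lemma tendsto_volterra_cobounded {A V : ℝ → ℂ → ℂ} (hpc : Continuous p)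
    (hsc : Continuous s) (hs : Integrable s) (hA : IsReg A) (hV : IsReg V)
    (hder : ∀ x, ∀ z ∈ upperClosed, HasDerivAt (fun x => A x z) (p x * V x z) x) (x : ℝ) :
    Tendsto (fun z => volt 2 s A x z) (Bornology.cobounded ℂ ⊓ 𝓟 upperClosed) (𝓝 0) := by
  obtain ⟨C, hC⟩ := hA.bdd
  obtain ⟨C', hC'⟩ := hV.bdd
  have h0 : (0 : ℂ) ∈ upperClosed := by simp [upperClosed]
  have hC0 : 0 ≤ C := (norm_nonneg _).trans (hC 0 0 h0)
  have hC'0 : 0 ≤ C' := (norm_nonneg _).trans (hC' 0 0 h0)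
  rw [Metric.tendsto_nhds]
  intro ε hε
  have htail : Tendsto (fun R => (∫ y in Set.Ioi R, ‖s y‖) * C) atTop (𝓝 0) := by
    simpa using (tendsto_integral_Ioi_zero (f := fun y => ‖s y‖) (μ := volume)
      (tendsto_id (α := ℝ))).mul_const C
  obtain ⟨R, hR, hxR⟩ := ((htail.eventually (gt_mem_nhds (show (0 : ℝ) < ε / 3 by positivity))).and
    (eventually_ge_atTop x)).exists
  set δ := ε / (6 * ((R - x + 1) * (C + 1))) with hδ
  have hRx : 0 ≤ R - x := by linarith
  have hδ0 : 0 < δ := by positivity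
  -- polynomial approximation of `s`, which makes integration by parts possible
  obtain ⟨P₁, hP₁⟩ := exists_polynomial_near_of_continuousOn x R (fun y => (s y).re)
    (Complex.continuous_re.comp hsc).continuousOn δ hδ0
  obtain ⟨P₂, hP₂⟩ := exists_polynomial_near_of_continuousOn x R (fun y => (s y).im)
    (Complex.continuous_im.comp hsc).continuousOn δ hδ0
  set P : ℝ → ℂ := fun y => ((P₁.eval y : ℝ) : ℂ) + Complex.I * ((P₂.eval y : ℝ) : ℂ) with hP
  set P' : ℝ → ℂ := fun y => ((P₁.derivative.eval y : ℝ) : ℂ)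
    + Complex.I * ((P₂.derivative.eval y : ℝ) : ℂ)
    with hP'
  have hPd : ∀ y, HasDerivAt P (P' y) y := fun y =>
    (P₁.hasDerivAt y).ofReal_comp.add (((P₂.hasDerivAt y).ofReal_comp).const_mul _)
  have hPc : Continuous P := by
    have h1 := P₁.continuous
    have h2 := P₂.continuous
    simp only [hP]; fun_prop
  have hP'c : Continuous P' := by
    have h1 := P₁.derivative.continuous
    have h2 := P₂.derivative.continuous
    simp only [hP']; fun_prop
  have hclose : ∀ y ∈ Set.Icc x R, ‖s y - P y‖ ≤ 2 * δ := fun y hy => by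
    refine (Complex.norm_le_abs_re_add_abs_im _).trans ?_
    have h1 := hP₁ y hy
    have h2 := hP₂ y hy
    have h3 : (s y - P y).re = -(P₁.eval y - (s y).re) := by simp [hP]
    have h4 : (s y - P y).im = -(P₂.eval y - (s y).im) := by simp [hP]
    rw [h3, h4, abs_neg, abs_neg]; linarith
  -- a bound, uniform in `z`, for the boundary terms and the integrand after integration by parts
  obtain ⟨M₁, hM₁⟩ := (isCompact_Icc (a := x) (b := R)).exists_bound_of_continuousOn
    hPc.continuousOn
  obtain ⟨M₂, hM₂⟩ := (isCompact_Icc (a := x) (b := R)).exists_bound_of_continuousOn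
    hP'c.continuousOn
  obtain ⟨M₃, hM₃⟩ := (isCompact_Icc (a := x) (b := R)).exists_bound_of_continuousOn
    hpc.continuousOn
  have hM₁0 : 0 ≤ M₁ := (norm_nonneg _).trans (hM₁ x ⟨le_rfl, hxR⟩)
  have hM₂0 : 0 ≤ M₂ := (norm_nonneg _).trans (hM₂ x ⟨le_rfl, hxR⟩)
  have hM₃0 : 0 ≤ M₃ := (norm_nonneg _).trans (hM₃ x ⟨le_rfl, hxR⟩)
  set D := M₂ * C + M₁ * (M₃ * C') with hD
  have hD0 : 0 ≤ D := by positivity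
  set K := 2 * (M₁ * C) + D * (R - x) with hK
  have hK0 : 0 ≤ K := by positivity
  have hparts : ∀ z ∈ upperClosed, z ≠ 0 →
      ‖∫ y in x..R, Complex.exp (Complex.I * (2 : ℝ) * z * (y - x)) * P y * A y z‖
        ≤ K / (2 * ‖z‖) := by
    intro z hz hz0
    have hAc := hA.continuous_left hz
    have hVc := hV.continuous_left hz
    set e : ℝ → ℂ := fun y => Complex.exp (Complex.I * (2 : ℝ) * z * (y - x)) with he
    have hec : Continuous e := by simp only [he]; fun_prop
    have hed : ∀ y, HasDerivAt e (e y * (2 * Complex.I * z)) y := fun y => by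
      have h3 : HasDerivAt (fun y : ℝ => Complex.I * (2 : ℝ) * z * ((y : ℂ) - x))
          (Complex.I * (2 : ℝ) * z * 1) y :=
        ((Complex.ofRealCLM.hasDerivAt (x := y)).sub_const _).const_mul _
      refine h3.cexp.congr_deriv ?_
      simp only [he]; push_cast; ring
    have hder2 : ∀ y ∈ Set.uIcc x R, HasDerivAt (fun y => e y * (P y * A y z))
        (2 * Complex.I * z * (e y * P y * A y z)
          + e y * (P' y * A y z + P y * (p y * V y z))) y := fun y _ => by
      refine ((hed y).mul ((hPd y).mul (hder y z hz))).congr_deriv ?_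
      simp only [Pi.mul_apply]
      ring
    have hcont1 : Continuous fun y => e y * P y * A y z := by fun_prop
    have hcont2 : Continuous fun y => e y * (P' y * A y z + P y * (p y * V y z)) := by fun_prop
    have hFTC := intervalIntegral.integral_eq_sub_of_hasDerivAt hder2
      ((by fun_prop : Continuous _).intervalIntegrable x R)
    rw [intervalIntegral.integral_add
      ((by fun_prop :
          Continuous fun y => 2 * Complex.I * z * (e y * P y * A y z)).intervalIntegrable
        _ _)
      (hcont2.intervalIntegrable _ _), intervalIntegral.integral_const_mul] at hFTC
    have hen : ∀ y, x ≤ y → ‖e y‖ ≤ 1 := fun y hy => norm_exp_le_one zero_le_two hz hy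
    have hb : ∀ y ∈ Set.Icc x R, ‖e y * (P y * A y z)‖ ≤ M₁ * C := fun y hy => by
      rw [norm_mul, norm_mul, ← one_mul (M₁ * C)]
      exact mul_le_mul (hen y hy.1) (mul_le_mul (hM₁ y hy) (hC y z hz) (norm_nonneg _) hM₁0)
        (by positivity) zero_le_one
    have hint : ‖∫ y in x..R, e y * (P' y * A y z + P y * (p y * V y z))‖ ≤ D * |R - x| := by
      refine intervalIntegral.norm_integral_le_of_norm_le_const fun y hy => ?_
      rw [Set.uIoc_of_le hxR] at hy
      have hy' : y ∈ Set.Icc x R := ⟨hy.1.le, hy.2⟩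
      rw [norm_mul, ← one_mul D]
      refine mul_le_mul (hen y hy'.1) ((norm_add_le _ _).trans (add_le_add ?_ ?_))
        (norm_nonneg _) zero_le_one
      · rw [norm_mul]
        exact mul_le_mul (hM₂ y hy') (hC y z hz) (norm_nonneg _) hM₂0
      · rw [norm_mul, norm_mul]
        exact mul_le_mul (hM₁ y hy') (mul_le_mul (hM₃ y hy') (hC' y z hz) (norm_nonneg _) hM₃0)
          (by positivity) hM₁0
    rw [abs_of_nonneg hRx] at hint
    have hzn : 0 < ‖z‖ := norm_pos_iff.2 hz0
    rw [le_div_iff₀ (by positivity)]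
    have hmain : 2 * Complex.I * z * (∫ y in x..R, e y * P y * A y z)
        = (e R * (P R * A R z) - e x * (P x * A x z))
          - ∫ y in x..R, e y * (P' y * A y z + P y * (p y * V y z)) := by
      rw [← hFTC]; ring
    have hnorm := congrArg norm hmain
    rw [norm_mul, norm_mul, norm_mul, Complex.norm_I] at hnorm
    simp only [Complex.norm_ofNat, mul_one] at hnorm
    calc _ = 2 * ‖z‖ * ‖∫ y in x..R, e y * P y * A y z‖ := by rw [mul_comm]
      _ ≤ _ := by
        rw [hnorm, hK]
        refine (norm_sub_le _ _).trans (add_le_add ((norm_sub_le _ _).trans ?_) hint)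
        linarith [hb R ⟨hxR, le_rfl⟩, hb x ⟨le_rfl, hxR⟩]
  have hlarge : ∀ᶠ z in Bornology.cobounded ℂ ⊓ 𝓟 upperClosed, 1 + K / ε * 3 ≤ ‖z‖ :=
    (tendsto_norm_cobounded_atTop.eventually (eventually_ge_atTop _)).filter_mono inf_le_left
  have hmem : ∀ᶠ z in Bornology.cobounded ℂ ⊓ 𝓟 upperClosed, z ∈ upperClosed :=
    (mem_principal_self _ : upperClosed ∈ 𝓟 upperClosed) |> fun h => mem_inf_of_right h
  filter_upwards [hlarge, hmem] with z hzl hz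
  have hzn : 0 < ‖z‖ := by
    have : 0 ≤ K / ε * 3 := by positivity
    linarith
  have hAc := hA.continuous_left hz
  have hsplit : volt 2 s A x z
      = (∫ y in x..R, Complex.exp (Complex.I * (2 : ℝ) * z * (y - x)) * s y * A y z)
        + ∫ y in Set.Ioi R, Complex.exp (Complex.I * (2 : ℝ) * z * (y - x)) * s y * A y z := by
    have h1 := integrableOn_volt_integrand (κ := 2) zero_le_two hsc hs hA hz x
    rw [intervalIntegral.integral_interval_add_Ioi h1 (h1.mono_set (Set.Ioi_subset_Ioi hxR))]
    rfl
  have h1 : ‖∫ y in Set.Ioi R, Complex.exp (Complex.I * (2 : ℝ) * z * (y - x)) * s y * A y z‖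
      ≤ (∫ y in Set.Ioi R, ‖s y‖) * C := by
    rw [← integral_mul_const]
    refine norm_integral_le_of_norm_le (hs.norm.mul_const C).integrableOn ?_
    refine (ae_restrict_iff' measurableSet_Ioi).2 (ae_of_all _ fun y hy => ?_)
    exact (norm_volt_integrand_le zero_le_two hz (hxR.trans (le_of_lt hy))).trans
      (mul_le_mul_of_nonneg_left (hC y z hz) (norm_nonneg _))
  have h2 : ‖∫ y in x..R, Complex.exp (Complex.I * (2 : ℝ) * z * (y - x)) * (s y - P y) * A y z‖
      ≤ 2 * δ * C * |R - x| := by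
    refine intervalIntegral.norm_integral_le_of_norm_le_const fun y hy => ?_
    rw [Set.uIoc_of_le hxR] at hy
    refine (norm_volt_integrand_le (g := fun y => s y - P y) zero_le_two hz hy.1.le).trans ?_
    exact mul_le_mul (hclose y ⟨hy.1.le, hy.2⟩) (hC y z hz) (norm_nonneg _) (by positivity)
  have h3 : (∫ y in x..R, Complex.exp (Complex.I * (2 : ℝ) * z * (y - x)) * s y * A y z)
      = (∫ y in x..R, Complex.exp (Complex.I * (2 : ℝ) * z * (y - x)) * (s y - P y) * A y z)
        + ∫ y in x..R, Complex.exp (Complex.I * (2 : ℝ) * z * (y - x)) * P y * A y z := by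
    rw [← intervalIntegral.integral_add]
    · refine intervalIntegral.integral_congr fun y _ => ?_
      ring
    · exact (by fun_prop : Continuous fun y : ℝ => Complex.exp (Complex.I * (2 : ℝ) * z * (y - x))
        * (s y - P y) * A y z).intervalIntegrable _ _
    · exact (by fun_prop : Continuous fun y : ℝ => Complex.exp (Complex.I * (2 : ℝ) * z * (y - x))
        * P y * A y z).intervalIntegrable _ _
  have h4 := hparts z hz (norm_pos_iff.1 hzn)
  have h5 : K / (2 * ‖z‖) < ε / 3 := by
    rw [div_lt_iff₀ (by positivity)]
    have h6 : K = K / ε * 3 * (ε / 3) := by field_simp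
    have h7 : 0 ≤ K / ε * 3 := by positivity
    nlinarith
  have h6 : 2 * δ * C * |R - x| ≤ ε / 3 := by
    rw [abs_of_nonneg hRx, hδ]
    have h7 : 2 * (ε / (6 * ((R - x + 1) * (C + 1)))) * C * (R - x)
        = ε / 3 * (((R - x) * C) / ((R - x + 1) * (C + 1))) := by field_simp; ring
    have h8 : ((R - x) * C) / ((R - x + 1) * (C + 1)) ≤ 1 := by
      rw [div_le_one (by positivity)]; nlinarith
    rw [h7]
    nlinarith
  rw [dist_eq_norm, sub_zero, hsplit, h3]
  refine (norm_add_le _ _).trans_lt ?_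
  have := norm_add_le (∫ y in x..R, Complex.exp (Complex.I * (2 : ℝ) * z * (y - x)) * (s y - P y)
    * A y z) (∫ y in x..R, Complex.exp (Complex.I * (2 : ℝ) * z * (y - x)) * P y * A y z)
  linarith

end VolterraEquation

/-! ### Jost functions at a fixed time -/

/-- The lower closed half-plane. -/
def lowerClosed : Set ℂ := {z | z.im ≤ 0}

/-- The lower open half-plane. -/
def lowerOpen : Set ℂ := {z | z.im < 0}

/-- A first column `e^{iθ} (a, λ c)` of a Jost solution, as a function of `x` and `z = λ²`,
for the potential `(u, r)` in place of `(q, -q*)`. It is normalized along the filter `l`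
and defined for `z` in the closed half-plane `H` with interior `U`. -/
structure HalfJost (u r : ℝ → ℂ) (l : Filter ℝ) (H U : Set ℂ) (a c : ℝ → ℂ → ℂ) : Prop where
  hasDerivAt_a : ∀ x, ∀ z ∈ H, HasDerivAt (fun x => a x z) (z * u x * c x z) x
  hasDerivAt_c : ∀ x, ∀ z ∈ H,
    HasDerivAt (fun x => c x z) (-(2 * Complex.I * z) * c x z + r x * a x z) x
  tendsto_a : ∀ z ∈ H, Tendsto (fun x => a x z) l (𝓝 1)
  tendsto_c : ∀ z ∈ H, Tendsto (fun x => c x z) l (𝓝 0)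
  continuousOn_a : ∀ x, ContinuousOn (a x) H
  continuousOn_c : ∀ x, ContinuousOn (c x) H
  differentiableOn_a : ∀ x, DifferentiableOn ℂ (a x) U
  differentiableOn_c : ∀ x, DifferentiableOn ℂ (c x) U
  asymptotics : ∀ x, ∃ e ≠ 0,
    Tendsto (a x) (Bornology.cobounded ℂ ⊓ 𝓟 H) (𝓝 e) ∧
    Tendsto (fun z => 2 * Complex.I * z * c x z - r x * a x z) (Bornology.cobounded ℂ ⊓ 𝓟 H) (𝓝 0)

lemma isCountablyGenerated_cobounded_inf (H : Set ℂ) :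
    (Bornology.cobounded ℂ ⊓ 𝓟 H).IsCountablyGenerated := by
  rw [← comap_norm_atTop]
  infer_instance

/-- The function `v = 2iz c - r a` satisfies, together with `a`, a system whose coefficients apart
from the exponent do not depend on `z`; the factor `E = exp (∫ u r / 2i)` removes its diagonal
part. The Volterra equation of that system yields the Jost function. -/
theorem exists_halfJost_atTop {u r r' : ℝ → ℂ} (huc : Continuous u) (hu : Integrable u)
    (hub : ∃ C, ∀ x, ‖u x‖ ≤ C) (hrd : ∀ x, HasDerivAt r (r' x) x) (hr : Integrable r)
    (hrb : ∃ C, ∀ x, ‖r x‖ ≤ C) (hr'c : Continuous r') (hr' : Integrable r') :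
    ∃ a c, HalfJost u r atTop upperClosed upperOpen a c := by
  obtain ⟨Cu, hCu⟩ := hub
  obtain ⟨Cr, hCr⟩ := hrb
  have hrc : Continuous r := continuous_iff_continuousAt.2 fun x => (hrd x).continuousAt
  have hI : (2 * Complex.I : ℂ) ≠ 0 := by simp
  set m : ℝ → ℂ := fun x => u x * r x / (2 * Complex.I) with hm
  have hmc : Continuous m := by simp only [hm]; fun_prop
  have hmi : Integrable m := by
    refine (hu.mul_bdd (c := Cr) hrc.aestronglyMeasurable (ae_of_all _ hCr)).div_const _
  set w : ℝ → ℂ := fun x => ∫ y in Set.Ioi x, m y with hw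
  have hwd : ∀ x, HasDerivAt w (-m x) x := fun x =>
    hasDerivAt_integral_Ioi hmc (fun x => hmi.integrableOn) x
  have hwc : Continuous w := continuous_iff_continuousAt.2 fun x => (hwd x).continuousAt
  have hwlim : Tendsto w atTop (𝓝 0) := tendsto_integral_Ioi_zero tendsto_id
  set K : ℝ := ∫ y, ‖m y‖ with hK
  have hwK : ∀ x, ‖w x‖ ≤ K := fun x =>
    (norm_integral_le_integral_norm _).trans (integral_Ioi_norm_le hmi x)
  have hexpb : ∀ (k : ℝ) (x : ℝ), ‖Complex.exp (k * w x)‖ ≤ Real.exp (|k| * K) := fun k x => by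
    rw [Complex.norm_exp]
    apply Real.exp_le_exp.2
    refine (Complex.re_le_norm _).trans ?_
    rw [norm_mul, Complex.norm_real, Real.norm_eq_abs]
    exact mul_le_mul_of_nonneg_left (hwK x) (abs_nonneg k)
  have hexpc : ∀ k : ℝ, Continuous fun x => Complex.exp (k * w x) := fun k => by fun_prop
  set p : ℝ → ℂ := fun x => u x / (2 * Complex.I) * Complex.exp ((2 : ℝ) * w x) with hp
  set s : ℝ → ℂ := fun x => -(r' x + u x * r x * r x / (2 * Complex.I))
    * Complex.exp ((-2 : ℝ) * w x) with hs
  have hpc : Continuous p := (huc.div_const _).mul (hexpc 2)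
  have hpi : Integrable p :=
    (hu.div_const _).mul_bdd (hexpc 2).aestronglyMeasurable (ae_of_all _ (hexpb 2))
  have hsc : Continuous s := ((hr'c.add (((huc.mul hrc).mul hrc).div_const _)).neg).mul (hexpc (-2))
  have hsi : Integrable s := by
    refine Integrable.mul_bdd ?_ (hexpc (-2)).aestronglyMeasurable (ae_of_all _ (hexpb (-2)))
    refine (hr'.add (((hu.mul_bdd (c := Cr) hrc.aestronglyMeasurable (ae_of_all _ hCr)).mul_bdd
      (c := Cr) hrc.aestronglyMeasurable (ae_of_all _ hCr)).div_const _)).neg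
  obtain ⟨A, V, hA, hV, hAeq, hVeq⟩ := exists_volterra hpc hpi hsc hsi
  have hAd : ∀ x, ∀ z ∈ upperClosed, HasDerivAt (fun x => A x z) (p x * V x z) x := by
    intro x z hz
    have h1 := (hasDerivAt_volt (κ := 0) le_rfl hpc hpi hV hz x).const_sub 1
    have h2 : (fun x => A x z) = fun x => 1 - volt 0 p V x z := by
      funext y; exact hAeq y z hz
    rw [h2]
    refine h1.congr_deriv ?_
    push_cast; ring
  have hVd : ∀ x, ∀ z ∈ upperClosed,
      HasDerivAt (fun x => V x z) (-(2 * Complex.I * z) * V x z + s x * A x z) x := by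
    intro x z hz
    have h1 := (hasDerivAt_volt (κ := 2) zero_le_two hsc hsi hA hz x).neg
    have h2 : (fun x => V x z) = fun x => -volt 2 s A x z := by
      funext y; exact hVeq y z
    rw [h2]
    refine h1.congr_deriv ?_
    rw [hVeq x z]
    push_cast; ring
  have hVlim : ∀ x, Tendsto (V x) (Bornology.cobounded ℂ ⊓ 𝓟 upperClosed) (𝓝 0) := fun x => by
    have := (tendsto_volterra_cobounded hpc hsc hsi hA hV hAd x).neg
    rw [neg_zero] at this
    exact this.congr fun z => (hVeq x z).symm
  have hmem : ∀ᶠ z in Bornology.cobounded ℂ ⊓ 𝓟 upperClosed, z ∈ upperClosed :=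
    mem_inf_of_right (mem_principal_self upperClosed)
  have hAlim : ∀ x, Tendsto (A x) (Bornology.cobounded ℂ ⊓ 𝓟 upperClosed) (𝓝 1) := fun x => by
    have := isCountablyGenerated_cobounded_inf upperClosed
    obtain ⟨C, hC⟩ := hV.bdd
    have h1 : Tendsto (fun z => volt 0 p V x z) (Bornology.cobounded ℂ ⊓ 𝓟 upperClosed)
        (𝓝 (∫ y in Set.Ioi x, 0)) := by
      refine tendsto_integral_filter_of_dominated_convergence (fun y => ‖p y‖ * C) ?_ ?_
        (hpi.norm.mul_const C).integrableOn ?_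
      · filter_upwards [hmem] with z hz
        exact (continuous_volt_integrand hpc hV hz x).aestronglyMeasurable
      · filter_upwards [hmem] with z hz
        refine (ae_restrict_iff' measurableSet_Ioi).2 (ae_of_all _ fun y hy => ?_)
        exact (norm_volt_integrand_le le_rfl hz (le_of_lt hy)).trans
          (mul_le_mul_of_nonneg_left (hC y z hz) (norm_nonneg _))
      · refine ae_of_all _ fun y => ?_
        have := (hVlim y).const_mul (p y)
        simpa using this
    have h2 := h1.const_sub 1
    simp only [integral_zero, sub_zero] at h2
    refine h2.congr' ?_
    filter_upwards [hmem] with z hz using (hAeq x z hz).symm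
  set E : ℝ → ℂ := fun x => Complex.exp ((-1 : ℝ) * w x) with hE
  set F : ℝ → ℂ := fun x => Complex.exp ((1 : ℝ) * w x) with hF
  have hEF : ∀ x, E x * F x = 1 := fun x => by
    simp only [hE, hF]; rw [← Complex.exp_add]; push_cast
    rw [neg_one_mul, one_mul, neg_add_cancel, Complex.exp_zero]
  have hFF : ∀ x, Complex.exp ((2 : ℝ) * w x) = F x * F x := fun x => by
    simp only [hF]; rw [← Complex.exp_add]; congr 1; push_cast; ring
  have hEE : ∀ x, Complex.exp ((-2 : ℝ) * w x) = E x * E x := fun x => by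
    simp only [hE]; rw [← Complex.exp_add]; congr 1; push_cast; ring
  have hEd : ∀ x, HasDerivAt E (E x * m x) x := fun x => by
    refine (((hwd x).const_mul ((-1 : ℝ) : ℂ)).cexp).congr_deriv ?_
    simp only [hE]; push_cast; ring
  have hFd : ∀ x, HasDerivAt F (-(F x * m x)) x := fun x => by
    refine (((hwd x).const_mul ((1 : ℝ) : ℂ)).cexp).congr_deriv ?_
    simp only [hF]; push_cast; ring
  have hElim : Tendsto E atTop (𝓝 1) := by
    have := (Complex.continuous_exp.tendsto _).comp (hwlim.const_mul ((-1 : ℝ) : ℂ))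
    rw [mul_zero, Complex.exp_zero] at this
    exact this
  have hFlim : Tendsto F atTop (𝓝 1) := by
    have := (Complex.continuous_exp.tendsto _).comp (hwlim.const_mul ((1 : ℝ) : ℂ))
    rw [mul_zero, Complex.exp_zero] at this
    exact this
  set a : ℝ → ℂ → ℂ := fun x z => E x * A x z with ha
  have hareg : IsReg a := hA.mul_left (hexpc (-1)) (hexpb (-1))
  set c : ℝ → ℂ → ℂ := fun x z => -volt 2 r a x z with hc
  have hcreg : IsReg c := (hareg.volt zero_le_two hrc hr).neg
  have hcd : ∀ x, ∀ z ∈ upperClosed,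
      HasDerivAt (fun x => c x z) (-(2 * Complex.I * z) * c x z + r x * a x z) x := by
    intro x z hz
    refine (hasDerivAt_volt (κ := 2) zero_le_two hrc hr hareg hz x).neg.congr_deriv ?_
    simp only [hc]; push_cast; ring
  have had : ∀ x, ∀ z ∈ upperClosed,
      HasDerivAt (fun x => a x z) (u x / (2 * Complex.I) * (F x * V x z + r x * a x z)) x := by
    intro x z hz
    refine ((hEd x).mul (hAd x z hz)).congr_deriv ?_
    have h1 := hEF x
    simp only [ha, hp, hm, hFF]
    linear_combination (u x / (2 * Complex.I) * F x * V x z) * h1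
  have hVtop : ∀ z ∈ upperClosed, Tendsto (fun x => V x z) atTop (𝓝 0) := fun z hz => by
    have := (tendsto_volt_atTop (κ := 2) zero_le_two hsi hA hz).neg
    rw [neg_zero] at this
    exact this.congr fun x => (hVeq x z).symm
  have hAtop : ∀ z ∈ upperClosed, Tendsto (fun x => A x z) atTop (𝓝 1) := fun z hz => by
    have := (tendsto_volt_atTop (κ := 0) le_rfl hpi hV hz).const_sub 1
    rw [sub_zero] at this
    exact this.congr fun x => (hAeq x z hz).symm
  have hatop : ∀ z ∈ upperClosed, Tendsto (fun x => a x z) atTop (𝓝 1) := fun z hz => by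
    simpa using hElim.mul (hAtop z hz)
  have hctop : ∀ z ∈ upperClosed, Tendsto (fun x => c x z) atTop (𝓝 0) := fun z hz => by
    have := (tendsto_volt_atTop (κ := 2) zero_le_two hr hareg hz).neg
    rwa [neg_zero] at this
  have hrtop : Tendsto r atTop (𝓝 0) :=
    tendsto_zero_of_hasDerivAt_of_integrableOn_Ioi (a := 0) (fun x _ => hrd x) hr'.integrableOn
      hr.integrableOn
  -- both sides solve the same scalar equation and vanish at infinity
  have hkey : ∀ x, ∀ z ∈ upperClosed, F x * V x z = 2 * Complex.I * z * c x z - r x * a x z := by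
    intro x z hz
    set D : ℝ → ℂ := fun x => F x * V x z - 2 * Complex.I * z * c x z + r x * a x z with hD
    have hDd : ∀ x, HasDerivAt D (-(2 * Complex.I * z) * D x) x := fun x => by
      refine ((((hFd x).mul (hVd x z hz)).sub ((hcd x z hz).const_mul (2 * Complex.I * z))).add
        ((hrd x).mul (had x z hz))).congr_deriv ?_
      have h1 := hEF x
      simp only [hD, hs, hm, hEE, ha]
      linear_combination (-(r' x + u x * r x * r x / (2 * Complex.I)) * E x * A x z) * h1
    set G : ℝ → ℂ := fun x => Complex.exp (2 * Complex.I * z * x) * D x with hG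
    have hGd : ∀ x, HasDerivAt G 0 x := fun x => by
      have h3 : HasDerivAt (fun x : ℝ => 2 * Complex.I * z * (x : ℂ)) (2 * Complex.I * z * 1) x :=
        (Complex.ofRealCLM.hasDerivAt (x := x)).const_mul _
      refine (h3.cexp.mul (hDd x)).congr_deriv ?_
      ring
    have hDtop : Tendsto D atTop (𝓝 0) := by
      have := ((hFlim.mul (hVtop z hz)).sub ((hctop z hz).const_mul (2 * Complex.I * z))).add
        (hrtop.mul (hatop z hz))
      simpa using this
    have hGtop : Tendsto G atTop (𝓝 0) := by
      refine squeeze_zero_norm' ?_ (tendsto_zero_iff_norm_tendsto_zero.1 hDtop)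
      filter_upwards [eventually_ge_atTop 0] with x hx
      rw [hG, norm_mul]
      have h1 := norm_exp_le_one (κ := 2) zero_le_two hz hx
      have h2 : Complex.I * ((2 : ℝ) : ℂ) * z * ((x : ℂ) - ((0 : ℝ) : ℂ))
          = 2 * Complex.I * z * x := by
        push_cast; ring
      rw [h2] at h1
      have := norm_nonneg (D x)
      nlinarith
    have hGconst : ∀ y, G y = G x := fun y =>
      is_const_of_deriv_eq_zero (fun x => (hGd x).differentiableAt) (fun x => (hGd x).deriv) y x
    have hG0 : G x = 0 :=
      tendsto_nhds_unique (tendsto_const_nhds.congr fun y => (hGconst y).symm) hGtop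
    have hD0 : D x = 0 := by
      rcases mul_eq_zero.1 hG0 with h | h
      · exact absurd h (Complex.exp_ne_zero _)
      · exact h
    simp only [hD] at hD0
    linear_combination hD0
  refine ⟨a, c, ⟨fun x z hz => (had x z hz).congr_deriv ?_, hcd, hatop, hctop,
    hareg.continuousOn_right, hcreg.continuousOn_right, hareg.diff, hcreg.diff,
    fun x => ⟨E x, Complex.exp_ne_zero _, ?_, ?_⟩⟩⟩
  · rw [hkey x z hz]
    field_simp
    ring
  · simpa using (hAlim x).const_mul (E x)
  · have := (hVlim x).const_mul (F x)
    rw [mul_zero] at this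
    refine this.congr' ?_
    filter_upwards [hmem] with z hz using hkey x z hz

lemma tendsto_neg_cobounded_inf :
    Tendsto (fun z : ℂ => -z) (Bornology.cobounded ℂ ⊓ 𝓟 lowerClosed)
      (Bornology.cobounded ℂ ⊓ 𝓟 upperClosed) := by
  refine tendsto_inf.2 ⟨(tendsto_neg_cobounded).mono_left inf_le_left, ?_⟩
  refine tendsto_principal.2 (mem_inf_of_right ?_)
  rw [mem_principal]
  intro z hz
  simpa [upperClosed, lowerClosed] using hz

/-- The reflection `x ↦ -x`, `z ↦ -z` carries the Jost functions at `+∞` to those at `-∞`. -/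
theorem exists_halfJost_atBot {u r r' : ℝ → ℂ} (huc : Continuous u) (hu : Integrable u)
    (hub : ∃ C, ∀ x, ‖u x‖ ≤ C) (hrd : ∀ x, HasDerivAt r (r' x) x) (hr : Integrable r)
    (hrb : ∃ C, ∀ x, ‖r x‖ ≤ C) (hr'c : Continuous r') (hr' : Integrable r') :
    ∃ a c, HalfJost u r atBot lowerClosed lowerOpen a c := by
  obtain ⟨Cu, hCu⟩ := hub
  obtain ⟨Cr, hCr⟩ := hrb
  obtain ⟨a, c, h⟩ := exists_halfJost_atTop (u := fun x => u (-x)) (r := fun x => -r (-x))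
    (r' := fun x => r' (-x)) (huc.comp continuous_neg) hu.comp_neg ⟨Cu, fun x => hCu _⟩
    (fun x => by
      refine (((hrd (-x)).scomp x (hasDerivAt_neg x)).neg).congr_deriv ?_
      simp)
    hr.comp_neg.neg ⟨Cr, fun x => by rw [norm_neg]; exact hCr _⟩ (hr'c.comp continuous_neg)
    hr'.comp_neg
  have hH : ∀ z ∈ lowerClosed, -z ∈ upperClosed := fun z hz => by
    simpa [upperClosed, lowerClosed] using hz
  have hU : ∀ z ∈ lowerOpen, -z ∈ upperOpen := fun z hz => by
    simpa [upperOpen, lowerOpen] using hz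
  refine ⟨fun x z => a (-x) (-z), fun x z => c (-x) (-z), ⟨?_, ?_, ?_, ?_, ?_, ?_, ?_, ?_, ?_⟩⟩
  · intro x z hz
    refine ((h.hasDerivAt_a (-x) (-z) (hH z hz)).scomp x (hasDerivAt_neg x)).congr_deriv ?_
    simp
  · intro x z hz
    refine ((h.hasDerivAt_c (-x) (-z) (hH z hz)).scomp x (hasDerivAt_neg x)).congr_deriv ?_
    simp
  · exact fun z hz => (h.tendsto_a (-z) (hH z hz)).comp tendsto_neg_atBot_atTop
  · exact fun z hz => (h.tendsto_c (-z) (hH z hz)).comp tendsto_neg_atBot_atTop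
  · exact fun x => (h.continuousOn_a (-x)).comp continuous_neg.continuousOn hH
  · exact fun x => (h.continuousOn_c (-x)).comp continuous_neg.continuousOn hH
  · exact fun x => (h.differentiableOn_a (-x)).comp differentiable_neg.differentiableOn hU
  · exact fun x => (h.differentiableOn_c (-x)).comp differentiable_neg.differentiableOn hU
  · intro x
    obtain ⟨e, he, h1, h2⟩ := h.asymptotics (-x)
    refine ⟨e, he, h1.comp tendsto_neg_cobounded_inf, ?_⟩
    have h3 := (h2.comp tendsto_neg_cobounded_inf).neg
    rw [neg_zero] at h3
    refine h3.congr fun z => ?_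
    simp
    ring

/-! ### Complex analysis: continuation across the real line, Liouville, double poles -/

/-- A continuous function that is holomorphic off the real line is holomorphic. -/
lemma differentiableOn_of_off_real {f : ℂ → ℂ} {U : Set ℂ} (hU : IsOpen U)
    (hc : ContinuousOn f U) (hd : ∀ z ∈ U, z.im ≠ 0 → DifferentiableAt ℂ f z) :
    DifferentiableOn ℂ f U := by
  refine (Complex.isConservativeOn_and_continuousOn_iff_isDifferentiableOn hU).1 ⟨?_, hc⟩
  -- the boundary integral of a rectangle that the real line does not cross in its interior
  have hdirect : ∀ z w : ℂ, Complex.Rectangle z w ⊆ U →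
      0 ∉ Set.Ioo (min z.im w.im) (max z.im w.im) →
      (∫ x : ℝ in z.re..w.re, f (x + z.im * Complex.I))
        - (∫ x : ℝ in z.re..w.re, f (x + w.im * Complex.I))
        + Complex.I • (∫ y : ℝ in z.im..w.im, f (w.re + y * Complex.I))
        - Complex.I • (∫ y : ℝ in z.im..w.im, f (z.re + y * Complex.I)) = 0 := by
    intro z w hzw h0
    refine Complex.integral_boundary_rect_eq_zero_of_continuousOn_of_differentiableOn f z w
      (hc.mono hzw) fun k hk => ?_
    have hk1 := (Complex.mem_reProdIm.1 hk)
    refine (hd k (hzw (Complex.mem_reProdIm.2 ⟨?_, ?_⟩)) ?_).differentiableWithinAt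
    · exact Set.Ioo_subset_Icc_self hk1.1
    · exact Set.Ioo_subset_Icc_self hk1.2
    · rintro hk0
      rw [hk0] at hk1
      exact h0 hk1.2
  intro z w hzw
  rw [← add_eq_zero_iff_eq_neg, Complex.wedgeIntegral_add_wedgeIntegral_eq]
  by_cases h0 : (0 : ℝ) ∈ Set.Ioo (min z.im w.im) (max z.im w.im)
  swap
  · exact hdirect z w hzw h0
  have h0' : (0 : ℝ) ∈ Set.uIcc z.im w.im := Set.Ioo_subset_Icc_self h0
  have hsub1 : Complex.Rectangle z ((w.re : ℝ) : ℂ) ⊆ U := fun k hk => hzw (by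
    have hk1 := Complex.mem_reProdIm.1 hk
    rw [Complex.ofReal_re, Complex.ofReal_im] at hk1
    exact Complex.mem_reProdIm.2 ⟨hk1.1, Set.uIcc_subset_uIcc Set.left_mem_uIcc h0' hk1.2⟩)
  have hsub2 : Complex.Rectangle ((z.re : ℝ) : ℂ) w ⊆ U := fun k hk => hzw (by
    have hk1 := Complex.mem_reProdIm.1 hk
    rw [Complex.ofReal_re, Complex.ofReal_im] at hk1
    exact Complex.mem_reProdIm.2 ⟨hk1.1, Set.uIcc_subset_uIcc h0' Set.right_mem_uIcc hk1.2⟩)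
  have e1 := hdirect z ((w.re : ℝ) : ℂ) hsub1 (by
    rw [Complex.ofReal_im]; rintro ⟨h1, h2⟩
    rcases le_total z.im 0 with h | h
    · rw [max_eq_right h] at h2; exact lt_irrefl _ h2
    · rw [min_eq_right h] at h1; exact lt_irrefl _ h1)
  have e2 := hdirect ((z.re : ℝ) : ℂ) w hsub2 (by
    rw [Complex.ofReal_im]; rintro ⟨h1, h2⟩
    rcases le_total w.im 0 with h | h
    · rw [max_eq_left h] at h2; exact lt_irrefl _ h2
    · rw [min_eq_left h] at h1; exact lt_irrefl _ h1)
  simp only [Complex.ofReal_re, Complex.ofReal_im] at e1 e2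
  have hvert : ∀ r ∈ Set.uIcc z.re w.re, ∀ a ∈ Set.uIcc z.im w.im, ∀ b ∈ Set.uIcc z.im w.im,
      IntervalIntegrable (fun y : ℝ => f (r + y * Complex.I)) volume a b := by
    intro r hr a ha b hb
    refine ContinuousOn.intervalIntegrable ?_
    refine hc.comp (by fun_prop) fun y hy => hzw (Complex.mem_reProdIm.2 ⟨?_, ?_⟩)
    · simpa using hr
    · simpa using Set.uIcc_subset_uIcc ha hb hy
  rw [← intervalIntegral.integral_add_adjacent_intervals
      (hvert w.re Set.right_mem_uIcc z.im Set.left_mem_uIcc 0 h0')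
      (hvert w.re Set.right_mem_uIcc 0 h0' w.im Set.right_mem_uIcc),
    ← intervalIntegral.integral_add_adjacent_intervals
      (hvert z.re Set.left_mem_uIcc z.im Set.left_mem_uIcc 0 h0')
      (hvert z.re Set.left_mem_uIcc 0 h0' w.im Set.right_mem_uIcc)]
  simp only [smul_eq_mul] at e1 e2 ⊢
  linear_combination e1 + e2

/-- Liouville's theorem for a function with finitely many removable singularities. -/
lemma exists_eq_const_of_bounded_off_finset {f : ℂ → ℂ} {S : Set ℂ} (hS : S.Finite)
    (hd : ∀ z ∉ S, DifferentiableAt ℂ f z)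
    (hb : ∀ s ∈ S, f =O[𝓝[≠] s] (fun _ => (1 : ℂ)))
    (hinf : f =O[Bornology.cobounded ℂ] (fun _ => (1 : ℂ))) :
    ∃ c, ∀ z ∉ S, f z = c := by
  classical
  set g : ℂ → ℂ := fun z => if z ∈ S then limUnder (𝓝[≠] z) f else f z with hg
  have hgf : ∀ z ∉ S, g z = f z := fun z hz => by simp [hg, hz]
  have hgd : Differentiable ℂ g := by
    intro z
    by_cases hz : z ∈ S
    · have h1 : ∀ᶠ w in 𝓝 z, w ∉ S \ {z} :=
        (hS.subset Set.sdiff_subset).isClosed.isOpen_compl.mem_nhds (by simp)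
      obtain ⟨C, hC⟩ := (hb z hz).bound
      rw [eventually_nhdsWithin_iff] at hC
      set W : Set ℂ := {w | w ∉ S \ {z} ∧ (w ∈ ({z}ᶜ : Set ℂ) → ‖f w‖ ≤ C * ‖(1 : ℂ)‖)} with hW
      have hWz : W ∈ 𝓝 z := h1.and hC
      have h2 := Complex.differentiableOn_update_limUnder_of_bddAbove (f := f) hWz
        (fun w hw => (hd w fun hwS => hw.1.1 ⟨hwS, hw.2⟩).differentiableWithinAt)
        ⟨C * ‖(1 : ℂ)‖, by rintro _ ⟨w, hw, rfl⟩; exact hw.1.2 hw.2⟩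
      have h3 : DifferentiableOn ℂ g W := by
        refine h2.congr fun w hw => ?_
        by_cases hwz : w = z
        · subst hwz; simp [hg, hz]
        · rw [Function.update_of_ne hwz]
          exact hgf w fun hwS => hw.1 ⟨hwS, hwz⟩
      exact h3.differentiableAt hWz
    · refine (hd z hz).congr_of_eventuallyEq ?_
      filter_upwards [hS.isClosed.isOpen_compl.mem_nhds hz] with w hw using hgf w hw
  have hbdd : Bornology.IsBounded (Set.range g) := by
    obtain ⟨C, hC⟩ := hinf.bound
    have hSb : ∀ᶠ z in Bornology.cobounded ℂ, z ∉ S := by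
      have := hS.isBounded
      exact this
    obtain ⟨R, hR⟩ := (hC.and hSb).exists_mem.imp fun _ h => h
    obtain ⟨hRm, hR⟩ := hR
    obtain ⟨C', hC'⟩ := ((show Bornology.IsBounded Rᶜ from by
      rw [← Bornology.isCobounded_compl_iff, compl_compl]; exact hRm).isCompact_closure
      ).exists_bound_of_continuousOn hgd.continuous.continuousOn
    refine isBounded_iff_forall_norm_le.2 ⟨max (C * ‖(1 : ℂ)‖) C', ?_⟩
    rintro _ ⟨z, rfl⟩
    by_cases hz : z ∈ R
    · rw [hgf z (hR z hz).2]
      exact (hR z hz).1.trans (le_max_left _ _)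
    · exact (hC' z (subset_closure hz)).trans (le_max_right _ _)
  refine ⟨g 0, fun z hz => ?_⟩
  rw [← hgf z hz]
  exact hgd.apply_eq_apply_of_bounded hbdd z 0

/-- Taylor's formula for an analytic function, with coefficients given by iterated derivatives. -/
lemma isBigO_sub_taylor {f : ℂ → ℂ} {ζ : ℂ} (hf : AnalyticAt ℂ f ζ) (n : ℕ) :
    (fun k => f k - ∑ i ∈ Finset.range n, iteratedDeriv i f ζ / i.factorial * (k - ζ) ^ i)
      =O[𝓝 ζ] fun k => (k - ζ) ^ n := by
  have h1 := (hf.hasFPowerSeriesAt.isBigO_sub_partialSum_pow n).comp_tendsto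
    (show Tendsto (fun k => k - ζ) (𝓝 ζ) (𝓝 0) by
      have h : Continuous fun k : ℂ => k - ζ := by fun_prop
      simpa using h.tendsto ζ)
  have h2 : ((fun y : ℂ => ‖y‖ ^ n) ∘ fun k => k - ζ) =O[𝓝 ζ] fun k => (k - ζ) ^ n :=
    Asymptotics.IsBigO.of_bound 1 (Eventually.of_forall fun k => by simp)
  refine (h1.trans h2).congr_left fun k => ?_
  simp only [Function.comp, FormalMultilinearSeries.partialSum, add_sub_cancel]
  congr 1
  refine Finset.sum_congr rfl fun i _ => ?_
  rw [FormalMultilinearSeries.ofScalars_apply_eq, smul_eq_mul]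

/-- `f - (K/(k-ζ)² + K D/(k-ζ)) g` is bounded near `ζ`. -/
def ResidueCondition (f g : ℂ → ℂ) (ζ K D : ℂ) : Prop :=
  (fun k => f k - (K / (k - ζ) ^ 2 + K * D / (k - ζ)) * g k) =O[𝓝[≠] ζ] (fun _ => (1 : ℂ))

lemma isBigO_one_of_continuousAt {f : ℂ → ℂ} {ζ : ℂ} (hf : ContinuousAt f ζ) :
    f =O[𝓝[≠] ζ] (fun _ => (1 : ℂ)) :=
  (hf.tendsto.isBigO_one ℂ).mono nhdsWithin_le_nhds

lemma isBigO_div_of_isBigO_mul {f h : ℂ → ℂ} {ζ : ℂ} (hh : ∀ᶠ k in 𝓝[≠] ζ, h k ≠ 0)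
    (hf : f =O[𝓝[≠] ζ] h) : (fun k => f k / h k) =O[𝓝[≠] ζ] (fun _ => (1 : ℂ)) := by
  obtain ⟨C, hC⟩ := hf.bound
  refine Asymptotics.IsBigO.of_bound C ?_
  filter_upwards [hC, hh] with k hk hk0
  rw [norm_div, norm_one, mul_one, div_le_iff₀ (norm_pos_iff.2 hk0)]
  exact hk

/-- The principal part at `ζ` of `(K/(k-ζ)² + K D/(k-ζ)) g`. -/
lemma mul_sub_principalPart_isBigO {g : ℂ → ℂ} {ζ : ℂ} (K D : ℂ) (hg : AnalyticAt ℂ g ζ) :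
    (fun k => (K / (k - ζ) ^ 2 + K * D / (k - ζ)) * g k
      - (K * g ζ / (k - ζ) ^ 2 + K * (D * g ζ + deriv g ζ) / (k - ζ)))
      =O[𝓝[≠] ζ] (fun _ => (1 : ℂ)) := by
  have h1 := isBigO_sub_taylor hg 2
  have hw : ∀ᶠ k in 𝓝[≠] ζ, (k - ζ) ^ 2 ≠ 0 := by
    filter_upwards [self_mem_nhdsWithin] with k hk
    exact pow_ne_zero 2 (sub_ne_zero.2 hk)
  have h2 := isBigO_div_of_isBigO_mul hw (h1.mono nhdsWithin_le_nhds)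
  have hg' := isBigO_sub_taylor hg 1
  have hw' : ∀ᶠ k in 𝓝[≠] ζ, (k - ζ) ^ 1 ≠ 0 := by
    filter_upwards [self_mem_nhdsWithin] with k hk
    exact pow_ne_zero 1 (sub_ne_zero.2 hk)
  have h3 := isBigO_div_of_isBigO_mul hw' (hg'.mono nhdsWithin_le_nhds)
  refine ((h2.const_mul_left K).add (h3.const_mul_left (K * D))).congr' ?_
    (Eventually.of_forall fun k => rfl)
  filter_upwards [self_mem_nhdsWithin] with k hk
  have hk0 : k - ζ ≠ 0 := sub_ne_zero.2 hk
  simp only [Finset.sum_range_succ, Finset.range_zero, Finset.sum_empty, iteratedDeriv_zero,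
    iteratedDeriv_one, Nat.factorial, pow_zero, pow_one]
  push_cast
  field_simp
  ring

/-- The residue condition fixes the principal part of `f` in terms of the value and the derivative
of `g` at the pole. -/
lemma residueCondition_iff {f g : ℂ → ℂ} {ζ K D : ℂ} (hg : AnalyticAt ℂ g ζ) :
    ResidueCondition f g ζ K D ↔
    (fun k => f k - (K * g ζ / (k - ζ) ^ 2 + K * (D * g ζ + deriv g ζ) / (k - ζ)))
      =O[𝓝[≠] ζ] (fun _ => (1 : ℂ)) := by
  have h := mul_sub_principalPart_isBigO K D hg
  constructor
  · intro h1
    exact (Asymptotics.IsBigO.add h1 h).congr_left fun k => by ring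
  · intro h1
    exact (h1.sub h).congr_left fun k => by ring

/-- Two rows with the same residue condition have a Wronskian without pole. -/
lemma ResidueCondition.wronskian_isBigO {f₁ g₁ f₂ g₂ : ℂ → ℂ} {ζ K D : ℂ}
    (h1 : ResidueCondition f₁ g₁ ζ K D) (h2 : ResidueCondition f₂ g₂ ζ K D)
    (hg₁ : ContinuousAt g₁ ζ) (hg₂ : ContinuousAt g₂ ζ) :
    (fun k => f₁ k * g₂ k - g₁ k * f₂ k) =O[𝓝[≠] ζ] (fun _ => (1 : ℂ)) := by
  have h3 := (h1.mul (isBigO_one_of_continuousAt hg₂)).sub (h2.mul (isBigO_one_of_continuousAt hg₁))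
  simp only [mul_one] at h3
  exact h3.congr_left fun k => by ring

/-- The residue condition at a double zero `ζ` of `s`, where `P₁ - (b + d (k - ζ)) P₂` vanishes to
second order. -/
lemma residueCondition_of_double_zero {P₁ P₂ s θ : ℂ → ℂ} {ζ b d : ℂ} (hP₁ : AnalyticAt ℂ P₁ ζ)
    (hP₂ : AnalyticAt ℂ P₂ ζ) (hs : AnalyticAt ℂ s ζ) (hθ : AnalyticAt ℂ θ ζ) (hb : b ≠ 0)
    (h0 : P₁ ζ = b * P₂ ζ) (h1 : deriv P₁ ζ - b * deriv P₂ ζ = d * P₂ ζ)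
    (hs0 : s ζ = 0) (hs1 : deriv s ζ = 0) (hs2 : iteratedDeriv 2 s ζ ≠ 0) :
    ResidueCondition (fun k => Complex.exp (-θ k) * P₁ k / s k) (fun k => Complex.exp (θ k) * P₂ k)
      ζ (2 * b / iteratedDeriv 2 s ζ * Complex.exp (-(2 * θ ζ)))
      (d / b - iteratedDeriv 3 s ζ / (3 * iteratedDeriv 2 s ζ) - 2 * deriv θ ζ) := by
  set σ₂ := iteratedDeriv 2 s ζ with hσ₂
  set σ₃ := iteratedDeriv 3 s ζ with hσ₃
  set D := d / b - σ₃ / (3 * σ₂) - 2 * deriv θ ζ with hD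
  set L := 𝓝[≠] ζ with hL
  have hone : ∀ {f : ℂ → ℂ}, AnalyticAt ℂ f ζ → f =O[L] (fun _ => (1 : ℂ)) := fun h =>
    isBigO_one_of_continuousAt h.continuousAt
  have hid : AnalyticAt ℂ (fun k : ℂ => k - ζ) ζ := analyticAt_id.sub analyticAt_const
  -- second order vanishing
  have hF : (fun k => P₁ k - (b + d * (k - ζ)) * P₂ k) =O[L] fun k => (k - ζ) ^ 2 := by
    have hFa : AnalyticAt ℂ (fun k => P₁ k - (b + d * (k - ζ)) * P₂ k) ζ :=
      hP₁.sub ((analyticAt_const.add (analyticAt_const.mul hid)).mul hP₂)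
    refine ((isBigO_sub_taylor hFa 2).mono nhdsWithin_le_nhds).congr_left fun k => ?_
    have hder : deriv (fun k => P₁ k - (b + d * (k - ζ)) * P₂ k) ζ = 0 := by
      have hl : HasDerivAt (fun k : ℂ => b + d * (k - ζ)) d ζ := by
        simpa using (((hasDerivAt_id ζ).sub_const ζ).const_mul d).const_add b
      have := (hP₁.differentiableAt.hasDerivAt.sub
        (hl.mul hP₂.differentiableAt.hasDerivAt)).deriv
      refine Eq.trans ?_ (this.trans ?_)
      · rfl
      · linear_combination h1
    simp only [Finset.sum_range_succ, Finset.range_zero, Finset.sum_empty, iteratedDeriv_zero,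
      iteratedDeriv_one, hder]
    simp [h0]
  have hE : (fun k => Complex.exp (2 * (θ k - θ ζ)) - (1 + 2 * deriv θ ζ * (k - ζ)))
      =O[L] fun k => (k - ζ) ^ 2 := by
    have hEa : AnalyticAt ℂ (fun k => Complex.exp (2 * (θ k - θ ζ))) ζ :=
      (analyticAt_const.mul (hθ.sub analyticAt_const)).cexp
    refine ((isBigO_sub_taylor hEa 2).mono nhdsWithin_le_nhds).congr_left fun k => ?_
    have hder : deriv (fun k => Complex.exp (2 * (θ k - θ ζ))) ζ = 2 * deriv θ ζ := by
      have := (((hθ.differentiableAt.hasDerivAt.sub_const (θ ζ)).const_mul 2).cexp).deriv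
      refine this.trans ?_
      simp
    simp only [Finset.sum_range_succ, Finset.range_zero, Finset.sum_empty, iteratedDeriv_zero,
      iteratedDeriv_one, hder]
    simp
  have hS : (fun k => s k - (σ₂ / 2 * (k - ζ) ^ 2 + σ₃ / 6 * (k - ζ) ^ 3))
      =O[L] fun k => (k - ζ) ^ 4 := by
    refine ((isBigO_sub_taylor hs 4).mono nhdsWithin_le_nhds).congr_left fun k => ?_
    simp only [Finset.sum_range_succ, Finset.range_zero, Finset.sum_empty, iteratedDeriv_zero,
      iteratedDeriv_one, hs0, hs1, Nat.factorial, ← hσ₂, ← hσ₃]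
    push_cast
    ring
  have hS2 : s =O[L] fun k => (k - ζ) ^ 2 := by
    refine ((isBigO_sub_taylor hs 2).mono nhdsWithin_le_nhds).congr_left fun k => ?_
    simp [Finset.sum_range_succ, hs0, hs1]
  -- lower bound for `s`
  have hSlow : ∀ᶠ k in L, ‖σ₂‖ / 4 * ‖k - ζ‖ ^ 2 ≤ ‖s k‖ := by
    have h4 : (fun k => s k - σ₂ / 2 * (k - ζ) ^ 2) =O[L] fun k => (k - ζ) ^ 3 := by
      refine ((isBigO_sub_taylor hs 3).mono nhdsWithin_le_nhds).congr_left fun k => ?_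
      simp [Finset.sum_range_succ, hs0, hs1, ← hσ₂]
    have h5 : (fun k : ℂ => (k - ζ) ^ 3) =o[L] fun k => (k - ζ) ^ 2 := by
      have h6 : Tendsto (fun k : ℂ => k - ζ) L (𝓝 0) := by
        have := hid.continuousAt.tendsto.mono_left (nhdsWithin_le_nhds (s := {ζ}ᶜ))
        simpa using this
      have := ((Asymptotics.isLittleO_one_iff ℂ).2 h6).mul_isBigO
        (Asymptotics.isBigO_refl (fun k : ℂ => (k - ζ) ^ 2) L)
      refine this.congr (fun k => by ring) fun k => by ring
    have hpos : 0 < ‖σ₂‖ / 4 := by positivity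
    filter_upwards [(h4.trans_isLittleO h5).bound hpos] with k hk
    have h7 : ‖σ₂ / 2 * (k - ζ) ^ 2‖ = ‖σ₂‖ / 2 * ‖k - ζ‖ ^ 2 := by
      rw [norm_mul, norm_div, norm_pow]; simp
    have h8 := norm_sub_norm_le (σ₂ / 2 * (k - ζ) ^ 2) (σ₂ / 2 * (k - ζ) ^ 2 - s k)
    have h9 : ‖(k - ζ) ^ 2‖ = ‖k - ζ‖ ^ 2 := norm_pow _ _
    rw [sub_sub_cancel, h7, norm_sub_rev (σ₂ / 2 * (k - ζ) ^ 2)] at h8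
    rw [h9] at hk
    linarith
  have hsne : ∀ᶠ k in L, s k ≠ 0 := by
    filter_upwards [hSlow, self_mem_nhdsWithin] with k hk hkζ
    have : 0 < ‖k - ζ‖ := norm_pos_iff.2 (sub_ne_zero.2 hkζ)
    have h3 : 0 < ‖σ₂‖ := norm_pos_iff.2 hs2
    have : 0 < ‖s k‖ := lt_of_lt_of_le (by positivity) hk
    exact norm_pos_iff.1 this
  -- the numerator after multiplication by `s (k - ζ)²`
  set Φ : ℂ → ℂ := fun k => (k - ζ) ^ 2 * P₁ k
    - 2 * b / σ₂ * Complex.exp (2 * (θ k - θ ζ)) * (1 + D * (k - ζ)) * s k * P₂ k with hΦ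
  have hΦO : Φ =O[L] fun k => (k - ζ) ^ 4 := by
    have t1 : (fun k => (k - ζ) ^ 2 * (P₁ k - (b + d * (k - ζ)) * P₂ k))
        =O[L] fun k => (k - ζ) ^ 4 :=
      ((Asymptotics.isBigO_refl (fun k : ℂ => (k - ζ) ^ 2) L).mul hF).congr_right
        fun k => by ring
    have aux : AnalyticAt ℂ (fun k => 2 * b / σ₂ * (1 + D * (k - ζ)) * P₂ k) ζ :=
      (analyticAt_const.mul (analyticAt_const.add (analyticAt_const.mul hid))).mul hP₂
    have t2 := (hone aux).mul (hE.mul hS2)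
    have aux' : AnalyticAt ℂ (fun k => 2 * b / σ₂ * (1 + D * (k - ζ)) * P₂ k
        * (1 + 2 * deriv θ ζ * (k - ζ))) ζ :=
      aux.mul (analyticAt_const.add (analyticAt_const.mul hid))
    have t3 := (hone aux').mul hS
    set e₁ := 2 * deriv θ ζ with he₁
    set e₂ := σ₃ / (3 * σ₂) with he₂
    have aux4 : AnalyticAt ℂ (fun k => P₂ k * (b * (D * e₁ + D * e₂ + e₁ * e₂
        + D * e₁ * e₂ * (k - ζ)))) ζ :=
      hP₂.mul (analyticAt_const.mul (analyticAt_const.add (analyticAt_const.mul hid)))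
    have t4 := (hone aux4).mul (Asymptotics.isBigO_refl (fun k : ℂ => (k - ζ) ^ 4) L)
    have key := ((t1.sub (t2.congr_right fun k => show _ = (k - ζ) ^ 4 by ring)).sub
      (t3.congr_right fun k => show _ = (k - ζ) ^ 4 by ring)).sub
      (t4.congr_right fun k => show _ = (k - ζ) ^ 4 by ring)
    refine key.congr_left fun k => ?_
    have hσ₃' : σ₃ = 3 * σ₂ * e₂ := by rw [he₂]; field_simp
    have hd' : d = b * (D + e₂ + e₁) := by rw [hD]; field_simp; ring
    simp only [hΦ]
    rw [hσ₃', hd']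
    field_simp
    ring
  have hquot : (fun k => Φ k / (s k * (k - ζ) ^ 2)) =O[L] (fun _ => (1 : ℂ)) := by
    refine isBigO_div_of_isBigO_mul ?_ (hΦO.trans ?_)
    · filter_upwards [hsne, self_mem_nhdsWithin] with k hk hkζ
      exact mul_ne_zero hk (pow_ne_zero 2 (sub_ne_zero.2 hkζ))
    · refine Asymptotics.IsBigO.of_bound (4 / ‖σ₂‖) ?_
      filter_upwards [hSlow] with k hk
      have h3 : 0 < ‖σ₂‖ := norm_pos_iff.2 hs2
      rw [norm_mul, norm_pow, norm_pow, div_mul_eq_mul_div, le_div_iff₀ h3]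
      have := mul_le_mul_of_nonneg_right hk (sq_nonneg ‖k - ζ‖)
      nlinarith
  have hexp : AnalyticAt ℂ (fun k => Complex.exp (-θ k)) ζ := hθ.neg.cexp
  have hfin := (hone hexp).mul hquot
  simp only [mul_one] at hfin
  refine hfin.congr' ?_ (Eventually.of_forall fun _ => rfl)
  filter_upwards [hsne, self_mem_nhdsWithin] with k hk hkζ
  have hkζ' : k - ζ ≠ 0 := sub_ne_zero.2 hkζ
  have e1 : Complex.exp (θ k) = Complex.exp (-θ k) * Complex.exp (2 * (θ k - θ ζ))
      * Complex.exp (2 * θ ζ) := by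
    rw [← Complex.exp_add, ← Complex.exp_add]; congr 1; ring
  have e2 : Complex.exp (-(2 * θ ζ)) * Complex.exp (2 * θ ζ) = 1 := by
    rw [← Complex.exp_add, neg_add_cancel, Complex.exp_zero]
  simp only [hΦ]
  rw [e1]
  have e3 : (2 * b / σ₂ * Complex.exp (-(2 * θ ζ)) / (k - ζ) ^ 2
      + 2 * b / σ₂ * Complex.exp (-(2 * θ ζ)) * D / (k - ζ))
      * (Complex.exp (-θ k) * Complex.exp (2 * (θ k - θ ζ)) * Complex.exp (2 * θ ζ) * P₂ k)
      = (2 * b / σ₂ / (k - ζ) ^ 2 + 2 * b / σ₂ * D / (k - ζ))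
      * (Complex.exp (-θ k) * Complex.exp (2 * (θ k - θ ζ)) * P₂ k) := by
    linear_combination ((2 * b / σ₂ / (k - ζ) ^ 2 + 2 * b / σ₂ * D / (k - ζ))
      * (Complex.exp (-θ k) * Complex.exp (2 * (θ k - θ ζ)) * P₂ k)) * e2
  rw [e3]
  field_simp
  try ring

/-! ### Rational functions with double poles -/

/-- The principal part `a/(k-ζ)² + b/(k-ζ)`. -/
noncomputable def polarPart (a b ζ k : ℂ) : ℂ := a / (k - ζ) ^ 2 + b / (k - ζ)

lemma hasDerivAt_polarPart (a b : ℂ) {ζ k : ℂ} (h : k ≠ ζ) :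
    HasDerivAt (polarPart a b ζ) (-2 * a / (k - ζ) ^ 3 - b / (k - ζ) ^ 2) k := by
  have hk : k - ζ ≠ 0 := sub_ne_zero.2 h
  have h1 : HasDerivAt (fun k : ℂ => k - ζ) 1 k := (hasDerivAt_id k).sub_const ζ
  have h2 := ((hasDerivAt_const k a).div (h1.pow 2) (pow_ne_zero 2 hk)).add
    ((hasDerivAt_const k b).div h1 hk)
  refine h2.congr_deriv ?_
  simp only [Pi.pow_apply]
  field_simp
  push_cast
  ring

lemma tendsto_sub_inv_cobounded (ζ : ℂ) :
    Tendsto (fun k : ℂ => (k - ζ)⁻¹) (Bornology.cobounded ℂ) (𝓝 0) := by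
  refine tendsto_inv₀_cobounded.comp ?_
  simp only [sub_eq_add_neg]
  exact tendsto_add_const_cobounded (-ζ)

lemma tendsto_polarPart (a b ζ : ℂ) :
    Tendsto (polarPart a b ζ) (Bornology.cobounded ℂ) (𝓝 0) := by
  have h := tendsto_sub_inv_cobounded ζ
  have h2 := ((h.pow 2).const_mul a).add (h.const_mul b)
  simp only [ne_eq, OfNat.ofNat_ne_zero, not_false_eq_true, zero_pow, mul_zero, add_zero] at h2
  refine h2.congr fun k => ?_
  simp [polarPart, div_eq_mul_inv]

lemma tendsto_mul_polarPart (a b ζ : ℂ) :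
    Tendsto (fun k => k * polarPart a b ζ k) (Bornology.cobounded ℂ) (𝓝 b) := by
  have h := tendsto_sub_inv_cobounded ζ
  have h2 := ((h.const_mul a).add ((h.pow 2).const_mul (a * ζ))).add
    ((h.const_mul (b * ζ)).const_add b)
  simp only [ne_eq, OfNat.ofNat_ne_zero, not_false_eq_true, zero_pow, mul_zero, add_zero,
    zero_add] at h2
  refine h2.congr' ?_
  have hne : ∀ᶠ k in Bornology.cobounded ℂ, k ∉ ({ζ} : Set ℂ) :=
    (Set.finite_singleton ζ).isBounded
  filter_upwards [hne] with k hk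
  have hk0 : k - ζ ≠ 0 := sub_ne_zero.2 hk
  simp only [polarPart]
  field_simp
  ring

section Expansion

variable {ι : Type} [Fintype ι] {ζ : ι → ℂ} (a b : ι → ℂ)

lemma hasDerivAt_sum_polarPart {k : ℂ} (hk : ∀ i, k ≠ ζ i) :
    HasDerivAt (fun k => ∑ i, polarPart (a i) (b i) (ζ i) k)
      (∑ i, (-2 * a i / (k - ζ i) ^ 3 - b i / (k - ζ i) ^ 2)) k :=
  HasDerivAt.fun_sum fun i _ => hasDerivAt_polarPart (a i) (b i) (hk i)

lemma tendsto_sum_polarPart :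
    Tendsto (fun k => ∑ i, polarPart (a i) (b i) (ζ i) k) (Bornology.cobounded ℂ) (𝓝 0) := by
  simpa using tendsto_finsetSum Finset.univ fun i _ => tendsto_polarPart (a i) (b i) (ζ i)

lemma tendsto_mul_sum_polarPart :
    Tendsto (fun k => k * ∑ i, polarPart (a i) (b i) (ζ i) k) (Bornology.cobounded ℂ)
      (𝓝 (∑ i, b i)) := by
  simp only [Finset.mul_sum]
  exact tendsto_finsetSum Finset.univ fun i _ => tendsto_mul_polarPart (a i) (b i) (ζ i)

lemma sum_polarPart_sub_isBigO (hζ : Function.Injective ζ) (i : ι) :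
    (fun k => (∑ j, polarPart (a j) (b j) (ζ j) k) - polarPart (a i) (b i) (ζ i) k)
      =O[𝓝[≠] (ζ i)] (fun _ => (1 : ℂ)) := by
  classical
  have h : (fun k => (∑ j, polarPart (a j) (b j) (ζ j) k) - polarPart (a i) (b i) (ζ i) k)
      = fun k => ∑ j ∈ Finset.univ.erase i, polarPart (a j) (b j) (ζ j) k := by
    funext k
    rw [← Finset.add_sum_erase _ _ (Finset.mem_univ i), add_sub_cancel_left]
  rw [h]
  refine isBigO_one_of_continuousAt ?_
  refine (HasDerivAt.fun_sum fun j hj => hasDerivAt_polarPart (a j) (b j) ?_).continuousAt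
  exact fun he => (Finset.ne_of_mem_erase hj) (hζ he).symm

/-- A function with double poles that converges at infinity is the sum of its limit and its
principal parts. -/
lemma eq_add_sum_polarPart (hζ : Function.Injective ζ) {f : ℂ → ℂ} {L : ℂ}
    (hd : ∀ k, (∀ i, k ≠ ζ i) → DifferentiableAt ℂ f k)
    (hp : ∀ i, (fun k => f k - polarPart (a i) (b i) (ζ i) k)
      =O[𝓝[≠] (ζ i)] (fun _ => (1 : ℂ)))
    (hL : Tendsto f (Bornology.cobounded ℂ) (𝓝 L)) (k : ℂ) (hk : ∀ i, k ≠ ζ i) :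
    f k = L + ∑ i, polarPart (a i) (b i) (ζ i) k := by
  have hmem : ∀ k, k ∉ Set.range ζ ↔ ∀ i, k ≠ ζ i := fun k => by
    simp only [Set.mem_range, not_exists, ne_eq, eq_comm]
  have hlim := hL.sub (tendsto_sum_polarPart (ζ := ζ) a b)
  rw [sub_zero] at hlim
  obtain ⟨c, hc⟩ := exists_eq_const_of_bounded_off_finset (Set.finite_range ζ)
    (f := fun k => f k - ∑ i, polarPart (a i) (b i) (ζ i) k)
    (fun k hk => (hd k ((hmem k).1 hk)).sub
      (hasDerivAt_sum_polarPart a b ((hmem k).1 hk)).differentiableAt)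
    (by
      rintro _ ⟨i, rfl⟩
      exact ((hp i).sub (sum_polarPart_sub_isBigO a b hζ i)).congr_left fun k => by ring)
    (hlim.isBigO_one ℂ)
  have hcL : c = L := by
    refine tendsto_nhds_unique (tendsto_const_nhds.congr' ?_) hlim
    have hfin : ∀ᶠ k in Bornology.cobounded ℂ, k ∉ Set.range ζ := (Set.finite_range ζ).isBounded
    filter_upwards [hfin] with k hk using (hc k hk).symm
  have := hc k ((hmem k).2 hk)
  rw [← hcL, ← this]
  ring

end Expansion

/-! ### The linear systems for the values at the poles -/

section Rows

variable {ι : Type} (A B : ℂ → ℂ) (z : ι → ℂ) (x t : ℝ)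

/-- The coefficient of `(k - ζ_s)⁻²` in the residue condition at `ζ_s`. -/
noncomputable def poleC (s : ι) : ℂ := A (z s) * Complex.exp (-(2 * Complex.I * theta (z s) x t))

/-- The coefficient of `(k - ζ_j^*)⁻²` in the residue condition at `ζ_j^*`. -/
noncomputable def poleCt (j : ι) : ℂ :=
  A (conj (z j)) * Complex.exp (2 * Complex.I * theta (conj (z j)) x t)

/-- A row `(f, g)` of meromorphic functions with the poles and the residue conditions of the
Riemann-Hilbert problem: `f` has double poles at the `ζ_s`, with principal parts given by `g`,
and `g` has double poles at the `ζ_j^*`, with principal parts given by `f`. -/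
structure IsRow (f g : ℂ → ℂ) : Prop where
  differentiableAt_fst : ∀ k, (∀ s, k ≠ z s) → DifferentiableAt ℂ f k
  differentiableAt_snd : ∀ k, (∀ j, k ≠ conj (z j)) → DifferentiableAt ℂ g k
  residue_fst : ∀ s, ResidueCondition f g (z s) (poleC A z x t s) (coefD B z x t s)
  residue_snd : ∀ j, ResidueCondition g f (conj (z j)) (poleCt A z x t j) (coefDt B z x t j)

variable {A B z x t}

variable [Fintype ι]

lemma analyticAt_of_differentiableAt_off {f : ℂ → ℂ} {ζ : ι → ℂ}
    (hd : ∀ k, (∀ s, k ≠ ζ s) → DifferentiableAt ℂ f k) {k : ℂ} (hk : ∀ s, k ≠ ζ s) :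
    AnalyticAt ℂ f k := by
  rw [Complex.analyticAt_iff_eventually_differentiableAt]
  have : ∀ᶠ w in 𝓝 k, ∀ s, w ≠ ζ s := by
    rw [eventually_all]
    exact fun s => (continuous_id.continuousAt).eventually_ne (hk s)
  filter_upwards [this] with w hw using hd w hw

lemma IsRow.analyticAt_fst {f g : ℂ → ℂ} (h : IsRow A B z x t f g) {k : ℂ} (hk : ∀ s, k ≠ z s) :
    AnalyticAt ℂ f k := analyticAt_of_differentiableAt_off h.differentiableAt_fst hk

lemma IsRow.analyticAt_snd {f g : ℂ → ℂ} (h : IsRow A B z x t f g) {k : ℂ}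
    (hk : ∀ j, k ≠ conj (z j)) : AnalyticAt ℂ g k :=
  analyticAt_of_differentiableAt_off (ζ := fun j => conj (z j)) h.differentiableAt_snd hk

variable (A B z x t) in
/-- The coefficients of the principal part of `f` at `ζ_s`, from value and derivative of `g`. -/
noncomputable def leadF (Y : ι ⊕ ι → ℂ) (s : ι) : ℂ := poleC A z x t s * Y (Sum.inl s)

variable (A B z x t) in
/-- The residue of `f` at `ζ_s`. -/
noncomputable def resF (Y : ι ⊕ ι → ℂ) (s : ι) : ℂ :=
  poleC A z x t s * (coefD B z x t s * Y (Sum.inl s) + Y (Sum.inr s))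

variable (A B z x t) in
/-- The coefficients of the principal part of `g` at `ζ_j^*`, from value and derivative of `f`. -/
noncomputable def leadG (X : ι ⊕ ι → ℂ) (j : ι) : ℂ := poleCt A z x t j * X (Sum.inl j)

variable (A B z x t) in
/-- The residue of `g` at `ζ_j^*`. -/
noncomputable def resG (X : ι ⊕ ι → ℂ) (j : ι) : ℂ :=
  poleCt A z x t j * (coefDt B z x t j * X (Sum.inl j) + X (Sum.inr j))

variable (A B z x t) in
/-- The sum of the principal parts of `f`. -/
noncomputable def polarF (Y : ι ⊕ ι → ℂ) (k : ℂ) : ℂ :=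
  ∑ s, polarPart (leadF A z x t Y s) (resF A B z x t Y s) (z s) k

variable (A B z x t) in
/-- The sum of the principal parts of `g`. -/
noncomputable def polarG (X : ι ⊕ ι → ℂ) (k : ℂ) : ℂ :=
  ∑ j, polarPart (leadG A z x t X j) (resG A B z x t X j) (conj (z j)) k

variable (A B z x t) in
/-- The derivative of `polarF`. -/
noncomputable def polarF' (Y : ι ⊕ ι → ℂ) (k : ℂ) : ℂ :=
  ∑ s, (-2 * leadF A z x t Y s / (k - z s) ^ 3 - resF A B z x t Y s / (k - z s) ^ 2)

variable (A B z x t) in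
/-- The derivative of `polarG`. -/
noncomputable def polarG' (X : ι ⊕ ι → ℂ) (k : ℂ) : ℂ :=
  ∑ j, (-2 * leadG A z x t X j / (k - conj (z j)) ^ 3 - resG A B z x t X j / (k - conj (z j)) ^ 2)

/-- The matrix `G` composes the maps from values of `f` to values of `g` and back. -/
lemma matG_mulVec (X : ι ⊕ ι → ℂ) :
    let Y : ι ⊕ ι → ℂ := Sum.elim (fun s => polarG A B z x t X (z s))
      (fun s => polarG' A B z x t X (z s))
    (matG A B z x t).mulVec X = Sum.elim (fun n => polarF A B z x t Y (conj (z n)))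
      (fun n => polarF' A B z x t Y (conj (z n))) := by
  intro Y
  funext n
  rcases n with n | n
  · simp only [Matrix.mulVec, dotProduct, Fintype.sum_sum_type, matG, Matrix.fromBlocks_apply₁₁,
      Matrix.fromBlocks_apply₁₂, Matrix.of_apply, Sum.elim_inl, g11, g12, Finset.sum_mul]
    rw [← Finset.sum_add_distrib]
    simp only [← Finset.sum_add_distrib]
    rw [Finset.sum_comm]
    refine Finset.sum_congr rfl fun s _ => ?_
    simp only [polarPart, leadF, resF, Y, Sum.elim_inl, Sum.elim_inr, polarG, polarG', leadG, resG,
      Finset.mul_sum, Finset.sum_div, ← Finset.sum_add_distrib, poleC, poleCt, coefC, coefCt]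
    refine Finset.sum_congr rfl fun j _ => ?_
    generalize z s - conj (z j) = f, conj (z n) - z s = e
    ring
  · simp only [Matrix.mulVec, dotProduct, Fintype.sum_sum_type, matG, Matrix.fromBlocks_apply₂₁,
      Matrix.fromBlocks_apply₂₂, Matrix.of_apply, Sum.elim_inr, g21, g22, Finset.sum_mul]
    rw [← Finset.sum_add_distrib]
    simp only [← Finset.sum_add_distrib]
    rw [Finset.sum_comm]
    refine Finset.sum_congr rfl fun s _ => ?_
    simp only [leadF, resF, Y, Sum.elim_inl, Sum.elim_inr, polarG, polarG', leadG, resG, polarPart,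
      Finset.mul_sum, Finset.sum_div, ← Finset.sum_add_distrib, ← Finset.sum_sub_distrib,
      poleC, poleCt, coefC, coefCt]
    refine Finset.sum_congr rfl fun j _ => ?_
    generalize z s - conj (z j) = f, conj (z n) - z s = e
    ring

lemma polarPart_sub_zero {K D X₁ X₂ ζ k : ℂ} (hζ : ζ ≠ 0) (hk : k ≠ ζ) :
    polarPart (K * X₁) (K * (D * X₁ + X₂)) ζ k - polarPart (K * X₁) (K * (D * X₁ + X₂)) ζ 0
      = K / (k - ζ) * (k / ζ) * ((D + 1 / (k - ζ) - 1 / ζ) * X₁ + X₂) := by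
  have h : k - ζ ≠ 0 := sub_ne_zero.2 hk
  simp only [polarPart]
  field_simp
  ring

/-- The analogue of `matG_mulVec` for `G̃`, with the principal parts normalized to vanish at the
origin. -/
lemma matGt_mulVec (hz : ∀ s, z s ≠ 0) (hzz : ∀ i j, z i ≠ conj (z j)) (X : ι ⊕ ι → ℂ) :
    let Y : ι ⊕ ι → ℂ := Sum.elim (fun s => polarG A B z x t X (z s) - polarG A B z x t X 0)
      (fun s => polarG' A B z x t X (z s))
    (matGt A B z x t).mulVec X = Sum.elim
      (fun n => polarF A B z x t Y (conj (z n)) - polarF A B z x t Y 0)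
      (fun n => polarF' A B z x t Y (conj (z n))) := by
  intro Y
  have hzc : ∀ s, conj (z s) ≠ 0 := fun s => by simpa using hz s
  have hY1 : ∀ s, Y (Sum.inl s) = ∑ j, poleCt A z x t j / (z s - conj (z j)) * (z s / conj (z j))
      * ((coefDt B z x t j + 1 / (z s - conj (z j)) - 1 / conj (z j)) * X (Sum.inl j)
        + X (Sum.inr j)) := fun s => by
    simp only [Y, Sum.elim_inl, polarG, ← Finset.sum_sub_distrib, leadG, resG]
    exact Finset.sum_congr rfl fun j _ => polarPart_sub_zero (hzc j) (hzz s j)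
  have hX1 : ∀ n, polarF A B z x t Y (conj (z n)) - polarF A B z x t Y 0
      = ∑ s, poleC A z x t s / (conj (z n) - z s) * (conj (z n) / z s)
        * ((coefD B z x t s + 1 / (conj (z n) - z s) - 1 / z s) * Y (Sum.inl s)
          + Y (Sum.inr s)) := fun n => by
    simp only [polarF, ← Finset.sum_sub_distrib, leadF, resF]
    exact Finset.sum_congr rfl fun s _ => polarPart_sub_zero (hz s) (hzz s n).symm
  funext n
  rcases n with n | n
  · simp only [Matrix.mulVec, dotProduct, Fintype.sum_sum_type, matGt, Matrix.fromBlocks_apply₁₁,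
      Matrix.fromBlocks_apply₁₂, Matrix.of_apply, Sum.elim_inl, gt11, gt12, Finset.sum_mul,
      Finset.mul_sum]
    rw [← Finset.sum_add_distrib]
    simp only [← Finset.sum_add_distrib]
    rw [Finset.sum_comm, hX1]
    refine Finset.sum_congr rfl fun s _ => ?_
    rw [hY1]
    simp only [Y, Sum.elim_inr, polarG', leadG, resG,
      Finset.mul_sum, ← Finset.sum_add_distrib, poleC, poleCt, coefC, coefCt]
    refine Finset.sum_congr rfl fun j _ => ?_
    generalize z s - conj (z j) = f, conj (z n) - z s = e
    ring
  · simp only [Matrix.mulVec, dotProduct, Fintype.sum_sum_type, matGt, Matrix.fromBlocks_apply₂₁,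
      Matrix.fromBlocks_apply₂₂, Matrix.of_apply, Sum.elim_inr, gt21, gt22, Finset.sum_mul]
    rw [← Finset.sum_add_distrib]
    simp only [← Finset.sum_add_distrib]
    rw [Finset.sum_comm]
    refine Finset.sum_congr rfl fun s _ => ?_
    simp only [leadF, resF]
    rw [hY1]
    simp only [Y, Sum.elim_inr, polarG', leadG, resG,
      Finset.mul_sum, Finset.sum_div, ← Finset.sum_add_distrib, ← Finset.sum_sub_distrib,
      poleC, poleCt, coefC, coefCt]
    refine Finset.sum_congr rfl fun j _ => ?_
    generalize z s - conj (z j) = f, conj (z n) - z s = e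
    ring

end Rows

/-! ### The vanishing lemma and the determinants -/

section Systems

variable {ι : Type} {A B : ℂ → ℂ} {z : ι → ℂ} {x t : ℝ}

/-- Values and derivatives of `f` at the points `w`. -/
noncomputable def jet (w : ι → ℂ) (f : ℂ → ℂ) : ι ⊕ ι → ℂ :=
  Sum.elim (fun n => f (w n)) (fun n => deriv f (w n))

lemma conj_injective_comp (hinj : Function.Injective z) :
    Function.Injective fun j => conj (z j) :=
  fun _ _ h => hinj ((starRingEnd ℂ).injective h)

variable [Fintype ι]

lemma hasDerivAt_polarF (Y : ι ⊕ ι → ℂ) {k : ℂ} (hk : ∀ s, k ≠ z s) :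
    HasDerivAt (polarF A B z x t Y) (polarF' A B z x t Y k) k :=
  hasDerivAt_sum_polarPart _ _ hk

lemma hasDerivAt_polarG (X : ι ⊕ ι → ℂ) {k : ℂ} (hk : ∀ j, k ≠ conj (z j)) :
    HasDerivAt (polarG A B z x t X) (polarG' A B z x t X k) k :=
  hasDerivAt_sum_polarPart (ζ := fun j => conj (z j)) _ _ hk

lemma eventually_ne_points {ζ : ι → ℂ} {k : ℂ} (hk : ∀ s, k ≠ ζ s) : ∀ᶠ w in 𝓝 k, ∀ s, w ≠ ζ s := by
  rw [eventually_all]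
  exact fun s => continuousAt_id.eventually_ne (hk s)

namespace IsRow

variable {f g : ℂ → ℂ} (hinj : Function.Injective z) (hzz : ∀ i j, z i ≠ conj (z j))
include hinj hzz

/-- The first entry is the sum of its limit at infinity and of principal parts determined by the
values of the second entry. -/
lemma fst_eq (h : IsRow A B z x t f g) {L : ℂ} (hL : Tendsto f (Bornology.cobounded ℂ) (𝓝 L))
    {k : ℂ} (hk : ∀ s, k ≠ z s) : f k = L + polarF A B z x t (jet z g) k :=
  eq_add_sum_polarPart _ _ hinj h.differentiableAt_fst
    (fun s => (residueCondition_iff (h.analyticAt_snd (hzz s))).1 (h.residue_fst s)) hL k hk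

lemma snd_eq (h : IsRow A B z x t f g) {L : ℂ} (hL : Tendsto g (Bornology.cobounded ℂ) (𝓝 L))
    {k : ℂ} (hk : ∀ j, k ≠ conj (z j)) :
    g k = L + polarG A B z x t (jet (fun j => conj (z j)) f) k :=
  eq_add_sum_polarPart _ _ (conj_injective_comp hinj) h.differentiableAt_snd
    (fun j => (residueCondition_iff (h.analyticAt_fst fun s => (hzz s j).symm)).1
      (h.residue_snd j)) hL k hk

lemma deriv_fst (h : IsRow A B z x t f g) {L : ℂ} (hL : Tendsto f (Bornology.cobounded ℂ) (𝓝 L))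
    {k : ℂ} (hk : ∀ s, k ≠ z s) : deriv f k = polarF' A B z x t (jet z g) k := by
  have he : f =ᶠ[𝓝 k] fun k => L + polarF A B z x t (jet z g) k := by
    filter_upwards [eventually_ne_points hk] with w hw using h.fst_eq hinj hzz hL hw
  rw [he.deriv_eq]
  exact ((hasDerivAt_polarF _ hk).const_add L).deriv

lemma deriv_snd (h : IsRow A B z x t f g) {L : ℂ} (hL : Tendsto g (Bornology.cobounded ℂ) (𝓝 L))
    {k : ℂ} (hk : ∀ j, k ≠ conj (z j)) :
    deriv g k = polarG' A B z x t (jet (fun j => conj (z j)) f) k := by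
  have he : g =ᶠ[𝓝 k] fun k => L + polarG A B z x t (jet (fun j => conj (z j)) f) k := by
    filter_upwards [eventually_ne_points (ζ := fun j => conj (z j)) hk] with w hw
      using h.snd_eq hinj hzz hL hw
  rw [he.deriv_eq]
  exact ((hasDerivAt_polarG _ hk).const_add L).deriv

/-- The linear system with matrix `I - G` for a row normalized at infinity. -/
lemma system_matG (h : IsRow A B z x t f g) {L : ℂ}
    (hL : Tendsto f (Bornology.cobounded ℂ) (𝓝 L)) (h0 : Tendsto g (Bornology.cobounded ℂ) (𝓝 0)) :
    jet (fun j => conj (z j)) f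
      = L • tau + (matG A B z x t).mulVec (jet (fun j => conj (z j)) f) := by
  have hY : (Sum.elim (fun s => polarG A B z x t (jet (fun j => conj (z j)) f) (z s))
      (fun s => polarG' A B z x t (jet (fun j => conj (z j)) f) (z s)) : ι ⊕ ι → ℂ) = jet z g := by
    funext s
    rcases s with s | s
    · simpa [jet] using (h.snd_eq hinj hzz h0 (hzz s)).symm
    · simpa [jet] using (h.deriv_snd hinj hzz h0 (hzz s)).symm
  have hG := matG_mulVec (A := A) (B := B) (z := z) (x := x) (t := t)
    (jet (fun j => conj (z j)) f)
  simp only [hY] at hG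
  rw [hG]
  funext n
  rcases n with n | n
  · simpa [jet, tau] using h.fst_eq hinj hzz hL fun s => (hzz s n).symm
  · simpa [jet, tau] using h.deriv_fst hinj hzz hL fun s => (hzz s n).symm

/-- The linear system with matrix `I - G̃` for a row normalized at the origin. -/
lemma system_matGt (hz : ∀ s, z s ≠ 0) (h : IsRow A B z x t f g) {L M : ℂ}
    (hL : Tendsto f (Bornology.cobounded ℂ) (𝓝 L)) (hM : Tendsto g (Bornology.cobounded ℂ) (𝓝 M))
    (h0 : g 0 = 0) :
    jet (fun j => conj (z j)) f
      = f 0 • tau + (matGt A B z x t).mulVec (jet (fun j => conj (z j)) f) := by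
  have hzc : ∀ s, (0 : ℂ) ≠ conj (z s) := fun s h => hz s (by simpa using h.symm)
  have hY : (Sum.elim (fun s => polarG A B z x t (jet (fun j => conj (z j)) f) (z s)
        - polarG A B z x t (jet (fun j => conj (z j)) f) 0)
      (fun s => polarG' A B z x t (jet (fun j => conj (z j)) f) (z s)) : ι ⊕ ι → ℂ) = jet z g := by
    funext s
    rcases s with s | s
    · have h1 := h.snd_eq hinj hzz hM hzc
      simp only [jet, Sum.elim_inl] at h1 ⊢
      rw [h.snd_eq hinj hzz hM (hzz s)]
      rw [h0] at h1
      simp only [jet]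
      linear_combination h1
    · simpa [jet] using (h.deriv_snd hinj hzz hM (hzz s)).symm
  have hG := matGt_mulVec (A := A) (B := B) (z := z) (x := x) (t := t) hz hzz
    (jet (fun j => conj (z j)) f)
  simp only [hY] at hG
  rw [hG]
  funext n
  rcases n with n | n
  · have h1 := h.fst_eq hinj hzz hL (fun s => (hz s).symm)
    have h2 := h.fst_eq hinj hzz hL (k := conj (z n)) fun s => (hzz s n).symm
    simp only [Pi.add_apply, Pi.smul_apply, tau, Sum.elim_inl, smul_eq_mul, mul_one]
    simp only [jet, Sum.elim_inl] at h1 h2 ⊢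
    linear_combination h2 - h1
  · simpa [jet, tau] using h.deriv_fst hinj hzz hL fun s => (hzz s n).symm

end IsRow

/-- Sums of principal parts with consistent coefficients form a row. -/
lemma isRow_polar (hinj : Function.Injective z) (hzz : ∀ i j, z i ≠ conj (z j)) (cf cg : ℂ)
    (X Y : ι ⊕ ι → ℂ)
    (hY : Y = Sum.elim (fun s => cg + polarG A B z x t X (z s))
      (fun s => polarG' A B z x t X (z s)))
    (hX : X = Sum.elim (fun n => cf + polarF A B z x t Y (conj (z n)))
      (fun n => polarF' A B z x t Y (conj (z n)))) :
    IsRow A B z x t (fun k => cf + polarF A B z x t Y k) (fun k => cg + polarG A B z x t X k) := by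
  have hd1 : ∀ k, (∀ s, k ≠ z s) → HasDerivAt (fun k => cf + polarF A B z x t Y k)
      (polarF' A B z x t Y k) k := fun k hk => (hasDerivAt_polarF Y hk).const_add cf
  have hd2 : ∀ k, (∀ j, k ≠ conj (z j)) → HasDerivAt (fun k => cg + polarG A B z x t X k)
      (polarG' A B z x t X k) k := fun k hk => (hasDerivAt_polarG X hk).const_add cg
  have hzz' : ∀ j s, conj (z j) ≠ z s := fun j s => (hzz s j).symm
  refine ⟨fun k hk => (hd1 k hk).differentiableAt, fun k hk => (hd2 k hk).differentiableAt,
    fun s => ?_, fun j => ?_⟩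
  · rw [residueCondition_iff (analyticAt_of_differentiableAt_off (ζ := fun j => conj (z j))
      (fun k hk => (hd2 k hk).differentiableAt) (hzz s)), (hd2 _ (hzz s)).deriv]
    have h1 : cg + polarG A B z x t X (z s) = Y (Sum.inl s) := by rw [hY]; rfl
    have h2 : polarG' A B z x t X (z s) = Y (Sum.inr s) := by rw [hY]; rfl
    rw [h1, h2]
    refine ((isBigO_one_of_continuousAt (f := fun _ => cf) continuousAt_const).add
      (sum_polarPart_sub_isBigO (leadF A z x t Y) (resF A B z x t Y) hinj s)).congr_left
      fun k => ?_
    simp only [polarF, polarPart, leadF, resF]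
    ring
  · rw [residueCondition_iff (analyticAt_of_differentiableAt_off
      (fun k hk => (hd1 k hk).differentiableAt) (hzz' j)), (hd1 _ (hzz' j)).deriv]
    have h1 : cf + polarF A B z x t Y (conj (z j)) = X (Sum.inl j) := by rw [hX]; rfl
    have h2 : polarF' A B z x t Y (conj (z j)) = X (Sum.inr j) := by rw [hX]; rfl
    rw [h1, h2]
    refine ((isBigO_one_of_continuousAt (f := fun _ => cg) continuousAt_const).add
      (sum_polarPart_sub_isBigO (leadG A z x t X) (resG A B z x t X)
        (conj_injective_comp hinj) j)).congr_left fun k => ?_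
    simp only [polarG, polarPart, leadG, resG]
    ring

/-- The matrix `(m₁₁, m₁₂; m₂₁, m₂₂)` solves the Riemann-Hilbert problem: its rows satisfy the
residue conditions, its determinant is `1`, and it converges to the invertible diagonal matrix
`diag (e, e')` at infinity. -/
structure IsSolRHP (A B : ℂ → ℂ) (z : ι → ℂ) (x t : ℝ) (m₁₁ m₁₂ m₂₁ m₂₂ : ℂ → ℂ) (e e' : ℂ) :
    Prop where
  row₁ : IsRow A B z x t m₁₁ m₁₂
  row₂ : IsRow A B z x t m₂₁ m₂₂
  det_eq_one : ∀ k, (∀ s, k ≠ z s) → (∀ s, k ≠ conj (z s)) → m₁₁ k * m₂₂ k - m₁₂ k * m₂₁ k = 1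
  tendsto₁₁ : Tendsto m₁₁ (Bornology.cobounded ℂ) (𝓝 e)
  tendsto₁₂ : Tendsto m₁₂ (Bornology.cobounded ℂ) (𝓝 0)
  tendsto₂₁ : Tendsto m₂₁ (Bornology.cobounded ℂ) (𝓝 0)
  tendsto₂₂ : Tendsto m₂₂ (Bornology.cobounded ℂ) (𝓝 e')

lemma eventually_cobounded_ne (ζ : ι → ℂ) : ∀ᶠ k in Bornology.cobounded ℂ, ∀ s, k ≠ ζ s := by
  have h : ∀ᶠ k in Bornology.cobounded ℂ, k ∉ Set.range ζ := (Set.finite_range ζ).isBounded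
  filter_upwards [h] with k hk s hs using hk ⟨s, hs.symm⟩

/-- The Wronskian of two rows is constant; it vanishes if one of them tends to zero somewhere. -/
lemma IsRow.wronskian_eq_zero (hzz : ∀ i j, z i ≠ conj (z j)) {f₁ g₁ f₂ g₂ : ℂ → ℂ}
    (h1 : IsRow A B z x t f₁ g₁) (h2 : IsRow A B z x t f₂ g₂)
    (hf₁ : f₁ =O[Bornology.cobounded ℂ] (fun _ => (1 : ℂ)))
    (hg₁ : g₁ =O[Bornology.cobounded ℂ] (fun _ => (1 : ℂ)))
    (hf₂ : f₂ =O[Bornology.cobounded ℂ] (fun _ => (1 : ℂ)))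
    (hg₂ : g₂ =O[Bornology.cobounded ℂ] (fun _ => (1 : ℂ)))
    {l : Filter ℂ} [l.NeBot] (hl : ∀ᶠ k in l, (∀ s, k ≠ z s) ∧ ∀ s, k ≠ conj (z s))
    (hf₁l : Tendsto f₁ l (𝓝 0)) (hg₁l : Tendsto g₁ l (𝓝 0))
    (hf₂l : f₂ =O[l] (fun _ => (1 : ℂ))) (hg₂l : g₂ =O[l] (fun _ => (1 : ℂ)))
    {k : ℂ} (hk : ∀ s, k ≠ z s) (hk' : ∀ s, k ≠ conj (z s)) : f₁ k * g₂ k - g₁ k * f₂ k = 0 := by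
  have hmem : ∀ k, k ∉ Set.range z ∪ Set.range (fun s => conj (z s)) ↔
      (∀ s, k ≠ z s) ∧ ∀ s, k ≠ conj (z s) := fun k => by
    simp only [Set.mem_union, Set.mem_range, not_or, not_exists, ne_eq, eq_comm]
  have hb := (hf₁.mul hg₂).sub (hg₁.mul hf₂)
  simp only [mul_one] at hb
  obtain ⟨c, hc⟩ := exists_eq_const_of_bounded_off_finset
    ((Set.finite_range z).union (Set.finite_range fun s => conj (z s)))
    (f := fun k => f₁ k * g₂ k - g₁ k * f₂ k)
    (fun k hk => by
      obtain ⟨ha, hb⟩ := (hmem k).1 hk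
      exact ((h1.differentiableAt_fst k ha).mul (h2.differentiableAt_snd k hb)).sub
        ((h1.differentiableAt_snd k hb).mul (h2.differentiableAt_fst k ha)))
    (by
      rintro _ (⟨s, rfl⟩ | ⟨s, rfl⟩)
      · exact (h1.residue_fst s).wronskian_isBigO (h2.residue_fst s)
          (h1.analyticAt_snd (hzz s)).continuousAt (h2.analyticAt_snd (hzz s)).continuousAt
      · refine ((h1.residue_snd s).wronskian_isBigO (h2.residue_snd s)
          (h1.analyticAt_fst fun j => (hzz j s).symm).continuousAt
          (h2.analyticAt_fst fun j => (hzz j s).symm).continuousAt).neg_left.congr_left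
          fun k => by ring)
    hb
  have hlim : Tendsto (fun k => f₁ k * g₂ k - g₁ k * f₂ k) l (𝓝 0) := by
    have ha := ((Asymptotics.isLittleO_one_iff ℂ).2 hf₁l).mul_isBigO hg₂l
    have hb := ((Asymptotics.isLittleO_one_iff ℂ).2 hg₁l).mul_isBigO hf₂l
    have := ha.sub hb
    simp only [mul_one] at this
    exact (Asymptotics.isLittleO_one_iff ℂ).1 this
  have hc0 : c = 0 := by
    refine tendsto_nhds_unique (tendsto_const_nhds.congr' ?_) hlim
    filter_upwards [hl] with k hk using (hc k ((hmem k).2 hk)).symm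
  rw [← hc0]
  exact hc k ((hmem k).2 ⟨hk, hk'⟩)

variable {m₁₁ m₁₂ m₂₁ m₂₂ : ℂ → ℂ} {e e' : ℂ}

/-- The vanishing lemma: a bounded row that tends to zero at infinity, or vanishes at the origin,
is zero. -/
lemma IsSolRHP.jet_eq_zero (hM : IsSolRHP A B z x t m₁₁ m₁₂ m₂₁ m₂₂ e e')
    (hzz : ∀ i j, z i ≠ conj (z j)) {f g : ℂ → ℂ} (h : IsRow A B z x t f g)
    (hf : f =O[Bornology.cobounded ℂ] (fun _ => (1 : ℂ)))
    (hg : g =O[Bornology.cobounded ℂ] (fun _ => (1 : ℂ)))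
    {l : Filter ℂ} [l.NeBot] (hl : ∀ᶠ k in l, (∀ s, k ≠ z s) ∧ ∀ s, k ≠ conj (z s))
    (hfl : Tendsto f l (𝓝 0)) (hgl : Tendsto g l (𝓝 0))
    (hm₁₁ : m₁₁ =O[l] (fun _ => (1 : ℂ))) (hm₁₂ : m₁₂ =O[l] (fun _ => (1 : ℂ)))
    (hm₂₁ : m₂₁ =O[l] (fun _ => (1 : ℂ))) (hm₂₂ : m₂₂ =O[l] (fun _ => (1 : ℂ))) :
    jet (fun j => conj (z j)) f = 0 := by
  -- the row times the inverse of the matrix vanishes, entry by entry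
  have hzero : ∀ k, (∀ s, k ≠ z s) → (∀ s, k ≠ conj (z s)) → f k = 0 := fun k hk hk' => by
    have h1 := h.wronskian_eq_zero hzz hM.row₁ hf hg (hM.tendsto₁₁.isBigO_one ℂ)
      (hM.tendsto₁₂.isBigO_one ℂ) hl hfl hgl hm₁₁ hm₁₂ hk hk'
    have h2 := h.wronskian_eq_zero hzz hM.row₂ hf hg (hM.tendsto₂₁.isBigO_one ℂ)
      (hM.tendsto₂₂.isBigO_one ℂ) hl hfl hgl hm₂₁ hm₂₂ hk hk'
    linear_combination m₁₁ k * h2 - m₂₁ k * h1 - f k * hM.det_eq_one k hk hk'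
  -- `f` is regular at the points `conj (z n)`, so it vanishes there with its derivative
  have hev : ∀ n, f =ᶠ[𝓝 (conj (z n))] fun _ => 0 := fun n => by
    have hn : ∀ s, conj (z n) ≠ z s := fun s => (hzz s n).symm
    rw [← (h.analyticAt_fst hn).continuousAt.eventuallyEq_nhds_iff_eventuallyEq_nhdsNE
      continuousAt_const]
    have hfin : ∀ᶠ k in 𝓝[≠] (conj (z n)), ∀ s, k ≠ conj (z s) := by
      rw [eventually_all]
      intro s
      by_cases hs : conj (z n) = conj (z s)
      · rw [← hs]
        exact eventually_mem_nhdsWithin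
      · exact nhdsWithin_le_nhds (continuousAt_id.eventually_ne hs)
    filter_upwards [hfin, nhdsWithin_le_nhds (eventually_ne_points hn)] with k hk hk'
      using hzero k hk' hk
  funext n
  rcases n with n | n
  · exact (hev n).eq_of_nhds
  · exact (hev n).deriv_eq.trans (deriv_const _ _)

variable [DecidableEq ι]

/-- A matrix `1 - H` without kernel is invertible; the kernel consists of the solutions of the
homogeneous linear system. -/
lemma det_one_sub_ne_zero {H : Matrix (ι ⊕ ι) (ι ⊕ ι) ℂ} (h : ∀ X, X = H.mulVec X → X = 0) :
    (1 - H).det ≠ 0 := by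
  intro hdet
  obtain ⟨X, hX, hHX⟩ := Matrix.exists_mulVec_eq_zero_iff.2 hdet
  refine hX (h X ?_)
  rw [Matrix.sub_mulVec, Matrix.one_mulVec, sub_eq_zero] at hHX
  exact hHX

/-- A solution `X = G X` yields a row made of principal parts only. It tends to zero at infinity. -/
lemma IsSolRHP.det_matG_ne_zero (hM : IsSolRHP A B z x t m₁₁ m₁₂ m₂₁ m₂₂ e e')
    (hinj : Function.Injective z) (hzz : ∀ i j, z i ≠ conj (z j)) :
    (1 - matG A B z x t).det ≠ 0 := by
  refine det_one_sub_ne_zero fun X hX => ?_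
  set Y : ι ⊕ ι → ℂ := Sum.elim (fun s => polarG A B z x t X (z s))
    (fun s => polarG' A B z x t X (z s)) with hY
  have hX' : X = Sum.elim (fun n => polarF A B z x t Y (conj (z n)))
      (fun n => polarF' A B z x t Y (conj (z n))) := hX.trans (matG_mulVec X)
  have hrow := isRow_polar (A := A) (B := B) (x := x) (t := t) hinj hzz 0 0 X Y
    (by simpa using hY) (by simpa using hX')
  simp only [zero_add] at hrow
  have hf : Tendsto (fun k => polarF A B z x t Y k) (Bornology.cobounded ℂ) (𝓝 0) :=
    tendsto_sum_polarPart _ _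
  have hg : Tendsto (fun k => polarG A B z x t X k) (Bornology.cobounded ℂ) (𝓝 0) :=
    tendsto_sum_polarPart _ _
  have h0 := hM.jet_eq_zero hzz hrow (hf.isBigO_one ℂ) (hg.isBigO_one ℂ)
    ((eventually_cobounded_ne z).and (eventually_cobounded_ne fun s => conj (z s))) hf hg
    (hM.tendsto₁₁.isBigO_one ℂ) (hM.tendsto₁₂.isBigO_one ℂ) (hM.tendsto₂₁.isBigO_one ℂ)
    (hM.tendsto₂₂.isBigO_one ℂ)
  rw [← h0]
  refine hX'.trans ?_
  funext n
  rcases n with n | n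
  · rfl
  · exact (hasDerivAt_polarF Y fun s => (hzz s n).symm).deriv.symm

/-- A solution `X = G̃ X` yields a bounded row that vanishes at the origin. -/
lemma IsSolRHP.det_matGt_ne_zero (hM : IsSolRHP A B z x t m₁₁ m₁₂ m₂₁ m₂₂ e e')
    (hinj : Function.Injective z) (hzz : ∀ i j, z i ≠ conj (z j)) (hz : ∀ s, z s ≠ 0) :
    (1 - matGt A B z x t).det ≠ 0 := by
  refine det_one_sub_ne_zero fun X hX => ?_
  set Y : ι ⊕ ι → ℂ := Sum.elim (fun s => polarG A B z x t X (z s) - polarG A B z x t X 0)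
    (fun s => polarG' A B z x t X (z s)) with hY
  have hX' : X = Sum.elim (fun n => polarF A B z x t Y (conj (z n)) - polarF A B z x t Y 0)
      (fun n => polarF' A B z x t Y (conj (z n))) := hX.trans (matGt_mulVec hz hzz X)
  have hrow := isRow_polar (A := A) (B := B) (x := x) (t := t) hinj hzz
    (-polarF A B z x t Y 0) (-polarG A B z x t X 0) X Y
    (by simpa only [neg_add_eq_sub] using hY) (by simpa only [neg_add_eq_sub] using hX')
  have hf : Tendsto (fun k => -polarF A B z x t Y 0 + polarF A B z x t Y k)
      (Bornology.cobounded ℂ) (𝓝 (-polarF A B z x t Y 0 + 0)) :=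
    (tendsto_sum_polarPart _ _).const_add _
  have hg : Tendsto (fun k => -polarG A B z x t X 0 + polarG A B z x t X k)
      (Bornology.cobounded ℂ) (𝓝 (-polarG A B z x t X 0 + 0)) :=
    (tendsto_sum_polarPart _ _).const_add _
  -- the vanishing lemma applies along the filter `pure 0`
  have hpure : ∀ f : ℂ → ℂ, f =O[pure 0] (fun _ => (1 : ℂ)) := fun f =>
    Asymptotics.IsBigO.of_bound ‖f 0‖ (by simp)
  have h0 := hM.jet_eq_zero hzz hrow (hf.isBigO_one ℂ) (hg.isBigO_one ℂ) (l := pure 0)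
    (eventually_pure.2 ⟨fun s => (hz s).symm, fun s h => hz s (by simpa using h.symm)⟩)
    (tendsto_pure_left.2 fun s hs => by simpa using mem_of_mem_nhds hs)
    (tendsto_pure_left.2 fun s hs => by simpa using mem_of_mem_nhds hs)
    (hpure _) (hpure _) (hpure _) (hpure _)
  rw [← h0]
  refine hX'.trans ?_
  funext n
  rcases n with n | n
  · simp [jet, neg_add_eq_sub]
  · exact ((hasDerivAt_polarF Y fun s => (hzz s n).symm).const_add _).deriv.symm

omit [DecidableEq ι] in
lemma alpha_dotProduct (X : ι ⊕ ι → ℂ) : alpha A B z x t ⬝ᵥ X = ∑ j, resG A B z x t X j := by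
  simp only [dotProduct, Fintype.sum_sum_type, alpha, Sum.elim_inl, Sum.elim_inr,
    ← Finset.sum_add_distrib, resG, poleCt]
  exact Finset.sum_congr rfl fun j _ => by ring

omit [DecidableEq ι] in
lemma IsRow.alpha_dotProduct_jet {f g : ℂ → ℂ} (hinj : Function.Injective z)
    (hzz : ∀ i j, z i ≠ conj (z j)) (h : IsRow A B z x t f g)
    (h0 : Tendsto g (Bornology.cobounded ℂ) (𝓝 0)) {w : ℂ}
    (hw : Tendsto (fun k => k * g k) (Bornology.cobounded ℂ) (𝓝 w)) :
    alpha A B z x t ⬝ᵥ jet (fun j => conj (z j)) f = w := by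
  rw [alpha_dotProduct]
  refine tendsto_nhds_unique (tendsto_mul_sum_polarPart (ζ := fun j => conj (z j))
    (leadG A z x t (jet (fun j => conj (z j)) f)) _) (hw.congr' ?_)
  filter_upwards [eventually_cobounded_ne fun j => conj (z j)] with k hk
  rw [h.snd_eq hinj hzz h0 hk, zero_add]
  rfl

/-- If `X` solves the linear system with matrix `I - H` and right-hand side `L τ`, then
`L det R = -(α X) det (I - H)`. -/
lemma det_bordered {H : Matrix (ι ⊕ ι) (ι ⊕ ι) ℂ} (hdet : (1 - H).det ≠ 0) {X : ι ⊕ ι → ℂ} {L : ℂ}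
    (hX : X = L • tau + H.mulVec X) :
    L * (bordered A B z x t H).det = -(alpha A B z x t ⬝ᵥ X) * (1 - H).det := by
  have hu : IsUnit (1 - H).det := hdet.isUnit
  let _ := Matrix.invertibleOfIsUnitDet (1 - H) hu
  have hX' : X = (1 - H)⁻¹.mulVec (L • tau) := by
    have h1 : (1 - H).mulVec X = L • tau := by
      rw [Matrix.sub_mulVec, Matrix.one_mulVec, sub_eq_iff_eq_add]
      exact hX
    rw [← h1, Matrix.mulVec_mulVec, Matrix.nonsing_inv_mul _ hu, Matrix.one_mulVec]
  rw [bordered, Matrix.det_fromBlocks₂₂, Matrix.det_unique (n := Unit),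
    Matrix.invOf_eq_nonsing_inv, Matrix.mul_assoc, ← Matrix.replicateCol_mulVec, Matrix.sub_apply,
    Matrix.replicateRow_mul_replicateCol_apply, hX', Matrix.mulVec_smul, dotProduct_smul]
  simp only [Matrix.zero_apply, smul_eq_mul]
  ring

/-- The determinants express the coefficient `w` of `1/k` in `m₁₂`. -/
lemma IsSolRHP.det_matR (hM : IsSolRHP A B z x t m₁₁ m₁₂ m₂₁ m₂₂ e e')
    (hinj : Function.Injective z) (hzz : ∀ i j, z i ≠ conj (z j)) {w : ℂ}
    (hw : Tendsto (fun k => k * m₁₂ k) (Bornology.cobounded ℂ) (𝓝 w)) :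
    e * (matR A B z x t).det = -w * (1 - matG A B z x t).det := by
  rw [← hM.row₁.alpha_dotProduct_jet hinj hzz hM.tendsto₁₂ hw]
  exact det_bordered (hM.det_matG_ne_zero hinj hzz)
    (hM.row₁.system_matG hinj hzz hM.tendsto₁₁ hM.tendsto₁₂)

/-- The analogue of `IsSolRHP.det_matR` for the normalization at the origin: the value
`m₁₁ 0 = 1` takes the place of the limit `e` at infinity. -/
lemma IsSolRHP.det_matRt (hM : IsSolRHP A B z x t m₁₁ m₁₂ m₂₁ m₂₂ e e')
    (hinj : Function.Injective z) (hzz : ∀ i j, z i ≠ conj (z j)) (hz : ∀ s, z s ≠ 0)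
    (h1 : m₁₁ 0 = 1) (h0 : m₁₂ 0 = 0) {w : ℂ}
    (hw : Tendsto (fun k => k * m₁₂ k) (Bornology.cobounded ℂ) (𝓝 w)) :
    (matRt A B z x t).det = -w * (1 - matGt A B z x t).det := by
  have h := det_bordered (A := A) (B := B) (z := z) (x := x) (t := t)
    (hM.det_matGt_ne_zero hinj hzz hz)
    (hM.row₁.system_matGt hinj hzz hz hM.tendsto₁₁ hM.tendsto₁₂ h0)
  rw [h1, one_mul, hM.row₁.alpha_dotProduct_jet hinj hzz hM.tendsto₁₂ hw] at h
  exact h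

/-- The determinant formula for `q`, from a solution of the Riemann-Hilbert problem. -/
lemma IsSolRHP.conclusion (hM : IsSolRHP A B z x t m₁₁ m₁₂ m₂₁ m₂₂ e (conj e))
    (hinj : Function.Injective z) (hzz : ∀ i j, z i ≠ conj (z j)) (hz : ∀ s, z s ≠ 0)
    (h1 : m₁₁ 0 = 1) (h0 : m₁₂ 0 = 0) {u : ℂ} (he : e * conj e = 1)
    (hw : Tendsto (fun k => k * m₁₂ k) (Bornology.cobounded ℂ)
      (𝓝 (Complex.I / 2 * u * conj e))) :
    (1 - matG A B z x t).det ≠ 0 ∧ (1 - matGt A B z x t).det ≠ 0 ∧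
    ((matR A B z x t).det = 0 ↔ u = 0) ∧ ((matRt A B z x t).det = 0 ↔ u = 0) ∧
    u = 2 * Complex.I * ((1 - matG A B z x t).det / (matR A B z x t).det) *
      ((matRt A B z x t).det / (1 - matGt A B z x t).det) ^ 2 := by
  have hG := hM.det_matG_ne_zero hinj hzz
  have hGt := hM.det_matGt_ne_zero hinj hzz hz
  have hR := hM.det_matR hinj hzz hw
  have hRt := hM.det_matRt hinj hzz hz h1 h0 hw
  have he0 : e ≠ 0 := left_ne_zero_of_mul_eq_one he
  have hc0 : conj e ≠ 0 := right_ne_zero_of_mul_eq_one he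
  have hR' : (matR A B z x t).det
      = -(Complex.I / 2 * u * conj e) * (1 - matG A B z x t).det * conj e := by
    linear_combination conj e * hR - (matR A B z x t).det * he
  refine ⟨hG, hGt, ?_, ?_, ?_⟩
  · rw [hR']
    simp [hG, hc0]
  · rw [hRt]
    simp [hGt, hc0]
  · rcases eq_or_ne u 0 with rfl | hu
    -- both determinants of bordered matrices vanish, and the quotient is `x / 0 = 0`
    · rw [hRt, hR']
      simp
    · rw [hRt, hR']
      field_simp
      linear_combination Complex.I_sq

end Systems

/-! ### The Lax pair -/

/-- The matrix of the temporal part `Ψ_t = T Ψ` of the Lax pair, as a function of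
`a = q`, `b = q_x`, `c = q_xx`. -/
noncomputable def timeMatrix (k a b c : ℂ) : Matrix (Fin 2) (Fin 2) ℂ :=
  !![4 * Complex.I * k ^ 6 - 2 * Complex.I * a * conj a * k ^ 4
      + k ^ 2 * (a * conj b - conj a * b + 3 / 2 * Complex.I * a ^ 2 * conj a ^ 2),
    4 * k ^ 5 * a + k ^ 3 * (-2 * Complex.I * b - 2 * a ^ 2 * conj a)
      + k * (-c + 3 * Complex.I * a * conj a * b + 3 / 2 * a ^ 3 * conj a ^ 2);
    -(4 * k ^ 5 * conj a) + k ^ 3 * (-2 * Complex.I * conj b + 2 * a * conj a ^ 2)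
      + k * (conj c + 3 * Complex.I * a * conj a * conj b - 3 / 2 * a ^ 2 * conj a ^ 3),
    -(4 * Complex.I * k ^ 6 - 2 * Complex.I * a * conj a * k ^ 4
      + k ^ 2 * (a * conj b - conj a * b + 3 / 2 * Complex.I * a ^ 2 * conj a ^ 2))]

/-- The matrix `T` of the temporal part of the Lax pair. -/
noncomputable def laxT (q : ℝ → ℝ → ℂ) (k : ℂ) (x t : ℝ) : Matrix (Fin 2) (Fin 2) ℂ :=
  timeMatrix k (q x t) (dx q 1 x t) (dx q 2 x t)

/-- The derivative of `laxX` with respect to `t`. -/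
noncomputable def laxXt (q : ℝ → ℝ → ℂ) (k : ℂ) (x t : ℝ) : Matrix (Fin 2) (Fin 2) ℂ :=
  !![0, k * dt q x t; -(k * conj (dt q x t)), 0]

lemma laxX_eq (q : ℝ → ℝ → ℂ) (k : ℂ) (x t : ℝ) :
    laxX q k x t = !![Complex.I * k ^ 2, k * q x t; -(k * conj (q x t)), -(Complex.I * k ^ 2)] := by
  ext i j
  fin_cases i <;> fin_cases j <;> simp [laxX, sigma3, potential] <;> ring

lemma hasDerivAt_conj_comp {f : ℝ → ℂ} {f' : ℂ} {x : ℝ} (h : HasDerivAt f f' x) :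
    HasDerivAt (fun y => conj (f y)) (conj f') x :=
  Complex.conjCLE.toContinuousLinearMap.hasFDerivAt.comp_hasDerivAt x h

section Solution

variable {q : ℝ → ℝ → ℂ}

lemma dx_zero : dx q 0 = q := by
  funext x t
  simp [dx]

namespace IsSolution

variable (hq : IsSolution q)
include hq

lemma hasDerivAt_dx {m : ℕ} (hm : m < 3) (x t : ℝ) :
    HasDerivAt (fun y => dx q m y t) (dx q (m + 1) x t) x := by
  have h := ((hq.contDiff_x t).differentiable_iteratedDeriv m (by exact_mod_cast hm)) x
  have h2 := h.hasDerivAt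
  rw [← iteratedDeriv_succ] at h2
  exact h2

lemma hasDerivAt_x (x t : ℝ) : HasDerivAt (fun y => q y t) (dx q 1 x t) x := by
  have := hq.hasDerivAt_dx (m := 0) (by norm_num) x t
  rwa [dx_zero] at this

lemma hasDerivAt_t (x t : ℝ) : HasDerivAt (fun s => q x s) (dt q x t) t :=
  (hq.differentiable_t x t).hasDerivAt

lemma continuous_uncurry : Continuous (fun p : ℝ × ℝ => q p.1 p.2) := by
  have := hq.continuous_dx 0 (by norm_num)
  rwa [dx_zero] at this

/-- The flow equation with its derivatives expanded, where `|q|² = q q^*`. -/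
lemma dt_eq (x t : ℝ) : dt q x t = -dx q 3 x t
    + 3 * Complex.I * ((dx q 1 x t * conj (q x t) + q x t * conj (dx q 1 x t)) * dx q 1 x t
      + q x t * conj (q x t) * dx q 2 x t)
    + 3 / 2 * (3 * q x t ^ 2 * dx q 1 x t * conj (q x t) ^ 2
      + 2 * q x t ^ 3 * conj (q x t) * conj (dx q 1 x t)) := by
  have h0 := hq.hasDerivAt_x x t
  have h1 : HasDerivAt (fun y => dx q 1 y t) (dx q 2 x t) x :=
    hq.hasDerivAt_dx (m := 1) (by norm_num) x t
  have h0c := hasDerivAt_conj_comp h0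
  have e1 : (fun y => (‖q y t‖ : ℂ) ^ 2 * dx q 1 y t)
      = fun y => q y t * conj (q y t) * dx q 1 y t := by
    funext y
    rw [Complex.mul_conj']
  have e2 : (fun y => (‖q y t‖ : ℂ) ^ 4 * q y t)
      = fun y => (q y t * conj (q y t)) * (q y t * conj (q y t)) * q y t := by
    funext y
    rw [Complex.mul_conj']
    ring
  have d1 := ((h0.mul h0c).mul h1).deriv
  have d2 := (((h0.mul h0c).mul (h0.mul h0c)).mul h0).deriv
  have h := hq.eqn x t
  rw [e1, e2] at h
  erw [d1, d2] at h
  simp only [Pi.mul_apply] at h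
  linear_combination h

/-- The zero curvature equation `T_x = X_t + X T - T X`. -/
lemma hasDerivAt_laxT (k : ℂ) (x t : ℝ) (i j : Fin 2) :
    HasDerivAt (fun y => laxT q k y t i j)
      ((laxXt q k x t + laxX q k x t * laxT q k x t - laxT q k x t * laxX q k x t) i j) x := by
  have a := hq.hasDerivAt_x x t
  have b : HasDerivAt (fun y => dx q 1 y t) (dx q 2 x t) x :=
    hq.hasDerivAt_dx (m := 1) (by norm_num) x t
  have c : HasDerivAt (fun y => dx q 2 y t) (dx q 3 x t) x :=
    hq.hasDerivAt_dx (m := 2) (by norm_num) x t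
  have a' := hasDerivAt_conj_comp a
  have b' := hasDerivAt_conj_comp b
  have c' := hasDerivAt_conj_comp c
  have hd := hq.dt_eq x t
  have hA := ((((a.const_mul (2 * Complex.I)).mul a').mul_const (k ^ 4)).const_sub
    (4 * Complex.I * k ^ 6)).add ((((a.mul b').sub (a'.mul b)).add
      (((a.pow 2).const_mul (3 / 2 * Complex.I)).mul (a'.pow 2))).const_mul (k ^ 2))
  rw [laxX_eq]
  simp only [laxT, laxXt, hd, timeMatrix]
  fin_cases i <;> fin_cases j
  · refine hA.congr_deriv ?_
    simp
    ring
  · have hB := (a.const_mul (4 * k ^ 5)).add (((b.const_mul (-2 * Complex.I)).sub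
      (((a.pow 2).const_mul 2).mul a')).const_mul (k ^ 3)) |>.add
      (((c.neg.add (((a.const_mul (3 * Complex.I)).mul a').mul b)).add
        (((a.pow 3).const_mul (3 / 2)).mul (a'.pow 2))).const_mul k)
    refine hB.congr_deriv ?_
    simp
    ring_nf
    simp only [Complex.I_sq]
    ring
  · have hC := (a'.const_mul (4 * k ^ 5)).neg.add (((b'.const_mul (-2 * Complex.I)).add
      ((a.const_mul 2).mul (a'.pow 2))).const_mul (k ^ 3)) |>.add
      (((c'.add (((a.const_mul (3 * Complex.I)).mul a').mul b')).sub
        (((a.pow 2).const_mul (3 / 2)).mul (a'.pow 3))).const_mul k)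
    refine hC.congr_deriv ?_
    have h3 : conj (3 : ℂ) = 3 := map_ofNat _ 3
    have h2 : conj (2 : ℂ) = 2 := map_ofNat _ 2
    simp [h3, h2]
    ring_nf
    simp only [Complex.I_sq]
    ring
  · refine hA.neg.congr_deriv ?_
    simp
    ring

end IsSolution
end Solution

/-! ### Time evolution of the Jost solutions -/

lemma entryNorm_add_le (A B : Matrix (Fin 2) (Fin 2) ℂ) :
    entryNorm (A + B) ≤ entryNorm A + entryNorm B := by
  simp only [entryNorm, ← Finset.sum_add_distrib]
  exact Finset.sum_le_sum fun a _ => Finset.sum_le_sum fun b _ => norm_add_le (A a b) (B a b)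

lemma mulVec_apply (A : Matrix (Fin 2) (Fin 2) ℂ) (v : Fin 2 → ℂ) (i : Fin 2) :
    A.mulVec v i = A i 0 * v 0 + A i 1 * v 1 := by
  rw [Matrix.mulVec, dotProduct, Fin.sum_univ_two]

lemma hasDerivAt_mulVec {A : ℝ → Matrix (Fin 2) (Fin 2) ℂ} {A' : Matrix (Fin 2) (Fin 2) ℂ}
    {v : ℝ → Fin 2 → ℂ} {v' : Fin 2 → ℂ} {s : ℝ}
    (hA : ∀ i j, HasDerivAt (fun s => A s i j) (A' i j) s)
    (hv : HasDerivAt v v' s) :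
    HasDerivAt (fun s => (A s).mulVec (v s)) (A'.mulVec (v s) + (A s).mulVec v') s := by
  rw [hasDerivAt_pi] at hv ⊢
  intro i
  simp only [Pi.add_apply, mulVec_apply]
  refine (((hA i 0).mul (hv 0)).add ((hA i 1).mul (hv 1))).congr_deriv ?_
  ring

/-- First order Taylor expansion, locally uniform in a parameter. -/
lemma eventually_norm_sub_sub_smul_le {E : Type*} [NormedAddCommGroup E] [NormedSpace ℝ E]
    {G G' : ℝ → ℝ → E} (hG : ∀ y s, HasDerivAt (fun y => G y s) (G' y s) y)
    (hc : Continuous fun p : ℝ × ℝ => G' p.1 p.2) (x τ : ℝ) {ε : ℝ} (hε : 0 < ε) :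
    ∀ᶠ y in 𝓝 x, ∀ s, |s| ≤ τ → ‖G y s - G x s - (y - x) • G' x s‖ ≤ ε * |y - x| := by
  have h1 := (isCompact_Icc (a := -τ) (b := τ)).eventually_forall_of_forall_eventually (x₀ := x)
    (P := fun y s => ‖G' y s - G' x s‖ ≤ ε) (fun s _ => by
      have hcont : Continuous fun p : ℝ × ℝ => ‖G' p.1 p.2 - G' x p.2‖ :=
        (hc.sub (hc.comp (continuous_const.prodMk continuous_snd))).norm
      have := (hcont.continuousAt (x := (x, s))).eventually_lt_const (u := ε) (by simpa using hε)
      filter_upwards [this] with p hp using hp.le)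
  obtain ⟨δ, hδ, h2⟩ := Metric.eventually_nhds_iff_ball.1 h1
  filter_upwards [Metric.ball_mem_nhds x hδ] with y hy s hs
  have h3 := (convex_ball x δ).norm_image_sub_le_of_norm_hasDerivWithin_le
    (f := fun y => G y s - (y - x) • G' x s) (f' := fun y => G' y s - G' x s) (C := ε) (x := x)
    (y := y) (fun w _ => by
      refine ((hG w s).sub (((hasDerivAt_id w).sub_const x).smul_const (G' x s))).congr_deriv ?_
        |>.hasDerivWithinAt
      simp) (fun w hw => h2 w hw s (abs_le.1 hs)) (Metric.mem_ball_self hδ) hy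
  simp only [sub_self, zero_smul, sub_zero] at h3
  rw [sub_right_comm]
  exact h3

lemma continuous_timeMatrix : Continuous fun p : ℂ × ℂ × ℂ × ℂ =>
    timeMatrix p.1 p.2.1 p.2.2.1 p.2.2.2 := by
  refine continuous_matrix fun i j => ?_
  fin_cases i <;> fin_cases j <;> simp only [timeMatrix] <;> simp <;> fun_prop

lemma timeMatrix_zero_mulVec (k : ℂ) (i : Fin 2) : (timeMatrix k 0 0 0).mulVec (Pi.single i 1)
    = (4 * Complex.I * k ^ 6 * sigma3 i i) • Pi.single i 1 := by
  funext j
  fin_cases i <;> fin_cases j <;> simp [timeMatrix, sigma3]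

section Evolution

variable {q : ℝ → ℝ → ℂ}

namespace IsSolution

variable (hq : IsSolution q)
include hq

lemma continuous_laxT : Continuous fun p : ℂ × ℝ × ℝ => laxT q p.1 p.2.1 p.2.2 := by
  have h0 := hq.continuous_uncurry.comp (continuous_snd (X := ℂ) (Y := ℝ × ℝ))
  have h1 := (hq.continuous_dx 1 (by norm_num)).comp (continuous_snd (X := ℂ) (Y := ℝ × ℝ))
  have h2 := (hq.continuous_dx 2 (by norm_num)).comp (continuous_snd (X := ℂ) (Y := ℝ × ℝ))
  exact continuous_timeMatrix.comp (f := fun p : ℂ × ℝ × ℝ =>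
    (p.1, q p.2.1 p.2.2, dx q 1 p.2.1 p.2.2, dx q 2 p.2.1 p.2.2))
    (continuous_fst.prodMk (h0.prodMk (h1.prodMk h2)))

lemma continuous_laxX : Continuous fun p : ℂ × ℝ × ℝ => laxX q p.1 p.2.1 p.2.2 := by
  have h : Continuous fun p : ℂ × ℝ × ℝ => q p.2.1 p.2.2 :=
    hq.continuous_uncurry.comp continuous_snd
  have hk : Continuous fun p : ℂ × ℝ × ℝ => Complex.I * p.1 ^ 2 := by fun_prop
  simp only [laxX_eq]
  refine continuous_matrix fun i j => ?_
  fin_cases i <;> fin_cases j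
  · exact hk
  · exact continuous_fst.mul h
  · exact (continuous_fst.mul (Complex.continuous_conj.comp h)).neg
  · exact hk.neg

lemma continuous_laxXt (k : ℂ) : Continuous fun p : ℝ × ℝ => laxXt q k p.1 p.2 := by
  refine continuous_matrix fun i j => ?_
  fin_cases i <;> fin_cases j
  · exact continuous_const
  · exact continuous_const.mul hq.continuous_dt
  · exact (continuous_const.mul (Complex.continuous_conj.comp hq.continuous_dt)).neg
  · exact continuous_const

lemma continuous_laxT_snd (k : ℂ) : Continuous fun p : ℝ × ℝ => laxT q k p.1 p.2 :=
  hq.continuous_laxT.comp (f := fun p : ℝ × ℝ => (k, p.1, p.2)) (by fun_prop)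

lemma continuous_laxX_snd (k : ℂ) : Continuous fun p : ℝ × ℝ => laxX q k p.1 p.2 :=
  hq.continuous_laxX.comp (f := fun p : ℝ × ℝ => (k, p.1, p.2)) (by fun_prop)

lemma hasDerivAt_laxX_t (k : ℂ) (x t : ℝ) (i j : Fin 2) :
    HasDerivAt (fun s => laxX q k x s i j) (laxXt q k x t i j) t := by
  have h := hq.hasDerivAt_t x t
  have hc := hasDerivAt_conj_comp h
  simp only [laxX_eq]
  fin_cases i <;> fin_cases j <;> simp only [laxXt]
  · exact hasDerivAt_const _ _
  · exact h.const_mul k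
  · exact (hc.const_mul k).neg
  · exact hasDerivAt_const _ _

/-- Solutions of the temporal equation that solve the spatial equation at `t = 0` solve it at
all times. -/
lemma hasDerivAt_x_of_hasDerivAt_t {k : ℂ} {φ : ℝ → ℝ → Fin 2 → ℂ}
    (ht : ∀ x t, HasDerivAt (fun s => φ x s) ((laxT q k x t).mulVec (φ x t)) t)
    (h0 : ∀ x, HasDerivAt (fun y => φ y 0) ((laxX q k x 0).mulVec (φ x 0)) x) (x t : ℝ) :
    HasDerivAt (fun y => φ y t) ((laxX q k x t).mulVec (φ x t)) x := by
  set τ := |t| with hτ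
  have hφc : Continuous (φ x) := continuous_iff_continuousAt.2 fun s => (ht x s).continuousAt
  have hTc := hq.continuous_laxT_snd k
  have hXc := hq.continuous_laxX_snd k
  have hXtc := hq.continuous_laxXt k
  -- `D = T_x`, by the zero curvature equation
  set D : ℝ → ℝ → Matrix (Fin 2) (Fin 2) ℂ := fun y s =>
    laxXt q k y s + laxX q k y s * laxT q k y s - laxT q k y s * laxX q k y s with hD
  have hDc : Continuous fun p : ℝ × ℝ => D p.1 p.2 :=
    (hXtc.add (hXc.matrix_mul hTc)).sub (hTc.matrix_mul hXc)
  obtain ⟨K, hK⟩ := ((isCompact_Icc (a := x - 1) (b := x + 1)).prod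
    (isCompact_Icc (a := -τ) (b := τ))).exists_bound_of_continuousOn
    (f := fun p : ℝ × ℝ => entryNorm (laxT q k p.1 p.2))
    (continuous_entryNorm.comp hTc).continuousOn
  set K' := max K 0
  have hGd : ∀ (v : ℝ → Fin 2 → ℂ) (y s : ℝ), HasDerivAt (fun y => (laxT q k y s).mulVec (v s))
      ((D y s).mulVec (v s)) y := fun v y s => by
    have := hasDerivAt_mulVec (hq.hasDerivAt_laxT k y s) (hasDerivAt_const y (v s))
    exact this.congr_deriv (by rw [Matrix.mulVec_zero, add_zero])
  have hXx : Continuous fun s : ℝ => laxX q k x s :=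
    hXc.comp (f := fun s : ℝ => (x, s)) (by fun_prop)
  have hTx : Continuous fun s : ℝ => laxT q k x s :=
    hTc.comp (f := fun s : ℝ => (x, s)) (by fun_prop)
  rw [hasDerivAt_iff_isLittleO, Asymptotics.isLittleO_iff]
  intro c hc
  set M := Real.exp ((K' + 1) * τ)
  have hM : 0 < M := Real.exp_pos _
  have hε : 0 < c / (3 * M) := by positivity
  have e1 := eventually_norm_sub_sub_smul_le (hGd (φ x))
    (hDc.matrix_mulVec (hφc.comp continuous_snd)) x τ hε
  have e2 := (isCompact_Icc (a := -τ) (b := τ)).eventually_forall_of_forall_eventually (x₀ := x)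
    (P := fun y s => ‖(laxT q k y s).mulVec ((laxX q k x s).mulVec (φ x s))
      - (laxT q k x s).mulVec ((laxX q k x s).mulVec (φ x s))‖ ≤ c / (3 * M)) (fun s _ => by
      have hv : Continuous fun p : ℝ × ℝ => (laxX q k x p.2).mulVec (φ x p.2) :=
        (hXx.matrix_mulVec hφc).comp continuous_snd
      have hT0 : Continuous fun p : ℝ × ℝ => laxT q k x p.2 := hTx.comp continuous_snd
      have hcont := ((hTc.matrix_mulVec hv).sub (hT0.matrix_mulVec hv)).norm
      have := (hcont.continuousAt (x := (x, s))).eventually_lt_const (u := c / (3 * M))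
        (by simpa using hε)
      filter_upwards [this] with p hp using hp.le)
  have e3 := (Asymptotics.isLittleO_iff.1 (hasDerivAt_iff_isLittleO.1 (h0 x))) hε
  filter_upwards [e1, e2, e3, Metric.closedBall_mem_nhds x one_pos] with y h1 h2 h3 h4
  rw [Metric.mem_closedBall, Real.dist_eq, abs_le] at h4
  -- The remainder `φ(y, ·) - φ(x, ·) - (y - x) X φ(x, ·)` is `o(y - x)` at time `0` and solves the
  -- temporal equation at `y` up to an inhomogeneity, which is `o(y - x)` because of `T_x = D`.
  have hw := norm_le_of_hasDerivAt (A := fun s => laxT q k y s)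
    (f := fun s => φ y s - φ x s - (y - x) • (laxX q k x s).mulVec (φ x s))
    (g := fun s => ((laxT q k y s).mulVec (φ x s) - (laxT q k x s).mulVec (φ x s)
        - (y - x) • (D x s).mulVec (φ x s))
      + (y - x) • ((laxT q k y s).mulVec ((laxX q k x s).mulVec (φ x s))
        - (laxT q k x s).mulVec ((laxX q k x s).mulVec (φ x s))))
    (t₀ := 0) (τ := τ) (K := K') (ε := 2 * (c / (3 * M) * |y - x|)) (s := t)
    (le_max_right _ _) (by positivity)
    (fun s => by
      refine (((ht y s).sub (ht x s)).sub ((hasDerivAt_mulVec (hq.hasDerivAt_laxX_t k x s)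
        (ht x s)).const_smul (y - x))).congr_deriv ?_
      simp only [hD, Matrix.mulVec_sub, Matrix.sub_mulVec, Matrix.add_mulVec, Matrix.mulVec_mulVec,
        smul_sub, smul_add, Matrix.mulVec_smul]
      abel)
    (fun s hs => by
      rw [sub_zero] at hs
      refine (le_abs_self _).trans ((hK (y, s) ⟨⟨by linarith, by linarith⟩, abs_le.1 hs⟩).trans
        (le_max_left _ _)))
    (fun s hs => by
      rw [sub_zero] at hs
      refine (norm_add_le _ _).trans ?_
      rw [norm_smul, Real.norm_eq_abs]
      have ha := h1 s hs
      have hb := mul_le_mul_of_nonneg_left (h2 s (abs_le.1 hs)) (abs_nonneg (y - x))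
      linarith)
    (by simp [hτ])
  refine hw.trans ?_
  rw [Real.norm_eq_abs] at h3 ⊢
  calc _ ≤ (c / (3 * M) * |y - x| + 2 * (c / (3 * M) * |y - x|)) * M := by gcongr
    _ = c * |y - x| := by field_simp; ring

omit hq in
/-- Solutions of the temporal equation keep the normalization at infinity. -/
lemma tendsto_exp_smul_of_hasDerivAt_t (hz : ZeroBoundary q) {l : Filter ℝ} (hl : l ≤ cocompact ℝ)
    {k : ℂ} {i : Fin 2} {φ : ℝ → ℝ → Fin 2 → ℂ}
    (ht : ∀ x t, HasDerivAt (fun s => φ x s) ((laxT q k x t).mulVec (φ x t)) t)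
    (h0 : Tendsto (fun x => Complex.exp (-(Complex.I * theta k x 0 * sigma3 i i)) • φ x 0) l
      (𝓝 (Pi.single i 1))) (t : ℝ) :
    Tendsto (fun x => Complex.exp (-(Complex.I * theta k x t * sigma3 i i)) • φ x t) l
      (𝓝 (Pi.single i 1)) := by
  set τ := |t| with hτ
  -- the coefficients of the temporal equation converge to those of the zero potential
  have hT : ∀ ε > 0, ∀ᶠ x in l, ∀ s, |s| ≤ τ →
      entryNorm (laxT q k x s - timeMatrix k 0 0 0) ≤ ε := by
    intro ε hε
    have hF : Continuous fun p : ℂ × ℂ × ℂ =>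
        entryNorm (timeMatrix k p.1 p.2.1 p.2.2 - timeMatrix k 0 0 0) :=
      continuous_entryNorm.comp ((continuous_timeMatrix.comp
        (continuous_const.prodMk continuous_id)).sub continuous_const)
    have hF0 : entryNorm (timeMatrix k 0 0 0 - timeMatrix k 0 0 0) = 0 := by
      simp [entryNorm]
    obtain ⟨δ, hδ, hball⟩ := Metric.eventually_nhds_iff_ball.1
      ((hF.continuousAt (x := 0)).eventually_lt_const (u := ε) (by
        simp only [Prod.fst_zero, Prod.snd_zero]
        rwa [hF0]))
    have hu : ∀ m ≤ 2, ∀ᶠ x in l, ∀ s, |s| ≤ τ → ‖dx q m x s‖ < δ := fun m hm => by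
      have h1 := (tendstoLocallyUniformlyOn_iff_tendstoUniformlyOn_of_compact
        (isCompact_Icc (a := -τ) (b := τ))).1 (hz.tendsto_zero m hm).tendstoLocallyUniformlyOn
      filter_upwards [hl (Metric.tendstoUniformlyOn_iff.1 h1 δ hδ)] with x hx s hs
      simpa using hx s (abs_le.1 hs)
    filter_upwards [hu 0 (by norm_num), hu 1 (by norm_num), hu 2 (by norm_num)] with x a b c s hs
    have h1 := hball (q x s, dx q 1 x s, dx q 2 x s) (by
      rw [mem_ball_zero_iff, Prod.norm_def, Prod.norm_def]
      have ha := a s hs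
      rw [dx_zero] at ha
      exact max_lt ha (max_lt (b s hs) (c s hs)))
    exact h1.le
  set A₀ := timeMatrix k 0 0 0 - (4 * Complex.I * k ^ 6 * sigma3 i i) • 1 with hA₀
  have hexp : ∀ x s : ℝ, HasDerivAt
      (fun s : ℝ => Complex.exp (-(Complex.I * theta k x s * sigma3 i i)))
      (-(4 * Complex.I * k ^ 6 * sigma3 i i)
        * Complex.exp (-(Complex.I * theta k x s * sigma3 i i))) s := fun x s => by
    have h1 : HasDerivAt (fun s : ℝ => (s : ℂ)) 1 s := Complex.ofRealCLM.hasDerivAt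
    have h2 := (((((h1.const_mul (4 * k ^ 4)).const_add (x : ℂ)).const_mul (k ^ 2)).const_mul
      Complex.I).mul_const (sigma3 i i)).neg.cexp
    refine h2.congr_deriv ?_
    simp only [theta, Pi.neg_apply]
    ring
  rw [Metric.tendsto_nhds] at h0 ⊢
  intro ε hε
  set M := Real.exp ((1 + entryNorm A₀ + 1) * τ) with hM
  have hMp : 0 < M := Real.exp_pos _
  have hε1 : 0 < ε / (3 * M) := by positivity
  filter_upwards [hT _ (lt_min one_pos hε1), h0 _ hε1] with x hx hx0
  -- The difference between the normalized solution and the unit vector, which solves the equation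
  -- of the zero potential, satisfies a linear system with small inhomogeneity.
  have hw := norm_le_of_hasDerivAt
    (A := fun s => laxT q k x s - (4 * Complex.I * k ^ 6 * sigma3 i i) • 1)
    (f := fun s => Complex.exp (-(Complex.I * theta k x s * sigma3 i i)) • φ x s - Pi.single i 1)
    (g := fun s => (laxT q k x s - timeMatrix k 0 0 0).mulVec (Pi.single i 1)) (t₀ := 0) (τ := τ)
    (K := 1 + entryNorm A₀) (ε := ε / (3 * M)) (s := t)
    (add_nonneg zero_le_one (entryNorm_nonneg _)) hε1.le
    (fun s => by
      refine (((hexp x s).smul (ht x s)).sub_const (Pi.single i 1)).congr_deriv ?_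
      simp only [Matrix.sub_mulVec, Matrix.mulVec_sub, timeMatrix_zero_mulVec, Matrix.smul_mulVec,
        Matrix.one_mulVec, Matrix.mulVec_smul]
      module)
    (fun s hs => by
      rw [sub_zero] at hs
      have h1 : laxT q k x s - (4 * Complex.I * k ^ 6 * sigma3 i i) • 1
          = (laxT q k x s - timeMatrix k 0 0 0) + A₀ := by rw [hA₀]; abel
      simp only [h1]
      refine (entryNorm_add_le _ _).trans ?_
      have := (hx s hs).trans (min_le_left _ _)
      linarith)
    (fun s hs => by
      rw [sub_zero] at hs
      refine (norm_mulVec_le _ _).trans ?_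
      have h1 : ‖(Pi.single i 1 : Fin 2 → ℂ)‖ = 1 := by rw [Pi.norm_single, norm_one]
      rw [h1, mul_one]
      exact (hx s hs).trans (min_le_right _ _))
    (by simp [hτ])
  rw [dist_eq_norm] at hx0 ⊢
  refine hw.trans_lt ?_
  calc _ ≤ (ε / (3 * M) + ε / (3 * M)) * M := by gcongr
    _ = 2 / 3 * ε := by field_simp; ring
    _ < ε := by linarith

/-- The solution of the temporal equation that starts from a Jost solution is a Jost solution at
all times. -/
lemma exists_isJost (hz : ZeroBoundary q) {l : Filter ℝ} (hl : l ≤ cocompact ℝ) {k : ℂ} {i : Fin 2}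
    {f : ℝ → Fin 2 → ℂ} (hf : IsJost q l i k 0 f) :
    ∃ φ : ℝ → ℝ → Fin 2 → ℂ, (∀ x, φ x 0 = f x) ∧
      (∀ x t, HasDerivAt (fun s => φ x s) ((laxT q k x t).mulVec (φ x t)) t) ∧
      ∀ t, IsJost q l i k t (fun x => φ x t) := by
  have h : ∀ x, ∃ g : ℝ → Fin 2 → ℂ, g 0 = f x ∧
      ∀ s, HasDerivAt g ((laxT q k x s).mulVec (g s)) s := fun x =>
    linearODE_exists
      ((hq.continuous_laxT_snd k).comp (f := fun s : ℝ => (x, s)) (by fun_prop)) (f x)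
  choose φ hφ0 hφt using h
  refine ⟨φ, hφ0, hφt, fun t => ⟨fun x => hq.hasDerivAt_x_of_hasDerivAt_t hφt ?_ x t,
    tendsto_exp_smul_of_hasDerivAt_t hz hl hφt ?_ t⟩⟩
  · intro x
    simpa only [hφ0] using hf.1 x
  · simpa only [hφ0] using hf.2

end IsSolution

end Evolution

/-! ### Uniqueness and representation of the Jost solutions -/

lemma hasDerivAt_wronskian {M : Matrix (Fin 2) (Fin 2) ℂ} (hM : M 1 1 = -M 0 0)
    {f g : ℝ → Fin 2 → ℂ} {s : ℝ} (hf : HasDerivAt f (M.mulVec (f s)) s)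
    (hg : HasDerivAt g (M.mulVec (g s)) s) :
    HasDerivAt (fun s => wronskian (f s) (g s)) 0 s := by
  rw [hasDerivAt_pi] at hf hg
  refine (((hf 0).mul (hg 1)).sub ((hf 1).mul (hg 0))).congr_deriv ?_
  simp only [mulVec_apply, hM]
  ring

lemma wronskian_eq_of_hasDerivAt {M : ℝ → Matrix (Fin 2) (Fin 2) ℂ}
    (hM : ∀ s, M s 1 1 = -M s 0 0) {f g : ℝ → Fin 2 → ℂ}
    (hf : ∀ s, HasDerivAt f ((M s).mulVec (f s)) s)
    (hg : ∀ s, HasDerivAt g ((M s).mulVec (g s)) s) (s s' : ℝ) :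
    wronskian (f s) (g s) = wronskian (f s') (g s') :=
  is_const_of_deriv_eq_zero
    (fun s => (hasDerivAt_wronskian (hM s) (hf s) (hg s)).differentiableAt)
    (fun s => (hasDerivAt_wronskian (hM s) (hf s) (hg s)).deriv) s s'

lemma wronskian_smul (c c' : ℂ) (a b : Fin 2 → ℂ) :
    wronskian (c • a) (c' • b) = c * c' * wronskian a b := by
  simp only [wronskian, Pi.smul_apply, smul_eq_mul]
  ring

lemma exists_eq_smul_of_wronskian_eq_zero {a b : Fin 2 → ℂ} (hb : b ≠ 0) (h : wronskian a b = 0) :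
    ∃ c : ℂ, a = c • b := by
  unfold wronskian at h
  by_cases h0 : b 0 = 0
  · have h1 : b 1 ≠ 0 := fun h1 => hb (by funext i; fin_cases i <;> simp [h0, h1])
    have ha : a 0 = 0 := by simpa [h0, h1] using h
    refine ⟨a 1 / b 1, ?_⟩
    funext i
    fin_cases i <;> simp [h0, h1, ha]
  · refine ⟨a 0 / b 0, ?_⟩
    funext i
    fin_cases i
    · simp [h0]
    · simp only [Fin.mk_one, Pi.smul_apply, smul_eq_mul]
      field_simp
      linear_combination -h

/-- The set of spectral parameters at which the exponential `exp (iθσ)` of the `i`-th column, with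
`σ` the `i`-th diagonal entry of `σ₃`, does not grow along `l`. -/
def IsAdmissible (l : Filter ℝ) (i : Fin 2) (k : ℂ) : Prop :=
  ∀ᶠ x : ℝ in l, 0 ≤ (sigma3 i i).re * (k ^ 2).im * x

lemma isAdmissible_atTop_zero {k : ℂ} : IsAdmissible atTop 0 k ↔ k ^ 2 ∈ upperClosed := by
  constructor
  · intro h
    obtain ⟨x, hx, hx0⟩ := (h.and (eventually_gt_atTop 0)).exists
    simp only [sigma3, Matrix.of_apply, Matrix.cons_val_zero, Complex.one_re, one_mul] at hx
    exact nonneg_of_mul_nonneg_left hx hx0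
  · intro h
    filter_upwards [eventually_ge_atTop 0] with x hx
    simpa [sigma3] using mul_nonneg h hx

lemma isAdmissible_atBot_zero {k : ℂ} : IsAdmissible atBot 0 k ↔ k ^ 2 ∈ lowerClosed := by
  constructor
  · intro h
    obtain ⟨x, hx, hx0⟩ := (h.and (eventually_lt_atBot 0)).exists
    simp only [sigma3, Matrix.of_apply, Matrix.cons_val_zero, Complex.one_re, one_mul] at hx
    exact nonpos_of_mul_nonneg_left hx hx0
  · intro h
    filter_upwards [eventually_le_atBot 0] with x hx
    simpa [sigma3] using mul_nonneg_of_nonpos_of_nonpos h hx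

lemma isAdmissible_one {l : Filter ℝ} {k : ℂ} :
    IsAdmissible l 1 k ↔ IsAdmissible l 0 (conj k) := by
  simp [IsAdmissible, sigma3, ← map_pow]

lemma norm_exp_theta (k : ℂ) (x t : ℝ) (i : Fin 2) :
    ‖Complex.exp (Complex.I * theta k x t * sigma3 i i)‖
      = Real.exp (-((sigma3 i i).re * (k ^ 2).im * x + (sigma3 i i).re * (4 * k ^ 6).im * t)) := by
  have h : theta k x t = k ^ 2 * x + 4 * k ^ 6 * t := by simp only [theta]; ring
  have hs : (sigma3 i i).im = 0 := by fin_cases i <;> simp [sigma3]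
  rw [Complex.norm_exp, h]
  congr 1
  rw [Complex.mul_re, hs, mul_zero, sub_zero, Complex.I_mul_re, Complex.add_im,
    Complex.im_mul_ofReal, Complex.im_mul_ofReal]
  ring

/-- The involution that maps solutions for `k^*` to solutions for `k`. -/
noncomputable def adjVec (v : Fin 2 → ℂ) : Fin 2 → ℂ := ![-conj (v 1), conj (v 0)]

section Jost

variable {q : ℝ → ℝ → ℂ} {l : Filter ℝ} {i : Fin 2} {k : ℂ} {t : ℝ}

lemma laxX_apply_one_one (q : ℝ → ℝ → ℂ) (k : ℂ) (x t : ℝ) :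
    laxX q k x t 1 1 = -laxX q k x t 0 0 := by simp [laxX_eq]

lemma laxT_apply_one_one (q : ℝ → ℝ → ℂ) (k : ℂ) (x t : ℝ) :
    laxT q k x t 1 1 = -laxT q k x t 0 0 := rfl

lemma IsSolution.continuous_laxX_left (hq : IsSolution q) (k : ℂ) (t : ℝ) :
    Continuous fun x => laxX q k x t :=
  (hq.continuous_laxX_snd k).comp (f := fun x : ℝ => (x, t)) (by fun_prop)

lemma IsSolution.continuous_laxT_right (hq : IsSolution q) (k : ℂ) (x : ℝ) :
    Continuous fun t => laxT q k x t :=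
  (hq.continuous_laxT_snd k).comp (f := fun t : ℝ => (x, t)) (by fun_prop)

lemma IsJost.ne_zero (hq : IsSolution q) [l.NeBot] {f : ℝ → Fin 2 → ℂ} (hf : IsJost q l i k t f)
    (x : ℝ) : f x ≠ 0 := by
  intro h
  have h0 : f = fun _ => 0 := linearODE_unique (hq.continuous_laxX_left k t) hf.1
    (fun s => by simpa using hasDerivAt_const s (0 : Fin 2 → ℂ)) (t₀ := x) h
  have h1 := hf.2
  simp only [h0, smul_zero] at h1
  have := congrFun (tendsto_nhds_unique h1 tendsto_const_nhds) i
  simp at this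

/-- The Wronskian of two Jost solutions for the same `k` is constant and tends to zero at infinity,
so that the solutions are proportional; the normalization makes them equal. -/
lemma IsJost.unique (hq : IsSolution q) [l.NeBot] (hk : IsAdmissible l i k) {f g : ℝ → Fin 2 → ℂ}
    (hf : IsJost q l i k t f) (hg : IsJost q l i k t g) : f = g := by
  set e : ℝ → ℂ := fun x => Complex.exp (Complex.I * theta k x t * sigma3 i i) with he
  set F : ℝ → Fin 2 → ℂ :=
    fun x => Complex.exp (-(Complex.I * theta k x t * sigma3 i i)) • f x with hF
  set G : ℝ → Fin 2 → ℂ :=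
    fun x => Complex.exp (-(Complex.I * theta k x t * sigma3 i i)) • g x with hG
  have hinv : ∀ x, e x * Complex.exp (-(Complex.I * theta k x t * sigma3 i i)) = 1 := fun x => by
    rw [he, ← Complex.exp_add, add_neg_cancel, Complex.exp_zero]
  have hfF : ∀ x, f x = e x • F x := fun x => by rw [hF, smul_smul, hinv, one_smul]
  have hgG : ∀ x, g x = e x • G x := fun x => by rw [hG, smul_smul, hinv, one_smul]
  have hFl : Tendsto F l (𝓝 (Pi.single i 1)) := hf.2
  have hGl : Tendsto G l (𝓝 (Pi.single i 1)) := hg.2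
  have heb : e =O[l] (fun _ => (1 : ℂ)) := by
    refine Asymptotics.IsBigO.of_bound (Real.exp |(sigma3 i i).re * (4 * k ^ 6).im * t|) ?_
    filter_upwards [hk] with x hx
    rw [he, norm_exp_theta, norm_one, mul_one]
    apply Real.exp_le_exp.2
    linarith [neg_abs_le ((sigma3 i i).re * (4 * k ^ 6).im * t)]
  have hW0 : Tendsto (fun x => wronskian (F x) (G x)) l (𝓝 0) := by
    rw [tendsto_pi_nhds] at hFl hGl
    have := ((hFl 0).mul (hGl 1)).sub ((hFl 1).mul (hGl 0))
    rwa [mul_comm, sub_self] at this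
  have hW : Tendsto (fun x => wronskian (f x) (g x)) l (𝓝 0) := by
    have h1 := (heb.mul heb).mul_isLittleO ((Asymptotics.isLittleO_one_iff ℂ).2 hW0)
    simp only [mul_one] at h1
    refine ((Asymptotics.isLittleO_one_iff ℂ).1 h1).congr fun x => ?_
    have h2 := wronskian_smul (e x) (e x) (F x) (G x)
    rw [← hfF, ← hgG] at h2
    exact h2.symm
  have hw0 : wronskian (f 0) (g 0) = 0 := by
    refine tendsto_nhds_unique (tendsto_const_nhds.congr fun x => ?_) hW
    exact wronskian_eq_of_hasDerivAt (fun x => laxX_apply_one_one q k x t) hf.1 hg.1 0 x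
  obtain ⟨c, hc⟩ := exists_eq_smul_of_wronskian_eq_zero (hg.ne_zero hq 0) hw0
  have hfg : f = fun x => c • g x := linearODE_unique (hq.continuous_laxX_left k t) hf.1
    (fun s => by
      refine ((hg.1 s).const_smul c).congr_deriv ?_
      rw [Matrix.mulVec_smul]) hc
  have hc1 : c = 1 := by
    have h1 : Tendsto F l (𝓝 (c • Pi.single i 1)) := by
      refine (hGl.const_smul c).congr fun x => ?_
      simp only [hF, hG, hfg]
      rw [smul_comm]
    have := congrFun (tendsto_nhds_unique h1 hFl) i
    simpa using this
  rw [hfg, hc1]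
  simp

/-- The functions `a`, `c` of the variable `z = k²` yield the first column of a Jost solution. -/
lemma HalfJost.isJost {H U : Set ℂ} {a c : ℝ → ℂ → ℂ}
    (h : HalfJost (fun x => q x t) (fun x => -conj (q x t)) l H U a c) (hk : k ^ 2 ∈ H) :
    IsJost q l 0 k t
      (fun x => Complex.exp (Complex.I * theta k x t) • ![a x (k ^ 2), k * c x (k ^ 2)]) := by
  have hexp : ∀ x : ℝ, HasDerivAt (fun x : ℝ => Complex.exp (Complex.I * theta k x t))
      (Complex.I * k ^ 2 * Complex.exp (Complex.I * theta k x t)) x := fun x => by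
    have h1 : HasDerivAt (fun x : ℝ => (x : ℂ)) 1 x := Complex.ofRealCLM.hasDerivAt
    refine (((h1.add_const (4 * k ^ 4 * (t : ℂ))).const_mul (k ^ 2)).const_mul
      Complex.I).cexp.congr_deriv ?_
    simp only [theta]
    ring
  refine ⟨fun x => ?_, ?_⟩
  · rw [hasDerivAt_pi]
    intro j
    have ha := (hexp x).mul (h.hasDerivAt_a x _ hk)
    have hc := (hexp x).mul ((h.hasDerivAt_c x _ hk).const_mul k)
    simp only [mulVec_apply, laxX_eq]
    fin_cases j
    · refine ha.congr_deriv ?_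
      simp
      ring
    · refine hc.congr_deriv ?_
      simp
      ring
  · have h1 : ∀ x : ℝ, Complex.exp (-(Complex.I * theta k x t * sigma3 0 0)) •
        Complex.exp (Complex.I * theta k x t) • (![a x (k ^ 2), k * c x (k ^ 2)] : Fin 2 → ℂ)
          = ![a x (k ^ 2), k * c x (k ^ 2)] := fun x => by
      rw [smul_smul, ← Complex.exp_add]
      simp [sigma3]
    simp only [h1]
    rw [tendsto_pi_nhds]
    intro j
    fin_cases j
    · simpa using h.tendsto_a _ hk
    · simpa using (h.tendsto_c _ hk).const_mul k

/-- Second columns of Jost solutions come from first columns at the conjugate spectral parameter. -/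
lemma IsJost.adjVec {f : ℝ → Fin 2 → ℂ} (hf : IsJost q l 0 (conj k) t f) :
    IsJost q l 1 k t (fun x => adjVec (f x)) := by
  refine ⟨fun x => ?_, ?_⟩
  · have h := hf.1 x
    rw [hasDerivAt_pi] at h ⊢
    have h0 := hasDerivAt_conj_comp (h 0)
    have h1 := hasDerivAt_conj_comp (h 1)
    intro j
    simp only [mulVec_apply, laxX_eq] at h0 h1 ⊢
    fin_cases j
    · refine h1.neg.congr_deriv ?_
      simp [TOFKN.adjVec]
    · refine h0.congr_deriv ?_
      simp [TOFKN.adjVec]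
      ring
  · have h := hf.2
    rw [tendsto_pi_nhds] at h ⊢
    have h0 := (Complex.continuous_conj.tendsto _).comp (h 0)
    have h1 := (Complex.continuous_conj.tendsto _).comp (h 1)
    have hth : ∀ x : ℝ, conj (theta (conj k) x t) = theta k x t := fun x => by
      have h4 : conj (4 : ℂ) = 4 := map_ofNat _ 4
      simp [theta, h4]
    have he : ∀ x : ℝ, conj (Complex.exp (-(Complex.I * theta (conj k) x t * sigma3 0 0)))
        = Complex.exp (-(Complex.I * theta k x t * sigma3 1 1)) := fun x => by
      rw [← Complex.exp_conj]
      simp [hth, sigma3]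
    intro j
    fin_cases j
    · refine (h1.neg.congr fun x => ?_).trans (by simp)
      simp only [Function.comp_apply, Pi.smul_apply, smul_eq_mul, map_mul, he]
      simp [TOFKN.adjVec]
    · refine (h0.congr fun x => ?_).trans (by simp)
      simp only [Function.comp_apply, Pi.smul_apply, smul_eq_mul, map_mul, he]
      simp [TOFKN.adjVec]

end Jost

/-! ### The Jost solutions of a solution with zero boundary conditions -/

section Potential

variable {q : ℝ → ℝ → ℂ} (hq : IsSolution q) (hz : ZeroBoundary q)
include hq hz

lemma exists_norm_le (t : ℝ) : ∃ C, ∀ x, ‖q x t‖ ≤ C := by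
  obtain ⟨U, hU, h⟩ := hz.tendsto_zero 0 (by norm_num) _ (Metric.dist_mem_uniformity one_pos) t
  obtain ⟨K, hK, hKU⟩ := mem_cocompact.1 h
  have hc : Continuous fun x => q x t := (hq.contDiff_x t).continuous
  obtain ⟨C, hC⟩ := hK.exists_bound_of_continuousOn hc.continuousOn
  refine ⟨max C 1, fun x => ?_⟩
  by_cases hx : x ∈ K
  · exact (hC x hx).trans (le_max_left _ _)
  · have h1 : dist 0 (dx q 0 x t) < 1 := hKU hx t (mem_of_mem_nhds hU)
    rw [dx_zero, dist_zero_left] at h1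
    exact h1.le.trans (le_max_right _ _)

lemma exists_halfJost (t : ℝ) :
    (∃ a c, HalfJost (fun x => q x t) (fun x => -conj (q x t)) atTop upperClosed upperOpen a c) ∧
    ∃ a c, HalfJost (fun x => q x t) (fun x => -conj (q x t)) atBot lowerClosed lowerOpen a c := by
  obtain ⟨C, hC⟩ := exists_norm_le hq hz t
  have huc : Continuous fun x => q x t := (hq.contDiff_x t).continuous
  have hu : Integrable fun x => q x t := by
    have := hz.integrable 0 (by norm_num) t
    rwa [dx_zero] at this
  have hrd : ∀ x, HasDerivAt (fun x => -conj (q x t)) (-conj (dx q 1 x t)) x := fun x =>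
    (hasDerivAt_conj_comp (hq.hasDerivAt_x x t)).neg
  have hr : Integrable fun x => -conj (q x t) :=
    (Complex.conjCLE.toContinuousLinearMap.integrable_comp hu).neg
  have hrb : ∃ C, ∀ x, ‖-conj (q x t)‖ ≤ C := ⟨C, fun x => by simpa using hC x⟩
  have hr'c : Continuous fun x => -conj (dx q 1 x t) :=
    (Complex.continuous_conj.comp ((hq.continuous_dx 1 (by norm_num)).comp
      (f := fun x : ℝ => (x, t)) (by fun_prop))).neg
  have hr' : Integrable fun x => -conj (dx q 1 x t) :=
    (Complex.conjCLE.toContinuousLinearMap.integrable_comp (hz.integrable 1 le_rfl t)).neg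
  exact ⟨exists_halfJost_atTop huc hu ⟨C, hC⟩ hrd hr hrb hr'c hr',
    exists_halfJost_atBot huc hu ⟨C, hC⟩ hrd hr hrb hr'c hr'⟩

variable {l : Filter ℝ} (hl : l = atTop ∨ l = atBot) {i : Fin 2} {k : ℂ} (hk : IsAdmissible l i k)
include hl hk

/-- The Jost solution exists for every admissible spectral parameter, so that `jost` is not a
default value. -/
lemma isJost_jost (t : ℝ) : IsJost q l i k t (fun x => jost q l i k x t) := by
  have h0 : ∀ k, IsAdmissible l 0 k → ∃ f, IsJost q l 0 k t f := fun k hk => by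
    rcases hl with rfl | rfl
    · obtain ⟨a, c, h⟩ := (exists_halfJost hq hz t).1
      exact ⟨_, h.isJost (isAdmissible_atTop_zero.1 hk)⟩
    · obtain ⟨a, c, h⟩ := (exists_halfJost hq hz t).2
      exact ⟨_, h.isJost (isAdmissible_atBot_zero.1 hk)⟩
  refine Classical.epsilon_spec (p := IsJost q l i k t) ?_
  fin_cases i
  · exact h0 k hk
  · obtain ⟨f, hf⟩ := h0 (conj k) (isAdmissible_one.1 hk)
    exact ⟨_, hf.adjVec⟩

lemma jost_eq {t : ℝ} {f : ℝ → Fin 2 → ℂ} (hf : IsJost q l i k t f) (x : ℝ) :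
    jost q l i k x t = f x := by
  have hnb : l.NeBot := by rcases hl with rfl | rfl <;> infer_instance
  exact congrFun ((isJost_jost hq hz hl hk t).unique hq hk hf) x

lemma jost_ne_zero (x t : ℝ) : jost q l i k x t ≠ 0 := by
  have hnb : l.NeBot := by rcases hl with rfl | rfl <;> infer_instance
  exact (isJost_jost hq hz hl hk t).ne_zero hq x

lemma hasDerivAt_jost_x (x t : ℝ) :
    HasDerivAt (fun y => jost q l i k y t) ((laxX q k x t).mulVec (jost q l i k x t)) x :=
  (isJost_jost hq hz hl hk t).1 x

/-- By uniqueness, the Jost solutions at different times are linked by the temporal part of the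
Lax pair. -/
lemma hasDerivAt_jost_t (x t : ℝ) :
    HasDerivAt (fun s => jost q l i k x s) ((laxT q k x t).mulVec (jost q l i k x t)) t := by
  have hle : l ≤ cocompact ℝ := by
    rcases hl with rfl | rfl
    · exact atTop_le_cocompact
    · exact atBot_le_cocompact
  obtain ⟨φ, hφ0, hφt, hφ⟩ := hq.exists_isJost hz hle (isJost_jost hq hz hl hk 0)
  have h : ∀ s, jost q l i k x s = φ x s := fun s => jost_eq hq hz hl hk (hφ s) x
  simpa only [h] using hφt x t

end Potential

/-! ### Dependence on the spectral parameter, norming constants -/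

/-- If `P` and `M` solve a linear system with parameter `k` and `P = b M` at `k = ζ`, then
`P' - b M'`, the prime denoting the derivative in `k`, is a solution at `k = ζ`; so it is a multiple
of `M` once its initial value is. -/
lemma linearODE_deriv_parameter {A : ℂ → ℝ → Matrix (Fin 2) (Fin 2) ℂ}
    (hA : Continuous fun p : ℂ × ℝ => A p.1 p.2) {P M : ℂ → ℝ → Fin 2 → ℂ} {ζ b d : ℂ}
    (hP : ∀ᶠ k in 𝓝 ζ, ∀ s, HasDerivAt (P k) ((A k s).mulVec (P k s)) s)
    (hM : ∀ᶠ k in 𝓝 ζ, ∀ s, HasDerivAt (M k) ((A k s).mulVec (M k s)) s)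
    (hP' : ∀ s, DifferentiableAt ℂ (fun k => P k s) ζ)
    (hM' : ∀ s, DifferentiableAt ℂ (fun k => M k s) ζ)
    (hb : ∀ s, P ζ s = b • M ζ s)
    (h0 : deriv (fun k => P k 0) ζ - b • deriv (fun k => M k 0) ζ = d • M ζ 0) (s : ℝ) :
    deriv (fun k => P k s) ζ - b • deriv (fun k => M k s) ζ = d • M ζ s := by
  have hslope : ∀ s, Tendsto (fun k => (k - ζ)⁻¹ • (P k s - b • M k s)) (𝓝[≠] ζ)
      (𝓝 (deriv (fun k => P k s) ζ - b • deriv (fun k => M k s) ζ)) := fun s => by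
    have h1 := (hP' s).hasDerivAt.sub ((hM' s).hasDerivAt.const_smul b)
    refine (hasDerivAt_iff_tendsto_slope.1 h1).congr fun k => ?_
    simp [slope_def_module, hb]
  refine tendsto_nhds_unique (hslope s) ?_
  refine linearODE_tendsto (A := A) (A₀ := A ζ)
    (f := fun k s => (k - ζ)⁻¹ • (P k s - b • M k s)) (f₀ := fun s => d • M ζ s)
    (hA.comp (f := fun s : ℝ => (ζ, s)) (by fun_prop)) (fun τ ε hε => ?_) ?_ (fun s => ?_) ?_ s
  · have h1 := (isCompact_Icc (a := -τ) (b := τ)).eventually_forall_of_forall_eventually (x₀ := ζ)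
      (P := fun k s => entryNorm (A k s - A ζ s) ≤ ε) (fun s _ => by
        have hc : Continuous fun p : ℂ × ℝ => entryNorm (A p.1 p.2 - A ζ p.2) :=
          continuous_entryNorm.comp
            (hA.sub (hA.comp (f := fun p : ℂ × ℝ => (ζ, p.2)) (by fun_prop)))
        have := (hc.continuousAt (x := (ζ, s))).eventually_lt_const (u := ε)
          (by simpa [entryNorm] using hε)
        filter_upwards [this] with p hp using hp.le)
    filter_upwards [nhdsWithin_le_nhds h1] with k hk s hs using hk s (abs_le.1 hs)
  · filter_upwards [nhdsWithin_le_nhds hP, nhdsWithin_le_nhds hM] with k hPk hMk s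
    refine (((hPk s).sub ((hMk s).const_smul b)).const_smul (k - ζ)⁻¹).congr_deriv ?_
    rw [Matrix.mulVec_smul, Matrix.mulVec_sub, Matrix.mulVec_smul]
  · refine ((hM.self_of_nhds s).const_smul d).congr_deriv ?_
    rw [Matrix.mulVec_smul]
  · simpa only [h0] using hslope 0

/-- The set of spectral parameters at which the exponential `exp (iθσ)` of the `i`-th column, with
`σ` the `i`-th diagonal entry of `σ₃`, decays along `l`; an open condition. -/
def IsDecaying (l : Filter ℝ) (i : Fin 2) (k : ℂ) : Prop :=
  ∀ᶠ x : ℝ in l, 0 < (sigma3 i i).re * (k ^ 2).im * x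

lemma IsDecaying.isAdmissible {l : Filter ℝ} {i : Fin 2} {k : ℂ} (h : IsDecaying l i k) :
    IsAdmissible l i k := by
  filter_upwards [h] with x hx using hx.le

lemma isDecaying_atTop_zero {k : ℂ} : IsDecaying atTop 0 k ↔ k ^ 2 ∈ upperOpen := by
  constructor
  · intro h
    obtain ⟨x, hx, hx0⟩ := (h.and (eventually_gt_atTop 0)).exists
    simp only [sigma3, Matrix.of_apply, Matrix.cons_val_zero, Complex.one_re, one_mul] at hx
    exact pos_of_mul_pos_left hx hx0.le
  · intro h
    filter_upwards [eventually_gt_atTop 0] with x hx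
    simpa [sigma3] using mul_pos h hx

lemma isDecaying_atBot_zero {k : ℂ} : IsDecaying atBot 0 k ↔ k ^ 2 ∈ lowerOpen := by
  constructor
  · intro h
    obtain ⟨x, hx, hx0⟩ := (h.and (eventually_lt_atBot 0)).exists
    simp only [sigma3, Matrix.of_apply, Matrix.cons_val_zero, Complex.one_re, one_mul] at hx
    by_contra h1
    exact absurd hx (not_lt.2 (mul_nonpos_of_nonneg_of_nonpos (not_lt.1 h1) hx0.le))
  · intro h
    filter_upwards [eventually_lt_atBot 0] with x hx
    simpa [sigma3] using mul_pos_of_neg_of_neg h hx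

lemma isDecaying_one {l : Filter ℝ} {k : ℂ} : IsDecaying l 1 k ↔ IsDecaying l 0 (conj k) := by
  simp [IsDecaying, sigma3, ← map_pow]

lemma isOpen_lowerOpen : IsOpen lowerOpen := isOpen_lt Complex.continuous_im continuous_const

lemma IsDecaying.eventually {l : Filter ℝ} (hl : l = atTop ∨ l = atBot) {i : Fin 2} {k : ℂ}
    (h : IsDecaying l i k) : ∀ᶠ k' in 𝓝 k, IsDecaying l i k' := by
  have h0 : ∀ k, IsDecaying l 0 k → ∀ᶠ k' in 𝓝 k, IsDecaying l 0 k' := fun k h => by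
    have hc : ContinuousAt (fun k : ℂ => k ^ 2) k := by fun_prop
    rcases hl with rfl | rfl
    · simp only [isDecaying_atTop_zero] at h ⊢
      exact hc (isOpen_upperOpen.mem_nhds h)
    · simp only [isDecaying_atBot_zero] at h ⊢
      exact hc (isOpen_lowerOpen.mem_nhds h)
  fin_cases i
  · exact h0 k h
  · exact ((Complex.continuous_conj.tendsto k).eventually (h0 _ (isDecaying_one.1 h))).mono
      fun k' hk' => isDecaying_one.2 hk'

section Potential

variable {q : ℝ → ℝ → ℂ} (hq : IsSolution q) (hz : ZeroBoundary q)
include hq hz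

lemma jost_one_eq_adjVec {l : Filter ℝ} (hl : l = atTop ∨ l = atBot) {k : ℂ}
    (hk : IsAdmissible l 1 k) (x t : ℝ) :
    jost q l 1 k x t = adjVec (jost q l 0 (conj k) x t) :=
  jost_eq hq hz hl hk (isJost_jost hq hz hl (isAdmissible_one.1 hk) t).adjVec x

lemma differentiableAt_jost {l : Filter ℝ} (hl : l = atTop ∨ l = atBot) {i : Fin 2} {k : ℂ}
    (hk : IsDecaying l i k) (x t : ℝ) (j : Fin 2) :
    DifferentiableAt ℂ (fun k => jost q l i k x t j) k := by
  have key : ∀ (H U : Set ℂ) (a c : ℝ → ℂ → ℂ), IsOpen U → U ⊆ H →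
      HalfJost (fun x => q x t) (fun x => -conj (q x t)) l H U a c →
      (∀ k, k ^ 2 ∈ U → IsAdmissible l 0 k) → ∀ k, k ^ 2 ∈ U → ∀ j,
        DifferentiableAt ℂ (fun k => jost q l 0 k x t j) k := by
    intro H U a c hU hUH h hUl k hk j
    have he : (fun k => jost q l 0 k x t j) =ᶠ[𝓝 k] fun k => (Complex.exp (Complex.I * theta k x t)
        • ![a x (k ^ 2), k * c x (k ^ 2)] : Fin 2 → ℂ) j := by
      have hc : ContinuousAt (fun k : ℂ => k ^ 2) k := by fun_prop
      filter_upwards [hc (hU.mem_nhds hk)] with k' hk'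
      rw [jost_eq hq hz hl (hUl k' hk') (h.isJost (hUH hk')) x]
    refine DifferentiableAt.congr_of_eventuallyEq ?_ he
    have hsq : DifferentiableAt ℂ (fun k : ℂ => k ^ 2) k := by fun_prop
    have ha : DifferentiableAt ℂ (fun k => a x (k ^ 2)) k :=
      ((h.differentiableOn_a x).differentiableAt (hU.mem_nhds hk)).comp k hsq
    have hc : DifferentiableAt ℂ (fun k => c x (k ^ 2)) k :=
      ((h.differentiableOn_c x).differentiableAt (hU.mem_nhds hk)).comp k hsq
    have hexp : DifferentiableAt ℂ (fun k => Complex.exp (Complex.I * theta k x t)) k := by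
      unfold theta
      fun_prop
    fin_cases j
    · exact hexp.mul ha
    · exact hexp.mul (differentiableAt_id.mul hc)
  have h0 : ∀ k, IsDecaying l 0 k → ∀ j, DifferentiableAt ℂ (fun k => jost q l 0 k x t j) k := by
    intro k hk j
    rcases hl with rfl | rfl
    · obtain ⟨a, c, h⟩ := (exists_halfJost hq hz t).1
      exact key _ _ a c isOpen_upperOpen upperOpen_subset h
        (fun k hk => isAdmissible_atTop_zero.2 (upperOpen_subset hk)) k
        (isDecaying_atTop_zero.1 hk) j
    · obtain ⟨a, c, h⟩ := (exists_halfJost hq hz t).2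
      have hsub : lowerOpen ⊆ lowerClosed := fun z (hz : z.im < 0) => hz.le
      exact key _ _ a c isOpen_lowerOpen hsub h
        (fun k hk => isAdmissible_atBot_zero.2 (hsub hk)) k (isDecaying_atBot_zero.1 hk) j
  fin_cases i
  · exact h0 k hk j
  · have hk' := isDecaying_one.1 hk
    have he : (fun k => jost q l 1 k x t j) =ᶠ[𝓝 k]
        fun k => adjVec (jost q l 0 (conj k) x t) j := by
      filter_upwards [hk.eventually hl] with k' hk'
      rw [jost_one_eq_adjVec hq hz hl hk'.isAdmissible]
    refine DifferentiableAt.congr_of_eventuallyEq ?_ he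
    have hc := fun j => (h0 _ hk' j).conj_conj
    simp only [Function.comp_def, Complex.conj_conj] at hc
    fin_cases j
    · exact (hc 1).neg
    · exact hc 0

lemma analyticAt_jost {l : Filter ℝ} (hl : l = atTop ∨ l = atBot) {i : Fin 2} {k : ℂ}
    (hk : IsDecaying l i k) (x t : ℝ) (j : Fin 2) :
    AnalyticAt ℂ (fun k => jost q l i k x t j) k := by
  rw [Complex.analyticAt_iff_eventually_differentiableAt]
  filter_upwards [hk.eventually hl] with k' hk' using differentiableAt_jost hq hz hl hk' x t j

variable {l l' : Filter ℝ} (hl : l = atTop ∨ l = atBot) (hl' : l' = atTop ∨ l' = atBot)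
  {i i' : Fin 2} {k : ℂ}
include hl hl'

/-- The Wronskians of Jost solutions do not depend on `(x, t)`. -/
lemma wronskian_jost (hk : IsAdmissible l i k) (hk' : IsAdmissible l' i' k) (x t : ℝ) :
    wronskian (jost q l i k x t) (jost q l' i' k x t)
      = wronskian (jost q l i k 0 0) (jost q l' i' k 0 0) :=
  (wronskian_eq_of_hasDerivAt (laxX_apply_one_one q k · t)
    (fun x => hasDerivAt_jost_x hq hz hl hk x t)
    (fun x => hasDerivAt_jost_x hq hz hl' hk' x t) x 0).trans
  (wronskian_eq_of_hasDerivAt (laxT_apply_one_one q k 0 ·)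
    (fun t => hasDerivAt_jost_t hq hz hl hk 0 t)
    (fun t => hasDerivAt_jost_t hq hz hl' hk' 0 t) t 0)

/-- Both sides solve the two equations of the Lax pair, so the factor of proportionality at the
origin serves for all `(x, t)`. This is the existence of the norming constant `b`. -/
lemma exists_jost_eq_smul (hk : IsAdmissible l i k) (hk' : IsAdmissible l' i' k)
    (hw : wronskian (jost q l i k 0 0) (jost q l' i' k 0 0) = 0) :
    ∃ b : ℂ, ∀ x t, jost q l i k x t = b • jost q l' i' k x t := by
  obtain ⟨b, hb⟩ := exists_eq_smul_of_wronskian_eq_zero (jost_ne_zero hq hz hl' hk' 0 0) hw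
  have hx : ∀ x, jost q l i k x 0 = b • jost q l' i' k x 0 := fun x =>
    congrFun (linearODE_unique (hq.continuous_laxX_left k 0)
      (fun x => hasDerivAt_jost_x hq hz hl hk x 0)
      (fun x => ((hasDerivAt_jost_x hq hz hl' hk' x 0).const_smul b).congr_deriv
        (Matrix.mulVec_smul _ _ _).symm) hb) x
  exact ⟨b, fun x t => congrFun (linearODE_unique (hq.continuous_laxT_right k x)
    (fun t => hasDerivAt_jost_t hq hz hl hk x t)
    (fun t => ((hasDerivAt_jost_t hq hz hl' hk' x t).const_smul b).congr_deriv
      (Matrix.mulVec_smul _ _ _).symm) (hx x)) t⟩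

/-- At a double zero of the Wronskian, the derivatives in the spectral parameter are linked by a
second norming constant `d`, which does not depend on `(x, t)` either. -/
lemma exists_deriv_jost_eq_smul (hk : IsDecaying l i k) (hk' : IsDecaying l' i' k) {b : ℂ}
    (hb : ∀ x t, jost q l i k x t = b • jost q l' i' k x t)
    (hw : deriv (fun k => wronskian (jost q l i k 0 0) (jost q l' i' k 0 0)) k = 0) :
    ∃ d : ℂ, ∀ x t, deriv (fun k => jost q l i k x t) k - b • deriv (fun k => jost q l' i' k x t) k
      = d • jost q l' i' k x t := by
  have hd : ∀ x t, DifferentiableAt ℂ (fun k => jost q l i k x t) k := fun x t =>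
    differentiableAt_pi.2 (differentiableAt_jost hq hz hl hk x t)
  have hd' : ∀ x t, DifferentiableAt ℂ (fun k => jost q l' i' k x t) k := fun x t =>
    differentiableAt_pi.2 (differentiableAt_jost hq hz hl' hk' x t)
  have hp := hasDerivAt_pi.1 (hd 0 0).hasDerivAt
  have hm := hasDerivAt_pi.1 (hd' 0 0).hasDerivAt
  have hw' : wronskian (deriv (fun k => jost q l i k 0 0) k
      - b • deriv (fun k => jost q l' i' k 0 0) k) (jost q l' i' k 0 0) = 0 := by
    have h1 := (((hp 0).mul (hm 1)).sub ((hp 1).mul (hm 0))).deriv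
    have h2 : deriv (fun k => wronskian (jost q l i k 0 0) (jost q l' i' k 0 0)) k = _ := h1
    rw [hw, hb] at h2
    simp only [wronskian, Pi.sub_apply, Pi.smul_apply, smul_eq_mul] at h2 ⊢
    linear_combination -h2
  obtain ⟨d, hd0⟩ := exists_eq_smul_of_wronskian_eq_zero
    (jost_ne_zero hq hz hl' hk'.isAdmissible 0 0) hw'
  have hx : ∀ x, deriv (fun k => jost q l i k x 0) k - b • deriv (fun k => jost q l' i' k x 0) k
      = d • jost q l' i' k x 0 := fun x => by
    refine linearODE_deriv_parameter (A := fun k x => laxX q k x 0)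
      (P := fun k x => jost q l i k x 0) (M := fun k x => jost q l' i' k x 0)
      (hq.continuous_laxX.comp (f := fun p : ℂ × ℝ => (p.1, p.2, (0 : ℝ))) (by fun_prop)) ?_ ?_
      (fun x => hd x 0) (fun x => hd' x 0) (fun x => hb x 0) hd0 x
    · filter_upwards [hk.eventually hl] with k h x
        using hasDerivAt_jost_x hq hz hl h.isAdmissible x 0
    · filter_upwards [hk'.eventually hl'] with k h x
        using hasDerivAt_jost_x hq hz hl' h.isAdmissible x 0
  refine ⟨d, fun x t => ?_⟩
  refine linearODE_deriv_parameter (A := fun k t => laxT q k x t)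
    (P := fun k t => jost q l i k x t) (M := fun k t => jost q l' i' k x t)
    (hq.continuous_laxT.comp (f := fun p : ℂ × ℝ => (p.1, x, p.2)) (by fun_prop)) ?_ ?_
    (fun t => hd x t) (fun t => hd' x t) (fun t => hb x t) (hx x) t
  · filter_upwards [hk.eventually hl] with k h t
      using hasDerivAt_jost_t hq hz hl h.isAdmissible x t
  · filter_upwards [hk'.eventually hl'] with k h t
      using hasDerivAt_jost_t hq hz hl' h.isAdmissible x t

end Potential

/-! ### Residue conditions at the discrete spectrum -/

lemma mem_DPlus_iff {k : ℂ} : k ∈ DPlus ↔ k ^ 2 ∈ upperOpen := by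
  have h : (k ^ 2).im = 2 * (k.re * k.im) := by
    rw [sq, Complex.mul_im]
    ring
  change 0 < k.re * k.im ↔ 0 < (k ^ 2).im
  rw [h]
  constructor <;> intro h <;> linarith

lemma notMem_DPlus_of_sq_mem_lowerOpen {k : ℂ} (hk : k ^ 2 ∈ lowerOpen) : k ∉ DPlus := fun h => by
  have h1 : 0 < (k ^ 2).im := mem_DPlus_iff.1 h
  have h2 : (k ^ 2).im < 0 := hk
  exact lt_asymm h1 h2

lemma conj_sq_im (k : ℂ) : (conj k ^ 2).im = -(k ^ 2).im := by
  rw [← map_pow, Complex.conj_im]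

lemma conj_sq_mem_upperOpen {k : ℂ} : conj k ^ 2 ∈ upperOpen ↔ k ^ 2 ∈ lowerOpen := by
  change 0 < (conj k ^ 2).im ↔ (k ^ 2).im < 0
  rw [conj_sq_im]
  constructor <;> intro h <;> linarith

lemma conj_sq_mem_lowerOpen {k : ℂ} : conj k ^ 2 ∈ lowerOpen ↔ k ^ 2 ∈ upperOpen := by
  change (conj k ^ 2).im < 0 ↔ 0 < (k ^ 2).im
  rw [conj_sq_im]
  constructor <;> intro h <;> linarith

lemma conj_sq_mem_upperClosed {k : ℂ} : conj k ^ 2 ∈ upperClosed ↔ k ^ 2 ∈ lowerClosed := by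
  change 0 ≤ (conj k ^ 2).im ↔ (k ^ 2).im ≤ 0
  rw [conj_sq_im]
  constructor <;> intro h <;> linarith

lemma conj_sq_mem_lowerClosed {k : ℂ} : conj k ^ 2 ∈ lowerClosed ↔ k ^ 2 ∈ upperClosed := by
  change (conj k ^ 2).im ≤ 0 ↔ 0 ≤ (k ^ 2).im
  rw [conj_sq_im]
  constructor <;> intro h <;> linarith

lemma analyticAt_theta (k : ℂ) (x t : ℝ) : AnalyticAt ℂ (fun k => Complex.I * theta k x t) k := by
  unfold theta
  fun_prop

section Potential

variable {q : ℝ → ℝ → ℂ} (hq : IsSolution q) (hz : ZeroBoundary q)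
include hq hz

section Pair

variable {l l' : Filter ℝ} (hl : l = atTop ∨ l = atBot) (hl' : l' = atTop ∨ l' = atBot)
  {i i' : Fin 2} {k : ℂ}
include hl hl'

lemma analyticAt_wronskian_jost (hk : IsDecaying l i k) (hk' : IsDecaying l' i' k) (x t : ℝ) :
    AnalyticAt ℂ (fun k => wronskian (jost q l i k x t) (jost q l' i' k x t)) k :=
  ((analyticAt_jost hq hz hl hk x t 0).mul (analyticAt_jost hq hz hl' hk' x t 1)).sub
    ((analyticAt_jost hq hz hl hk x t 1).mul (analyticAt_jost hq hz hl' hk' x t 0))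

/-- The residue condition satisfied by a Jost solution divided by a scattering coefficient `s` at a
double zero of `s`, in terms of the norming constants. -/
lemma residueCondition_jost (hk : IsDecaying l i k) (hk' : IsDecaying l' i' k) {b d : ℂ}
    (hb : ∀ x t, jost q l i k x t = b • jost q l' i' k x t)
    (hd : ∀ x t, deriv (fun k => jost q l i k x t) k - b • deriv (fun k => jost q l' i' k x t) k
      = d • jost q l' i' k x t)
    {s θ : ℂ → ℂ} (hs : AnalyticAt ℂ s k) (hs0 : s k = 0) (hs1 : deriv s k = 0)
    (hs2 : iteratedDeriv 2 s k ≠ 0) (hθ : AnalyticAt ℂ θ k) (x t : ℝ) (j : Fin 2) :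
    ResidueCondition (fun k => Complex.exp (-θ k) * jost q l i k x t j / s k)
      (fun k => Complex.exp (θ k) * jost q l' i' k x t j) k
      (2 * b / iteratedDeriv 2 s k * Complex.exp (-(2 * θ k)))
      (d / b - iteratedDeriv 3 s k / (3 * iteratedDeriv 2 s k) - 2 * deriv θ k) := by
  have hb0 : b ≠ 0 := fun h => jost_ne_zero hq hz hl hk.isAdmissible 0 0 (by
    rw [hb, h, zero_smul])
  have hP := fun j => (differentiableAt_jost hq hz hl hk x t j)
  have hM := fun j => (differentiableAt_jost hq hz hl' hk' x t j)
  have hdj := congrFun (hd x t) j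
  simp only [Pi.sub_apply, Pi.smul_apply, smul_eq_mul, deriv_pi hP, deriv_pi hM] at hdj
  exact residueCondition_of_double_zero (analyticAt_jost hq hz hl hk x t j)
    (analyticAt_jost hq hz hl' hk' x t j) hs hθ hb0 (congrFun (hb x t) j) hdj hs0 hs1 hs2

end Pair

lemma analyticAt_s11 {k : ℂ} (hk : k ^ 2 ∈ upperOpen) : AnalyticAt ℂ (s11 q) k :=
  analyticAt_wronskian_jost hq hz (Or.inl rfl) (Or.inr rfl) (isDecaying_atTop_zero.2 hk)
    (isDecaying_one.2 (isDecaying_atBot_zero.2 (conj_sq_mem_lowerOpen.2 hk))) 0 0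

lemma analyticAt_s22 {k : ℂ} (hk : k ^ 2 ∈ lowerOpen) : AnalyticAt ℂ (s22 q) k :=
  analyticAt_wronskian_jost hq hz (Or.inr rfl) (Or.inl rfl) (isDecaying_atBot_zero.2 hk)
    (isDecaying_one.2 (isDecaying_atTop_zero.2 (conj_sq_mem_upperOpen.2 hk))) 0 0

/-- The residue condition at a double zero of `s₁₁`. -/
lemma residueCondition_s11 {k : ℂ} (hk : k ^ 2 ∈ upperOpen) (hs0 : s11 q k = 0)
    (hs1 : deriv (s11 q) k = 0) (hs2 : iteratedDeriv 2 (s11 q) k ≠ 0) (x t : ℝ) (j : Fin 2) :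
    ResidueCondition
      (fun k => Complex.exp (-(Complex.I * theta k x t)) * psiP1 q k x t j / s11 q k)
      (fun k => Complex.exp (Complex.I * theta k x t) * psiM2 q k x t j) k
      (constA q k * Complex.exp (-(2 * Complex.I * theta k x t)))
      (constB q k - 2 * Complex.I * thetaDeriv k x t) := by
  have hD : k ∈ DPlus := mem_DPlus_iff.2 hk
  have hP : IsDecaying atTop 0 k := isDecaying_atTop_zero.2 hk
  have hM : IsDecaying atBot 1 k :=
    isDecaying_one.2 (isDecaying_atBot_zero.2 (conj_sq_mem_lowerOpen.2 hk))
  have hb : ∀ x t, psiP1 q k x t = normB q k • psiM2 q k x t := by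
    rw [normB, if_pos hD]
    exact Classical.epsilon_spec (exists_jost_eq_smul hq hz (Or.inl rfl) (Or.inr rfl)
      hP.isAdmissible hM.isAdmissible hs0)
  have hd : ∀ x t, deriv (fun k => psiP1 q k x t) k - normB q k • deriv (fun k => psiM2 q k x t) k
      = normD q k • psiM2 q k x t := by
    rw [normD, if_pos hD]
    exact Classical.epsilon_spec (exists_deriv_jost_eq_smul hq hz (Or.inl rfl) (Or.inr rfl)
      hP hM hb hs1)
  have h := residueCondition_jost hq hz (Or.inl rfl) (Or.inr rfl) hP hM hb hd
    (analyticAt_s11 hq hz hk) hs0 hs1 hs2 (analyticAt_theta k x t) x t j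
  rw [deriv_const_mul_field, ← mul_assoc, ← mul_assoc] at h
  rw [constA, constB, if_pos hD, if_pos hD]
  exact h

/-- The residue condition at a double zero of `s₂₂`. -/
lemma residueCondition_s22 {k : ℂ} (hk : k ^ 2 ∈ lowerOpen) (hs0 : s22 q k = 0)
    (hs1 : deriv (s22 q) k = 0) (hs2 : iteratedDeriv 2 (s22 q) k ≠ 0) (x t : ℝ) (j : Fin 2) :
    ResidueCondition
      (fun k => Complex.exp (Complex.I * theta k x t) * psiP2 q k x t j / s22 q k)
      (fun k => Complex.exp (-(Complex.I * theta k x t)) * psiM1 q k x t j) k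
      (constA q k * Complex.exp (2 * Complex.I * theta k x t))
      (constB q k + 2 * Complex.I * thetaDeriv k x t) := by
  have hD : k ∉ DPlus := notMem_DPlus_of_sq_mem_lowerOpen hk
  have hM : IsDecaying atBot 0 k := isDecaying_atBot_zero.2 hk
  have hP : IsDecaying atTop 1 k :=
    isDecaying_one.2 (isDecaying_atTop_zero.2 (conj_sq_mem_upperOpen.2 hk))
  have hw : (fun k => wronskian (psiP2 q k 0 0) (psiM1 q k 0 0)) = fun k => -s22 q k := by
    funext k
    simp only [s22, wronskian]
    ring
  have hb : ∀ x t, psiP2 q k x t = normB q k • psiM1 q k x t := by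
    rw [normB, if_neg hD]
    exact Classical.epsilon_spec (exists_jost_eq_smul hq hz (Or.inl rfl) (Or.inr rfl)
      hP.isAdmissible hM.isAdmissible (by
        have h1 : wronskian (psiP2 q k 0 0) (psiM1 q k 0 0) = -s22 q k := congrFun hw k
        rw [hs0, neg_zero] at h1
        exact h1))
  have hd : ∀ x t, deriv (fun k => psiP2 q k x t) k - normB q k • deriv (fun k => psiM1 q k x t) k
      = normD q k • psiM1 q k x t := by
    rw [normD, if_neg hD]
    exact Classical.epsilon_spec (exists_deriv_jost_eq_smul hq hz (Or.inl rfl) (Or.inr rfl)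
      hP hM hb (by
        have h1 : deriv (fun k => wronskian (psiP2 q k 0 0) (psiM1 q k 0 0)) k = 0 := by
          rw [hw, deriv.fun_neg, hs1, neg_zero]
        exact h1))
  have h := residueCondition_jost hq hz (Or.inl rfl) (Or.inr rfl) hP hM hb hd
    (analyticAt_s22 hq hz hk) hs0 hs1 hs2 (analyticAt_theta k x t).neg x t j
  have hdθ : deriv (-fun k => Complex.I * theta k x t) k = -(Complex.I * thetaDeriv k x t) := by
    rw [deriv.neg, deriv_const_mul_field]
    rfl
  rw [hdθ] at h
  simp only [Pi.neg_apply, neg_neg] at h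
  have e1 : -(2 * -(Complex.I * theta k x t)) = 2 * Complex.I * theta k x t := by ring
  have e2 : ∀ B : ℂ, B - 2 * -(Complex.I * thetaDeriv k x t)
      = B + 2 * Complex.I * thetaDeriv k x t := fun B => by ring
  rw [e1, e2] at h
  rw [constA, constB, if_neg hD, if_neg hD]
  exact h

/-! ### Symmetries of the scattering coefficients -/

lemma psiP2_eq {k : ℂ} (hk : k ^ 2 ∈ lowerClosed) (x t : ℝ) :
    psiP2 q k x t = adjVec (psiP1 q (conj k) x t) :=
  jost_one_eq_adjVec hq hz (Or.inl rfl)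
    (isAdmissible_one.2 (isAdmissible_atTop_zero.2 (conj_sq_mem_upperClosed.2 hk))) x t

lemma psiM2_eq {k : ℂ} (hk : k ^ 2 ∈ upperClosed) (x t : ℝ) :
    psiM2 q k x t = adjVec (psiM1 q (conj k) x t) :=
  jost_one_eq_adjVec hq hz (Or.inr rfl)
    (isAdmissible_one.2 (isAdmissible_atBot_zero.2 (conj_sq_mem_lowerClosed.2 hk))) x t

lemma s22_eq_conj_s11 {k : ℂ} (hk : k ^ 2 ∈ lowerClosed) : s22 q k = conj (s11 q (conj k)) := by
  rw [s22, s11, psiP2_eq hq hz hk, psiM2_eq hq hz (conj_sq_mem_upperClosed.2 hk), Complex.conj_conj]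
  simp [wronskian, adjVec]
  ring

variable {t : ℝ} {ap cp am cm : ℝ → ℂ → ℂ}

lemma psiP1_eq (h : HalfJost (fun x => q x t) (fun x => -conj (q x t)) atTop upperClosed upperOpen
    ap cp) {k : ℂ} (hk : k ^ 2 ∈ upperClosed) (x : ℝ) : psiP1 q k x t
      = Complex.exp (Complex.I * theta k x t) • ![ap x (k ^ 2), k * cp x (k ^ 2)] :=
  jost_eq hq hz (Or.inl rfl) (isAdmissible_atTop_zero.2 hk) (h.isJost hk) x

lemma psiM1_eq (h : HalfJost (fun x => q x t) (fun x => -conj (q x t)) atBot lowerClosed lowerOpen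
    am cm) {k : ℂ} (hk : k ^ 2 ∈ lowerClosed) (x : ℝ) : psiM1 q k x t
      = Complex.exp (Complex.I * theta k x t) • ![am x (k ^ 2), k * cm x (k ^ 2)] :=
  jost_eq hq hz (Or.inr rfl) (isAdmissible_atBot_zero.2 hk) (h.isJost hk) x

omit hq hz in
lemma exp_mul_conj_exp_theta (k : ℂ) (x t : ℝ) : Complex.exp (Complex.I * theta k x t)
    * conj (Complex.exp (Complex.I * theta (conj k) x t)) = 1 := by
  have h4 : conj (4 : ℂ) = 4 := map_ofNat _ 4
  rw [← Complex.exp_conj, ← Complex.exp_add]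
  simp [theta, h4]

end Potential

/-! ### The sectionally meromorphic solution is meromorphic -/

open Classical in
/-- The function `f₊ / S` in the upper half-plane and `f₋` in the closed lower half-plane. -/
noncomputable def glue (fp fm S : ℂ → ℂ) (w : ℂ) : ℂ := if 0 < w.im then fp w / S w else fm w

section Glue

variable {fp fm S : ℂ → ℂ}

lemma glue_of_pos {w : ℂ} (hw : 0 < w.im) : glue fp fm S w = fp w / S w := if_pos hw

lemma glue_of_nonpos {w : ℂ} (hw : w.im ≤ 0) : glue fp fm S w = fm w := if_neg hw.not_gt

lemma glue_of_nonneg (hS : ∀ w : ℂ, w.im = 0 → S w ≠ 0)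
    (heq : ∀ w : ℂ, w.im = 0 → S w * fm w = fp w) {w : ℂ} (hw : 0 ≤ w.im) :
    glue fp fm S w = fp w / S w := by
  rcases hw.eq_or_lt with h | h
  · rw [glue_of_nonpos h.symm.le, eq_div_iff (hS w h.symm), mul_comm, heq w h.symm]
  · exact glue_of_pos h

/-- If `f₊ = S f₋` on the real line, the glued function is holomorphic off the zeros of `S`. -/
lemma differentiableAt_glue {Z : Set ℂ} (hZ : Z.Finite) (hSZ : ∀ w : ℂ, 0 ≤ w.im → S w = 0 → w ∈ Z)
    (hS : ∀ w : ℂ, w.im = 0 → S w ≠ 0) (heq : ∀ w : ℂ, w.im = 0 → S w * fm w = fp w)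
    (hfp : ContinuousOn fp upperClosed) (hfp' : DifferentiableOn ℂ fp upperOpen)
    (hfm : ContinuousOn fm lowerClosed) (hfm' : DifferentiableOn ℂ fm lowerOpen)
    (hSc : ContinuousOn S upperClosed) (hSd : DifferentiableOn ℂ S upperOpen)
    {w : ℂ} (hw : w ∉ Z) : DifferentiableAt ℂ (glue fp fm S) w := by
  have hU : IsOpen Zᶜ := hZ.isClosed.isOpen_compl
  have hclU : IsClosed upperClosed := isClosed_le continuous_const Complex.continuous_im
  have hclL : IsClosed lowerClosed := isClosed_le Complex.continuous_im continuous_const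
  -- continuity across the real line; holomorphy there follows from `differentiableOn_of_off_real`
  have hcont : ContinuousOn (glue fp fm S) Zᶜ := by
    intro v hv
    have h1 : ContinuousWithinAt (glue fp fm S) (Zᶜ ∩ upperClosed) v := by
      by_cases hvu : v ∈ upperClosed
      · have h2 : ContinuousOn (fun w => fp w / S w) (Zᶜ ∩ upperClosed) :=
          (hfp.mono Set.inter_subset_right).div (hSc.mono Set.inter_subset_right)
            fun w hw h => hw.1 (hSZ w hw.2 h)
        exact (h2 v ⟨hv, hvu⟩).congr (fun w hw => glue_of_nonneg hS heq hw.2)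
          (glue_of_nonneg hS heq hvu)
      · exact continuousWithinAt_of_notMem_closure fun h =>
          hvu (hclU.closure_subset (closure_mono Set.inter_subset_right h))
    have h2 : ContinuousWithinAt (glue fp fm S) (Zᶜ ∩ lowerClosed) v := by
      by_cases hvl : v ∈ lowerClosed
      · exact ((hfm v hvl).mono Set.inter_subset_right).congr (fun w hw => glue_of_nonpos hw.2)
          (glue_of_nonpos hvl)
      · exact continuousWithinAt_of_notMem_closure fun h =>
          hvl (hclL.closure_subset (closure_mono Set.inter_subset_right h))
    refine (h1.union h2).mono fun w hw => ?_
    rcases le_total 0 w.im with h | h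
    · exact Or.inl ⟨hw, h⟩
    · exact Or.inr ⟨hw, h⟩
  refine (differentiableOn_of_off_real hU hcont fun v hv hv0 => ?_).differentiableAt
    (hU.mem_nhds hw)
  rcases lt_or_gt_of_ne hv0 with h | h
  · have he : glue fp fm S =ᶠ[𝓝 v] fm := by
      filter_upwards [isOpen_lowerOpen.mem_nhds h] with u hu using glue_of_nonpos (le_of_lt hu)
    exact (hfm'.differentiableAt (isOpen_lowerOpen.mem_nhds h)).congr_of_eventuallyEq he
  · have he : glue fp fm S =ᶠ[𝓝 v] fun w => fp w / S w := by
      filter_upwards [isOpen_upperOpen.mem_nhds h] with u hu using glue_of_pos hu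
    exact ((hfp'.differentiableAt (isOpen_upperOpen.mem_nhds h)).div
      (hSd.differentiableAt (isOpen_upperOpen.mem_nhds h))
      fun h0 => hv (hSZ v (le_of_lt h) h0)).congr_of_eventuallyEq he

lemma tendsto_cobounded_of_halves {f : ℂ → ℂ} {L : ℂ}
    (hu : Tendsto f (Bornology.cobounded ℂ ⊓ 𝓟 upperClosed) (𝓝 L))
    (hl : Tendsto f (Bornology.cobounded ℂ ⊓ 𝓟 lowerClosed) (𝓝 L)) :
    Tendsto f (Bornology.cobounded ℂ) (𝓝 L) := by
  have h := hu.sup hl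
  rw [← inf_sup_left, sup_principal] at h
  have huniv : upperClosed ∪ lowerClosed = Set.univ :=
    Set.eq_univ_of_forall fun w => le_total 0 w.im
  rwa [huniv, principal_univ, inf_top_eq] at h

end Glue

lemma tendsto_conj_cobounded_upper : Tendsto (fun w : ℂ => conj w)
    (Bornology.cobounded ℂ ⊓ 𝓟 upperClosed) (Bornology.cobounded ℂ ⊓ 𝓟 lowerClosed) := by
  refine tendsto_inf.2 ⟨?_, ?_⟩
  · rw [← tendsto_norm_atTop_iff_cobounded]
    simp only [Complex.norm_conj]
    exact tendsto_norm_cobounded_atTop.mono_left inf_le_left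
  · refine tendsto_principal.2 ?_
    filter_upwards [mem_inf_of_right (mem_principal_self _)] with w hw
    simpa [lowerClosed, upperClosed] using hw

lemma tendsto_ofReal_cobounded (H : Set ℂ) (hH : ∀ w : ℂ, w.im = 0 → w ∈ H) :
    Tendsto (fun s : ℝ => (s : ℂ)) atTop (Bornology.cobounded ℂ ⊓ 𝓟 H) := by
  refine tendsto_inf.2 ⟨?_, tendsto_principal.2 (Eventually.of_forall fun s => hH _ (by simp))⟩
  rw [← tendsto_norm_atTop_iff_cobounded]
  simpa using tendsto_abs_atTop_atTop

/-- The scattering coefficient `s₁₁` as a function of `w = λ²`. -/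
noncomputable def scatS (ap cp am cm : ℂ → ℂ) (w : ℂ) : ℂ :=
  ap w * conj (am (conj w)) + w * cp w * conj (cm (conj w))

/-- Jost functions at a fixed point `(x, t)` of a reflectionless potential, as functions of
`w = λ²`: here `ap`, `cp` (in the upper half-plane) and `am`, `cm` (in the lower one) come from
the columns `ψ₊₁` and `ψ₋₁`, `r` is the value of `-q^*`, and `Z` is the set of the squares of the
points of the discrete spectrum. -/
structure ReflectionlessData (r : ℂ) (Z : Set ℂ) (ap cp am cm : ℂ → ℂ) : Prop where
  continuousOn_ap : ContinuousOn ap upperClosed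
  continuousOn_cp : ContinuousOn cp upperClosed
  continuousOn_am : ContinuousOn am lowerClosed
  continuousOn_cm : ContinuousOn cm lowerClosed
  differentiableOn_ap : DifferentiableOn ℂ ap upperOpen
  differentiableOn_cp : DifferentiableOn ℂ cp upperOpen
  differentiableOn_am : DifferentiableOn ℂ am lowerOpen
  differentiableOn_cm : DifferentiableOn ℂ cm lowerOpen
  asymptotics_p : ∃ e ≠ 0, Tendsto ap (Bornology.cobounded ℂ ⊓ 𝓟 upperClosed) (𝓝 e) ∧
    Tendsto (fun w => 2 * Complex.I * w * cp w - r * ap w)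
      (Bornology.cobounded ℂ ⊓ 𝓟 upperClosed) (𝓝 0)
  asymptotics_m : ∃ e ≠ 0, Tendsto am (Bornology.cobounded ℂ ⊓ 𝓟 lowerClosed) (𝓝 e) ∧
    Tendsto (fun w => 2 * Complex.I * w * cm w - r * am w)
      (Bornology.cobounded ℂ ⊓ 𝓟 lowerClosed) (𝓝 0)
  reflectionless : ∀ w : ℂ, w.im = 0 → cp w * am w = cm w * ap w
  unitary : ∀ w : ℂ, w.im = 0 → am w * conj (am w) + w * cm w * conj (cm w) = 1
  ne_zero : ∀ w : ℂ, w.im = 0 → scatS ap cp am cm w ≠ 0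
  finite : Z.Finite
  mem_of_eq_zero : ∀ w : ℂ, 0 ≤ w.im → scatS ap cp am cm w = 0 → w ∈ Z

namespace ReflectionlessData

variable {r : ℂ} {Z : Set ℂ} {ap cp am cm : ℂ → ℂ} (h : ReflectionlessData r Z ap cp am cm)
include h

lemma scatS_mul_am {w : ℂ} (hw : w.im = 0) : scatS ap cp am cm w * am w = ap w := by
  have h1 := h.reflectionless w hw
  have h2 := h.unitary w hw
  rw [scatS, Complex.conj_eq_iff_im.2 hw]
  linear_combination ap w * h2 + w * conj (cm w) * h1

lemma scatS_mul_cm {w : ℂ} (hw : w.im = 0) : scatS ap cp am cm w * cm w = cp w := by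
  have h1 := h.reflectionless w hw
  have h2 := h.unitary w hw
  rw [scatS, Complex.conj_eq_iff_im.2 hw]
  linear_combination cp w * h2 - conj (am w) * h1

lemma continuousOn_scatS : ContinuousOn (scatS ap cp am cm) upperClosed := by
  have hmaps : Set.MapsTo (fun w : ℂ => conj w) upperClosed lowerClosed := fun w hw => by
    simpa [lowerClosed, upperClosed] using hw
  have hc : ∀ f : ℂ → ℂ, ContinuousOn f lowerClosed →
      ContinuousOn (fun w => conj (f (conj w))) upperClosed := fun f hf =>
    Complex.continuous_conj.comp_continuousOn (hf.comp Complex.continuous_conj.continuousOn hmaps)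
  exact (h.continuousOn_ap.mul (hc _ h.continuousOn_am)).add
    ((continuousOn_id.mul h.continuousOn_cp).mul (hc _ h.continuousOn_cm))

lemma differentiableOn_scatS : DifferentiableOn ℂ (scatS ap cp am cm) upperOpen := by
  have hc : ∀ f : ℂ → ℂ, DifferentiableOn ℂ f lowerOpen →
      DifferentiableOn ℂ (fun w => conj (f (conj w))) upperOpen := fun f hf w hw => by
    have hw' : conj w ∈ lowerOpen := by simpa [lowerOpen, upperOpen] using hw
    have := (hf.differentiableAt (isOpen_lowerOpen.mem_nhds hw')).conj_conj
    simp only [Function.comp_def, Complex.conj_conj] at this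
    exact this.differentiableWithinAt
  exact (h.differentiableOn_ap.mul (hc _ h.differentiableOn_am)).add
    ((differentiableOn_id.mul h.differentiableOn_cp).mul (hc _ h.differentiableOn_cm))

lemma differentiableAt_glue_a {w : ℂ} (hw : w ∉ Z) :
    DifferentiableAt ℂ (glue ap am (scatS ap cp am cm)) w :=
  differentiableAt_glue h.finite h.mem_of_eq_zero h.ne_zero (fun _ => h.scatS_mul_am)
    h.continuousOn_ap h.differentiableOn_ap h.continuousOn_am h.differentiableOn_am
    h.continuousOn_scatS h.differentiableOn_scatS hw

lemma differentiableAt_glue_c {w : ℂ} (hw : w ∉ Z) :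
    DifferentiableAt ℂ (glue cp cm (scatS ap cp am cm)) w :=
  differentiableAt_glue h.finite h.mem_of_eq_zero h.ne_zero (fun _ => h.scatS_mul_cm)
    h.continuousOn_cp h.differentiableOn_cp h.continuousOn_cm h.differentiableOn_cm
    h.continuousOn_scatS h.differentiableOn_scatS hw

/-- The determinant of the solution of the Riemann-Hilbert problem. It is `1` in the upper
half-plane by the definition of `s₁₁`, on the real line by unitarity, and in the lower half-plane
by symmetry. -/
lemma glue_det {w : ℂ} (hw : w ∉ Z) (hw' : conj w ∉ Z) :
    glue ap am (scatS ap cp am cm) w * conj (glue ap am (scatS ap cp am cm) (conj w))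
      + w * glue cp cm (scatS ap cp am cm) w * conj (glue cp cm (scatS ap cp am cm) (conj w))
      = 1 := by
  have key : ∀ w, 0 < w.im → w ∉ Z →
      glue ap am (scatS ap cp am cm) w * conj (glue ap am (scatS ap cp am cm) (conj w))
      + w * glue cp cm (scatS ap cp am cm) w * conj (glue cp cm (scatS ap cp am cm) (conj w))
      = 1 := fun w hw hwZ => by
    have hS : scatS ap cp am cm w ≠ 0 := fun h0 => hwZ (h.mem_of_eq_zero w hw.le h0)
    have hcw : (conj w).im ≤ 0 := by simpa using hw.le
    rw [glue_of_pos hw, glue_of_pos hw, glue_of_nonpos hcw, glue_of_nonpos hcw]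
    have h1 : scatS ap cp am cm w = _ := rfl
    conv_rhs at h1 => rw [scatS]
    field_simp
    linear_combination -h1
  rcases lt_trichotomy 0 w.im with hpos | hzero | hneg
  · exact key w hpos hw
  · have hc : conj w = w := Complex.conj_eq_iff_im.2 hzero.symm
    rw [hc, glue_of_nonpos hzero.symm.le, glue_of_nonpos hzero.symm.le]
    exact h.unitary w hzero.symm
  · have h1 := key (conj w) (by simpa using hneg) hw'
    have h2 := congrArg conj h1
    simp only [map_add, map_mul, Complex.conj_conj, map_one] at h2
    linear_combination h2

/-- The limits of the glued functions at infinity. The limits `e₊` and `e₋` of `ap` and `am` may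
differ; division by `s₁₁ → e₊ e₋^*` reconciles them, because `|e₋| = 1`. -/
lemma exists_limit : ∃ e : ℂ, e * conj e = 1 ∧
    Tendsto (glue ap am (scatS ap cp am cm)) (Bornology.cobounded ℂ) (𝓝 e) ∧
    Tendsto (fun w => w * glue cp cm (scatS ap cp am cm) w) (Bornology.cobounded ℂ)
      (𝓝 (r * e / (2 * Complex.I))) := by
  obtain ⟨ep, hep, hap, hcp⟩ := h.asymptotics_p
  obtain ⟨em, hem, ham, hcm⟩ := h.asymptotics_m
  have hI : (2 * Complex.I : ℂ) ≠ 0 := by simp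
  have hwc : ∀ {l : Filter ℂ} {a c : ℂ → ℂ} {e : ℂ}, Tendsto a l (𝓝 e) →
      Tendsto (fun w => 2 * Complex.I * w * c w - r * a w) l (𝓝 0) →
      Tendsto (fun w => w * c w) l (𝓝 (r * e / (2 * Complex.I))) := fun {l a c e} ha hc => by
    have h1 := (hc.add (ha.const_mul r)).div_const (2 * Complex.I)
    rw [zero_add] at h1
    refine h1.congr fun w => ?_
    field_simp
    ring
  have hcp' := hwc hap hcp
  have hcm' := hwc ham hcm
  have hcm0 : Tendsto cm (Bornology.cobounded ℂ ⊓ 𝓟 lowerClosed) (𝓝 0) := by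
    have h1 := (tendsto_inv₀_cobounded.mono_left inf_le_left).mul hcm'
    rw [zero_mul] at h1
    refine h1.congr' ?_
    have hne : ∀ᶠ w in Bornology.cobounded ℂ, w ∉ ({0} : Set ℂ) :=
      (Set.finite_singleton 0).isBounded
    filter_upwards [hne.filter_mono inf_le_left] with w hw
    rw [← mul_assoc, inv_mul_cancel₀ hw, one_mul]
  have hconj : ∀ {l : Filter ℂ} {f : ℂ → ℂ} {e : ℂ}, Tendsto f l (𝓝 e) →
      Tendsto (fun w => conj (f w)) l (𝓝 (conj e)) := fun {l f e} hf =>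
    (Complex.continuous_conj.tendsto e).comp hf
  have hSlim : Tendsto (scatS ap cp am cm) (Bornology.cobounded ℂ ⊓ 𝓟 upperClosed)
      (𝓝 (ep * conj em)) := by
    have h1 := (hap.mul (hconj (ham.comp tendsto_conj_cobounded_upper))).add
      (hcp'.mul (hconj (hcm0.comp tendsto_conj_cobounded_upper)))
    rw [map_zero, mul_zero, add_zero] at h1
    exact h1
  have hcem : conj em ≠ 0 := by simpa using hem
  have hSne : ep * conj em ≠ 0 := mul_ne_zero hep hcem
  -- unitarity on the real line, in the limit of large `w`
  have hunit : em * conj em = 1 := by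
    have hr := tendsto_ofReal_cobounded lowerClosed fun w hw => hw.le
    have h1 := ((ham.mul (hconj ham)).add (hcm'.mul (hconj hcm0))).comp hr
    rw [map_zero, mul_zero, add_zero] at h1
    refine tendsto_nhds_unique h1 (tendsto_const_nhds.congr fun s => ?_)
    exact (h.unitary (s : ℂ) (Complex.ofReal_im s)).symm
  refine ⟨em, hunit, tendsto_cobounded_of_halves ?_ ?_, tendsto_cobounded_of_halves ?_ ?_⟩
  · have h1 := hap.div hSlim hSne
    have h2 : ep / (ep * conj em) = em := by
      field_simp
      linear_combination -hunit
    rw [h2] at h1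
    refine h1.congr' ?_
    filter_upwards [mem_inf_of_right (mem_principal_self _)] with w hw
    exact (glue_of_nonneg h.ne_zero (fun _ => h.scatS_mul_am) hw).symm
  · refine ham.congr' ?_
    filter_upwards [mem_inf_of_right (mem_principal_self _)] with w hw
    exact (glue_of_nonpos hw).symm
  · have h1 := hcp'.div hSlim hSne
    have h2 : r * ep / (2 * Complex.I) / (ep * conj em) = r * em / (2 * Complex.I) := by
      field_simp
      linear_combination -r * hunit
    rw [h2] at h1
    refine h1.congr' ?_
    filter_upwards [mem_inf_of_right (mem_principal_self _)] with w hw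
    rw [glue_of_nonneg h.ne_zero (fun _ => h.scatS_mul_cm) hw]
    exact mul_div_assoc _ _ _
  · refine hcm'.congr' ?_
    filter_upwards [mem_inf_of_right (mem_principal_self _)] with w hw
    rw [glue_of_nonpos hw]

end ReflectionlessData

/-! ### The Riemann-Hilbert problem of a reflectionless solution -/

/-- At `z = 0` the spatial equation for `a` has no right-hand side. -/
lemma HalfJost.apply_zero {u r : ℝ → ℂ} {l : Filter ℝ} [l.NeBot] {H U : Set ℂ}
    {a c : ℝ → ℂ → ℂ} (h : HalfJost u r l H U a c) (h0 : (0 : ℂ) ∈ H) (x : ℝ) : a x 0 = 1 := by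
  have hd : ∀ x, HasDerivAt (fun x => a x 0) 0 x := fun x => by
    simpa using h.hasDerivAt_a x 0 h0
  refine tendsto_nhds_unique (tendsto_const_nhds.congr fun y => ?_) (h.tendsto_a 0 h0)
  exact is_const_of_deriv_eq_zero (fun x => (hd x).differentiableAt) (fun x => (hd x).deriv) x y

/-- For real `z` the Jost matrix satisfies a unitarity relation, which follows from the conservation
of the left-hand side in `x`. -/
lemma HalfJost.unitary {u : ℝ → ℂ} {l : Filter ℝ} [l.NeBot] {H U : Set ℂ} {a c : ℝ → ℂ → ℂ}
    (h : HalfJost u (fun x => -conj (u x)) l H U a c) {w : ℂ} (hwH : w ∈ H) (hw : w.im = 0)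
    (x : ℝ) : a x w * conj (a x w) + w * c x w * conj (c x w) = 1 := by
  have hcw : conj w = w := Complex.conj_eq_iff_im.2 hw
  have hd : ∀ x, HasDerivAt (fun x => a x w * conj (a x w) + w * c x w * conj (c x w)) 0 x :=
    fun x => by
      have ha := h.hasDerivAt_a x w hwH
      have hc := h.hasDerivAt_c x w hwH
      refine ((ha.mul (hasDerivAt_conj_comp ha)).add
        ((hc.const_mul w).mul (hasDerivAt_conj_comp hc))).congr_deriv ?_
      have h2 : conj (2 : ℂ) = 2 := map_ofNat _ 2
      simp only [map_add, map_mul, map_neg, Complex.conj_I, hcw, h2, Complex.conj_conj]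
      ring
  have hl := ((h.tendsto_a w hwH).mul ((Complex.continuous_conj.tendsto _).comp
    (h.tendsto_a w hwH))).add (((h.tendsto_c w hwH).const_mul w).mul
      ((Complex.continuous_conj.tendsto _).comp (h.tendsto_c w hwH)))
  simp only [map_one, mul_one, mul_zero, zero_mul, add_zero] at hl
  refine tendsto_nhds_unique (tendsto_const_nhds.congr fun y => ?_) hl
  exact is_const_of_deriv_eq_zero (fun x => (hd x).differentiableAt) (fun x => (hd x).deriv) x y

lemma sq_im (k : ℂ) : (k ^ 2).im = 2 * (k.re * k.im) := by
  rw [sq, Complex.mul_im]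
  ring

lemma exists_sq_eq (w : ℂ) : ∃ k : ℂ, k ^ 2 = w := IsAlgClosed.exists_pow_nat_eq w two_pos

lemma mem_contSpec_of_sq_im {k : ℂ} (hk : (k ^ 2).im = 0) : k ∈ contSpec := by
  rw [sq_im] at hk
  rcases mul_eq_zero.1 ((mul_eq_zero.1 hk).resolve_left two_ne_zero) with h | h
  · exact Or.inr h
  · exact Or.inl h

lemma mem_firstQuadrant_or_neg_mem {k : ℂ} (hk : k ^ 2 ∈ upperOpen) :
    k ∈ firstQuadrant ∨ -k ∈ firstQuadrant := by
  have h : 0 < (k ^ 2).im := hk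
  rw [sq_im] at h
  have h1 : 0 < k.re * k.im := by linarith
  rcases mul_pos_iff.1 h1 with h2 | h2
  · exact Or.inl h2
  · exact Or.inr ⟨by simpa using h2.1, by simpa using h2.2⟩

lemma sq_mem_upperOpen_of_mem_firstQuadrant {k : ℂ} (hk : k ∈ firstQuadrant) :
    k ^ 2 ∈ upperOpen := by
  change 0 < (k ^ 2).im
  rw [sq_im]
  have := mul_pos hk.1 hk.2
  linarith

lemma tendsto_sq_cobounded : Tendsto (fun k : ℂ => k ^ 2) (Bornology.cobounded ℂ)
    (Bornology.cobounded ℂ) := by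
  rw [← tendsto_norm_atTop_iff_cobounded]
  simp only [norm_pow]
  exact (tendsto_pow_atTop two_ne_zero).comp tendsto_norm_cobounded_atTop

lemma tendsto_conj_sq_cobounded : Tendsto (fun k : ℂ => conj k ^ 2) (Bornology.cobounded ℂ)
    (Bornology.cobounded ℂ) := by
  rw [← tendsto_norm_atTop_iff_cobounded]
  simp only [norm_pow, Complex.norm_conj]
  exact (tendsto_pow_atTop two_ne_zero).comp tendsto_norm_cobounded_atTop

/-- The entries of the first column of the solution of the Riemann-Hilbert problem, as functions of
`k` in terms of functions of `w = k²`: the first entry is even and the second one is odd. -/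
def rhpFst (F₁ F₂ : ℂ → ℂ) : Fin 2 → ℂ → ℂ := ![fun k => F₁ (k ^ 2), fun k => k * F₂ (k ^ 2)]

/-- The entries of the second column of the solution of the Riemann-Hilbert problem, obtained from
the first column by the symmetry `k ↦ k^*`. -/
noncomputable def rhpSnd (F₁ F₂ : ℂ → ℂ) : Fin 2 → ℂ → ℂ :=
  ![fun k => -(k * conj (F₂ (conj k ^ 2))), fun k => conj (F₁ (conj k ^ 2))]

lemma differentiableAt_rhpFst {F₁ F₂ : ℂ → ℂ} {k : ℂ} (h₁ : DifferentiableAt ℂ F₁ (k ^ 2))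
    (h₂ : DifferentiableAt ℂ F₂ (k ^ 2)) (j : Fin 2) : DifferentiableAt ℂ (rhpFst F₁ F₂ j) k := by
  have hsq : DifferentiableAt ℂ (fun k : ℂ => k ^ 2) k := by fun_prop
  have hc₁ : DifferentiableAt ℂ (fun k => F₁ (k ^ 2)) k := h₁.comp k hsq
  have hc₂ : DifferentiableAt ℂ (fun k => F₂ (k ^ 2)) k := h₂.comp k hsq
  fin_cases j
  · exact hc₁
  · exact differentiableAt_id.mul hc₂

lemma differentiableAt_rhpSnd {F₁ F₂ : ℂ → ℂ} {k : ℂ} (h₁ : DifferentiableAt ℂ F₁ (conj k ^ 2))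
    (h₂ : DifferentiableAt ℂ F₂ (conj k ^ 2)) (j : Fin 2) :
    DifferentiableAt ℂ (rhpSnd F₁ F₂ j) k := by
  have h := fun j => (differentiableAt_rhpFst h₁ h₂ j).conj_conj
  simp only [Function.comp_def, Complex.conj_conj] at h
  fin_cases j
  · refine (h 1).neg.congr_of_eventuallyEq (Eventually.of_forall fun k => ?_)
    simp [rhpFst, rhpSnd]
  · exact h 0

section Potential

variable {q : ℝ → ℝ → ℂ} (hq : IsSolution q) (hz : ZeroBoundary q)

section Representation

variable {t : ℝ} {ap cp am cm : ℝ → ℂ → ℂ}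
  (hp : HalfJost (fun x => q x t) (fun x => -conj (q x t)) atTop upperClosed upperOpen ap cp)
  (hm : HalfJost (fun x => q x t) (fun x => -conj (q x t)) atBot lowerClosed lowerOpen am cm)
include hq hz hp hm

lemma s11_eq_scatS {k : ℂ} (hk : k ^ 2 ∈ upperClosed) (x : ℝ) :
    s11 q k = scatS (ap x) (cp x) (am x) (cm x) (k ^ 2) := by
  have h1 : wronskian (psiP1 q k x t) (psiM2 q k x t) = s11 q k :=
    wronskian_jost hq hz (Or.inl rfl) (Or.inr rfl) (isAdmissible_atTop_zero.2 hk)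
      (isAdmissible_one.2 (isAdmissible_atBot_zero.2 (conj_sq_mem_lowerClosed.2 hk))) x t
  rw [← h1, psiM2_eq hq hz hk, psiP1_eq hq hz hp hk,
    psiM1_eq hq hz hm (conj_sq_mem_lowerClosed.2 hk), scatS]
  have he := exp_mul_conj_exp_theta k x t
  generalize Complex.exp (Complex.I * theta k x t) = e at he ⊢
  generalize Complex.exp (Complex.I * theta (conj k) x t) = e' at he ⊢
  simp only [wronskian, adjVec, Pi.smul_apply, smul_eq_mul, Matrix.cons_val_zero,
    Matrix.cons_val_one, map_mul, Complex.conj_conj, map_pow]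
  linear_combination (ap x (k ^ 2) * conj (am x (conj k ^ 2))
    + k ^ 2 * cp x (k ^ 2) * conj (cm x (conj k ^ 2))) * he

lemma s21_eq {k : ℂ} (hk : (k ^ 2).im = 0) (x : ℝ) : s21 q k
    = Complex.exp (Complex.I * theta k x t) ^ 2
      * (k * (cp x (k ^ 2) * am x (k ^ 2) - cm x (k ^ 2) * ap x (k ^ 2))) := by
  have hu : k ^ 2 ∈ upperClosed := hk.ge
  have hl : k ^ 2 ∈ lowerClosed := hk.le
  have h1 : wronskian (psiM1 q k x t) (psiP1 q k x t) = s21 q k :=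
    wronskian_jost hq hz (Or.inr rfl) (Or.inl rfl) (isAdmissible_atBot_zero.2 hl)
      (isAdmissible_atTop_zero.2 hu) x t
  rw [← h1, psiP1_eq hq hz hp hu, psiM1_eq hq hz hm hl]
  simp only [wronskian, Pi.smul_apply, smul_eq_mul, Matrix.cons_val_zero, Matrix.cons_val_one]
  ring

/-- The assumptions on the scattering data, in terms of the Jost functions at a point. -/
lemma reflectionlessData {N : ℕ} {lam : Fin N → ℂ}
    (hzeros : ∀ k, (k ∈ firstQuadrant ∧ s11 q k = 0) ↔ ∃ n, lam n = k)
    (hnosing : ∀ k ∈ contSpec, s11 q k ≠ 0) (hrefl : ∀ k ∈ contSpec, rho q k = 0) (x : ℝ) :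
    ReflectionlessData (-conj (q x t)) (Set.range fun n => lam n ^ 2) (ap x) (cp x) (am x)
      (cm x) := by
  have hne : ∀ w : ℂ, w.im = 0 → scatS (ap x) (cp x) (am x) (cm x) w ≠ 0 := fun w hw => by
    obtain ⟨k, rfl⟩ := exists_sq_eq w
    rw [← s11_eq_scatS hq hz hp hm hw.ge x]
    exact hnosing k (mem_contSpec_of_sq_im hw)
  refine ⟨hp.continuousOn_a x, hp.continuousOn_c x, hm.continuousOn_a x, hm.continuousOn_c x,
    hp.differentiableOn_a x, hp.differentiableOn_c x, hm.differentiableOn_a x,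
    hm.differentiableOn_c x, hp.asymptotics x, hm.asymptotics x, fun w hw => ?_,
    fun w hw => hm.unitary (le_of_eq hw) hw x, hne, Set.finite_range _, fun w hw hS => ?_⟩
  · have h0 : ∀ w : ℂ, w.im = 0 → w ≠ 0 → cp x w * am x w = cm x w * ap x w := fun w hw hw0 => by
      obtain ⟨k, rfl⟩ := exists_sq_eq w
      have hk := mem_contSpec_of_sq_im hw
      have h1 := (div_eq_zero_iff.1 (hrefl k hk)).resolve_right (hnosing k hk)
      rw [s21_eq hq hz hp hm hw x] at h1
      have hk0 : k ≠ 0 := fun h => hw0 (by rw [h]; simp)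
      have h2 := (mul_eq_zero.1 h1).resolve_left (pow_ne_zero 2 (Complex.exp_ne_zero _))
      exact sub_eq_zero.1 ((mul_eq_zero.1 h2).resolve_left hk0)
    -- the value at `w = 0`, where the factor `k` vanishes, follows by continuity
    have hc : ∀ {f : ℂ → ℂ} {H : Set ℂ}, ContinuousOn f H → (∀ s : ℝ, (s : ℂ) ∈ H) →
        Continuous fun s : ℝ => f s := fun hf hH =>
      hf.comp_continuous Complex.continuous_ofReal hH
    have hu : ∀ s : ℝ, (s : ℂ) ∈ upperClosed := fun s => (Complex.ofReal_im s).ge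
    have hl : ∀ s : ℝ, (s : ℂ) ∈ lowerClosed := fun s => (Complex.ofReal_im s).le
    have h1 := Continuous.ext_on (dense_compl_singleton (0 : ℝ))
      ((hc (hp.continuousOn_c x) hu).mul (hc (hm.continuousOn_a x) hl))
      ((hc (hm.continuousOn_c x) hl).mul (hc (hp.continuousOn_a x) hu))
      fun s hs => h0 s (Complex.ofReal_im s) (by simpa using hs)
    have hre : ((w.re : ℝ) : ℂ) = w := Complex.ext (by simp) (by simp [hw])
    have h2 : cp x (w.re : ℝ) * am x (w.re : ℝ) = cm x (w.re : ℝ) * ap x (w.re : ℝ) :=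
      congrFun h1 w.re
    rwa [hre] at h2
  · rcases hw.eq_or_lt with h0 | h0
    · exact absurd hS (hne w h0.symm)
    · obtain ⟨k, rfl⟩ := exists_sq_eq w
      have hk : k ^ 2 ∈ upperOpen := h0
      rcases mem_firstQuadrant_or_neg_mem hk with h1 | h1
      · obtain ⟨n, hn⟩ := (hzeros k).1 ⟨h1, by
          rw [s11_eq_scatS hq hz hp hm (upperOpen_subset hk) x, hS]⟩
        exact ⟨n, by simp only [hn]⟩
      · have hk' : (-k) ^ 2 ∈ upperClosed := by rw [neg_sq]; exact upperOpen_subset hk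
        obtain ⟨n, hn⟩ := (hzeros (-k)).1 ⟨h1, by
          rw [s11_eq_scatS hq hz hp hm hk' x, neg_sq, hS]⟩
        exact ⟨n, by simp only [hn, neg_sq]⟩

end Representation

end Potential

/-! ### The discrete spectrum and the solution of the Riemann-Hilbert problem -/

section Spectrum

variable {q : ℝ → ℝ → ℂ} (hq : IsSolution q) (hz : ZeroBoundary q)
include hq hz

lemma s11_neg {k : ℂ} (hk : k ^ 2 ∈ upperClosed) : s11 q (-k) = s11 q k := by
  obtain ⟨⟨ap, cp, hp⟩, am, cm, hm⟩ := exists_halfJost hq hz 0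
  rw [s11_eq_scatS hq hz hp hm hk 0, s11_eq_scatS hq hz hp hm (by rwa [neg_sq]) 0, neg_sq]

/-- `s₁₁` is even, so its zeros in `D⁺` come in pairs with the same multiplicity. -/
lemma double_zero_neg {k : ℂ} (hk : k ^ 2 ∈ upperOpen) (h0 : s11 q k = 0)
    (h1 : deriv (s11 q) k = 0) (h2 : iteratedDeriv 2 (s11 q) k ≠ 0) :
    s11 q (-k) = 0 ∧ deriv (s11 q) (-k) = 0 ∧ iteratedDeriv 2 (s11 q) (-k) ≠ 0 := by
  have he : s11 q =ᶠ[𝓝 (-k)] fun k => s11 q (-k) := by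
    have hc : ContinuousAt (fun k : ℂ => k ^ 2) (-k) := by fun_prop
    filter_upwards [hc (isOpen_upperOpen.mem_nhds (by simpa using hk))] with k' hk'
      using (s11_neg hq hz (upperOpen_subset hk')).symm
  refine ⟨?_, ?_, ?_⟩
  · rw [s11_neg hq hz (upperOpen_subset hk), h0]
  · rw [he.deriv_eq, deriv_comp_neg, neg_neg, h1, neg_zero]
  · rw [he.iteratedDeriv_eq, iteratedDeriv_comp_neg, neg_neg]
    simpa using h2

/-- The zeros of `s₂₂` are the complex conjugates of the zeros of `s₁₁`. -/
lemma double_zero_conj {k : ℂ} (hk : k ^ 2 ∈ upperOpen) (h0 : s11 q k = 0)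
    (h1 : deriv (s11 q) k = 0) (h2 : iteratedDeriv 2 (s11 q) k ≠ 0) :
    s22 q (conj k) = 0 ∧ deriv (s22 q) (conj k) = 0 ∧ iteratedDeriv 2 (s22 q) (conj k) ≠ 0 := by
  have hsub : ∀ {k : ℂ}, k ^ 2 ∈ lowerOpen → k ^ 2 ∈ lowerClosed := fun {k} h =>
    le_of_lt (show (k ^ 2).im < 0 from h)
  have hk' := conj_sq_mem_lowerOpen.2 hk
  have he : s22 q =ᶠ[𝓝 (conj k)] (conj ∘ s11 q ∘ conj) := by
    have hc : ContinuousAt (fun k : ℂ => k ^ 2) (conj k) := by fun_prop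
    filter_upwards [hc (isOpen_lowerOpen.mem_nhds hk')] with k' h'
      using s22_eq_conj_s11 hq hz (hsub h')
  refine ⟨?_, ?_, ?_⟩
  · rw [s22_eq_conj_s11 hq hz (hsub hk'), Complex.conj_conj, h0, map_zero]
  · rw [he.deriv_eq, deriv_conj_conj, Function.comp_apply, Function.comp_apply, Complex.conj_conj,
      h1, map_zero]
  · rw [iteratedDeriv_succ, iteratedDeriv_one] at h2
    rw [he.iteratedDeriv_eq, iteratedDeriv_succ, iteratedDeriv_one, deriv_conj_conj,
      deriv_conj_conj, Function.comp_apply, Function.comp_apply, Complex.conj_conj]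
    simpa using h2

variable {t x : ℝ} {ap cp am cm : ℝ → ℂ → ℂ}
  (hp : HalfJost (fun x => q x t) (fun x => -conj (q x t)) atTop upperClosed upperOpen ap cp)
  (hm : HalfJost (fun x => q x t) (fun x => -conj (q x t)) atBot lowerClosed lowerOpen am cm)
include hp hm

/-- The residue condition of the first column at the zeros of `s₁₁`. -/
lemma residueCondition_rhpFst {k : ℂ} (hk : k ^ 2 ∈ upperOpen) (h0 : s11 q k = 0)
    (h1 : deriv (s11 q) k = 0) (h2 : iteratedDeriv 2 (s11 q) k ≠ 0) (j : Fin 2) :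
    ResidueCondition
      (rhpFst (glue (ap x) (am x) (scatS (ap x) (cp x) (am x) (cm x)))
        (glue (cp x) (cm x) (scatS (ap x) (cp x) (am x) (cm x))) j)
      (rhpSnd (glue (ap x) (am x) (scatS (ap x) (cp x) (am x) (cm x)))
        (glue (cp x) (cm x) (scatS (ap x) (cp x) (am x) (cm x))) j) k
      (constA q k * Complex.exp (-(2 * Complex.I * theta k x t)))
      (constB q k - 2 * Complex.I * thetaDeriv k x t) := by
  have hc : ContinuousAt (fun k : ℂ => k ^ 2) k := by fun_prop
  have hev : ∀ᶠ k' in 𝓝[≠] k, k' ^ 2 ∈ upperOpen :=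
    nhdsWithin_le_nhds (hc (isOpen_upperOpen.mem_nhds hk))
  refine Asymptotics.IsBigO.congr' (residueCondition_s11 hq hz hk h0 h1 h2 x t j) ?_ .rfl
  filter_upwards [hev] with k' hk'
  have hu := upperOpen_subset hk'
  have hle : (conj k' ^ 2).im ≤ 0 := conj_sq_mem_lowerClosed.2 hu
  have hpos : 0 < (k' ^ 2).im := hk'
  have he : Complex.exp (-(Complex.I * theta k' x t)) * Complex.exp (Complex.I * theta k' x t)
      = 1 := by
    rw [← Complex.exp_add, neg_add_cancel, Complex.exp_zero]
  have he' := exp_mul_conj_exp_theta k' x t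
  rw [psiM2_eq hq hz hu, psiP1_eq hq hz hp hu, psiM1_eq hq hz hm (conj_sq_mem_lowerClosed.2 hu),
    s11_eq_scatS hq hz hp hm hu x]
  generalize Complex.exp (Complex.I * theta k' x t) = e at he he' ⊢
  generalize Complex.exp (Complex.I * theta (conj k') x t) = e' at he' ⊢
  congr 1
  · fin_cases j
    · simp [rhpFst, glue_of_pos hpos, ← mul_assoc, he]
    · simp [rhpFst, glue_of_pos hpos, ← mul_assoc, he, mul_div_assoc]
  · congr 1
    fin_cases j
    · simp [rhpSnd, glue_of_nonpos hle, adjVec, ← mul_assoc, he']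
    · simp [rhpSnd, glue_of_nonpos hle, adjVec, ← mul_assoc, he']

/-- The residue condition of the second column at the zeros of `s₂₂`. -/
lemma residueCondition_rhpSnd {k : ℂ} (hk : k ^ 2 ∈ lowerOpen) (h0 : s22 q k = 0)
    (h1 : deriv (s22 q) k = 0) (h2 : iteratedDeriv 2 (s22 q) k ≠ 0) (j : Fin 2) :
    ResidueCondition
      (rhpSnd (glue (ap x) (am x) (scatS (ap x) (cp x) (am x) (cm x)))
        (glue (cp x) (cm x) (scatS (ap x) (cp x) (am x) (cm x))) j)
      (rhpFst (glue (ap x) (am x) (scatS (ap x) (cp x) (am x) (cm x)))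
        (glue (cp x) (cm x) (scatS (ap x) (cp x) (am x) (cm x))) j) k
      (constA q k * Complex.exp (2 * Complex.I * theta k x t))
      (constB q k + 2 * Complex.I * thetaDeriv k x t) := by
  have hc : ContinuousAt (fun k : ℂ => k ^ 2) k := by fun_prop
  have hev : ∀ᶠ k' in 𝓝[≠] k, k' ^ 2 ∈ lowerOpen :=
    nhdsWithin_le_nhds (hc (isOpen_lowerOpen.mem_nhds hk))
  refine Asymptotics.IsBigO.congr' (residueCondition_s22 hq hz hk h0 h1 h2 x t j) ?_ .rfl
  filter_upwards [hev] with k' hk'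
  have hlt : (k' ^ 2).im < 0 := hk'
  have hl : k' ^ 2 ∈ lowerClosed := hlt.le
  have hu := conj_sq_mem_upperClosed.2 hl
  have hpos : 0 < (conj k' ^ 2).im := conj_sq_mem_upperOpen.2 hk'
  have he : Complex.exp (-(Complex.I * theta k' x t)) * Complex.exp (Complex.I * theta k' x t)
      = 1 := by
    rw [← Complex.exp_add, neg_add_cancel, Complex.exp_zero]
  have he' := exp_mul_conj_exp_theta k' x t
  rw [psiP2_eq hq hz hl, psiP1_eq hq hz hp hu, psiM1_eq hq hz hm hl, s22_eq_conj_s11 hq hz hl,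
    s11_eq_scatS hq hz hp hm hu x]
  generalize Complex.exp (Complex.I * theta k' x t) = e at he he' ⊢
  generalize Complex.exp (Complex.I * theta (conj k') x t) = e' at he' ⊢
  congr 1
  · fin_cases j
    · simp [rhpSnd, glue_of_pos hpos, adjVec, ← mul_assoc, he', mul_div_assoc, neg_div]
    · simp [rhpSnd, glue_of_pos hpos, adjVec, ← mul_assoc, he']
  · congr 1
    fin_cases j
    · simp [rhpFst, glue_of_nonpos hlt.le, ← mul_assoc, he]
    · simp [rhpFst, glue_of_nonpos hlt.le, ← mul_assoc, he]

end Spectrum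

section Zeta

variable {N : ℕ} {lam : Fin N → ℂ} (hlam : ∀ n, lam n ∈ firstQuadrant)
include hlam

lemma zeta_sq_mem (s : Fin N ⊕ Fin N) : zeta lam s ^ 2 ∈ upperOpen := by
  rcases s with n | n
  · exact sq_mem_upperOpen_of_mem_firstQuadrant (hlam n)
  · simpa [zeta] using sq_mem_upperOpen_of_mem_firstQuadrant (hlam n)

lemma zeta_ne_conj (i j : Fin N ⊕ Fin N) : zeta lam i ≠ conj (zeta lam j) := fun h => by
  have h1 : 0 < (zeta lam i ^ 2).im := zeta_sq_mem hlam i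
  have h2 : (conj (zeta lam j) ^ 2).im < 0 := conj_sq_mem_lowerOpen.2 (zeta_sq_mem hlam j)
  rw [← h] at h2
  exact lt_asymm h1 h2

lemma zeta_ne_zero (s : Fin N ⊕ Fin N) : zeta lam s ≠ 0 := fun h => by
  have h1 : 0 < (zeta lam s ^ 2).im := zeta_sq_mem hlam s
  simp [h] at h1

lemma zeta_injective (hinj : Function.Injective lam) : Function.Injective (zeta lam) := by
  have hre : ∀ n, 0 < (lam n).re := fun n => (hlam n).1
  have hne : ∀ n m, lam n ≠ -lam m := fun n m h => by
    have h1 := hre n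
    rw [h, Complex.neg_re] at h1
    linarith [hre m]
  rintro (n | n) (m | m) h
  · exact congrArg _ (hinj h)
  · exact absurd h (hne n m)
  · exact absurd h.symm (hne m n)
  · exact congrArg _ (hinj (neg_injective h))

omit hlam in
lemma sq_notMem_range {k : ℂ} (hk : ∀ s, k ≠ zeta lam s) :
    k ^ 2 ∉ Set.range fun n => lam n ^ 2 := by
  rintro ⟨n, hn⟩
  rcases sq_eq_sq_iff_eq_or_eq_neg.1 hn with h | h
  · exact hk (Sum.inl n) h.symm
  · exact hk (Sum.inr n) (by simp [zeta, h])

end Zeta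

/-- The Jost functions of a reflectionless solution with double zeros of `s₁₁` solve the
Riemann-Hilbert problem, and the coefficient of `1/k` in its entry `m₁₂` is a multiple of `q`. -/
lemma exists_isSolRHP {q : ℝ → ℝ → ℂ} (hq : IsSolution q) (hz : ZeroBoundary q) {N : ℕ}
    {lam : Fin N → ℂ} (hzeros : ∀ k, (k ∈ firstQuadrant ∧ s11 q k = 0) ↔ ∃ n, lam n = k)
    (hdouble : ∀ n, deriv (s11 q) (lam n) = 0 ∧ iteratedDeriv 2 (s11 q) (lam n) ≠ 0)
    (hnosing : ∀ k ∈ contSpec, s11 q k ≠ 0) (hrefl : ∀ k ∈ contSpec, rho q k = 0) (x t : ℝ) :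
    ∃ (m₁₁ m₁₂ m₂₁ m₂₂ : ℂ → ℂ) (e : ℂ),
      IsSolRHP (constA q) (constB q) (zeta lam) x t m₁₁ m₁₂ m₂₁ m₂₂ e (conj e) ∧
      m₁₁ 0 = 1 ∧ m₁₂ 0 = 0 ∧ e * conj e = 1 ∧
      Tendsto (fun k => k * m₁₂ k) (Bornology.cobounded ℂ)
        (𝓝 (Complex.I / 2 * q x t * conj e)) := by
  have hlam : ∀ n, lam n ∈ firstQuadrant := fun n => ((hzeros _).2 ⟨n, rfl⟩).1
  have hs : ∀ s, s11 q (zeta lam s) = 0 ∧ deriv (s11 q) (zeta lam s) = 0 ∧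
      iteratedDeriv 2 (s11 q) (zeta lam s) ≠ 0 := by
    rintro (n | n)
    · exact ⟨((hzeros _).2 ⟨n, rfl⟩).2, hdouble n⟩
    · exact double_zero_neg hq hz (sq_mem_upperOpen_of_mem_firstQuadrant (hlam n))
        ((hzeros _).2 ⟨n, rfl⟩).2 (hdouble n).1 (hdouble n).2
  obtain ⟨⟨ap, cp, hp⟩, am, cm, hm⟩ := exists_halfJost hq hz t
  have hd := reflectionlessData hq hz hp hm hzeros hnosing hrefl x
  obtain ⟨e, he, hF₁, hF₂⟩ := hd.exists_limit
  set S := scatS (ap x) (cp x) (am x) (cm x) with hS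
  set F₁ := glue (ap x) (am x) S with hF₁d
  set F₂ := glue (cp x) (cm x) S with hF₂d
  have hconj : ∀ {k : ℂ}, (∀ s, k ≠ conj (zeta lam s)) → ∀ s, conj k ≠ zeta lam s :=
    fun {k} hk s h => hk s (by rw [← h, Complex.conj_conj])
  have hrow : ∀ j, IsRow (constA q) (constB q) (zeta lam) x t (rhpFst F₁ F₂ j)
      (rhpSnd F₁ F₂ j) := fun j => by
    refine ⟨fun k hk => differentiableAt_rhpFst (hd.differentiableAt_glue_a (sq_notMem_range hk))
      (hd.differentiableAt_glue_c (sq_notMem_range hk)) j, fun k hk =>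
      differentiableAt_rhpSnd (hd.differentiableAt_glue_a (sq_notMem_range (hconj hk)))
        (hd.differentiableAt_glue_c (sq_notMem_range (hconj hk))) j, fun s => ?_, fun s => ?_⟩
    · exact residueCondition_rhpFst hq hz hp hm (zeta_sq_mem hlam s) (hs s).1 (hs s).2.1
        (hs s).2.2 j
    · obtain ⟨h0, h1, h2⟩ := double_zero_conj hq hz (zeta_sq_mem hlam s) (hs s).1 (hs s).2.1
        (hs s).2.2
      exact residueCondition_rhpSnd hq hz hp hm (conj_sq_mem_lowerOpen.2 (zeta_sq_mem hlam s))
        h0 h1 h2 j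
  have hconjt : ∀ {l : Filter ℂ} {f : ℂ → ℂ} {e : ℂ}, Tendsto f l (𝓝 e) →
      Tendsto (fun w => conj (f w)) l (𝓝 (conj e)) := fun {l f e} hf =>
    (Complex.continuous_conj.tendsto e).comp hf
  -- the entries off the diagonal are `O(1/k)`
  have h21 : Tendsto (fun k => k * rhpFst F₁ F₂ 1 k) (Bornology.cobounded ℂ)
      (𝓝 (-conj (q x t) * e / (2 * Complex.I))) :=
    (hF₂.comp tendsto_sq_cobounded).congr fun k => by simp [rhpFst]; ring
  have h12 : Tendsto (fun k => k * rhpSnd F₁ F₂ 0 k) (Bornology.cobounded ℂ)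
      (𝓝 (Complex.I / 2 * q x t * conj e)) := by
    have h1 := (hconjt (hF₂.comp tendsto_conj_sq_cobounded)).neg
    have h2 : -conj (-conj (q x t) * e / (2 * Complex.I)) = Complex.I / 2 * q x t * conj e := by
      have h2 : conj (2 : ℂ) = 2 := map_ofNat _ 2
      simp only [map_div₀, map_mul, map_neg, Complex.conj_conj, Complex.conj_I, h2]
      have hI : Complex.I ≠ 0 := Complex.I_ne_zero
      field_simp
      linear_combination -(q x t * conj e) * Complex.I_sq
    rw [h2] at h1
    refine h1.congr fun k => ?_
    simp [rhpSnd]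
    ring
  have hzero : ∀ {f : ℂ → ℂ} {w : ℂ}, Tendsto (fun k => k * f k) (Bornology.cobounded ℂ) (𝓝 w) →
      Tendsto f (Bornology.cobounded ℂ) (𝓝 0) := fun {f w} hf => by
    have h1 := tendsto_inv₀_cobounded.mul hf
    rw [zero_mul] at h1
    refine h1.congr' ?_
    have hne : ∀ᶠ w in Bornology.cobounded ℂ, w ∉ ({0} : Set ℂ) :=
      (Set.finite_singleton 0).isBounded
    filter_upwards [hne] with w hw
    rw [← mul_assoc, inv_mul_cancel₀ hw, one_mul]
  refine ⟨rhpFst F₁ F₂ 0, rhpSnd F₁ F₂ 0, rhpFst F₁ F₂ 1, rhpSnd F₁ F₂ 1, e,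
    ⟨hrow 0, hrow 1, fun k hk hk' => ?_, hF₁.comp tendsto_sq_cobounded, hzero h12, hzero h21,
      hconjt (hF₁.comp tendsto_conj_sq_cobounded)⟩, ?_, ?_, he, h12⟩
  · have h1 := hd.glue_det (sq_notMem_range hk)
      (by rw [map_pow]; exact sq_notMem_range (hconj hk'))
    rw [map_pow] at h1
    simp only [rhpFst, rhpSnd, Matrix.cons_val_zero, Matrix.cons_val_one]
    linear_combination h1
  · have h0 : (0 : ℂ) ∈ lowerClosed := by simp [lowerClosed]
    simp only [rhpFst, Matrix.cons_val_zero]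
    rw [zero_pow two_ne_zero, hF₁d, glue_of_nonpos (by simp), hm.apply_zero h0]
  · simp [rhpSnd]

end TOFKN

theorem mainTheorem1
    (q : ℝ → ℝ → ℂ) (hsol : IsSolution q) (hzbc : ZeroBoundary q)
    (N : ℕ) (lam : Fin N → ℂ) (hinj : Function.Injective lam)
    (hzeros : ∀ k, (k ∈ firstQuadrant ∧ s11 q k = 0) ↔ ∃ n, lam n = k)
    (hdouble : ∀ n, deriv (s11 q) (lam n) = 0 ∧ iteratedDeriv 2 (s11 q) (lam n) ≠ 0)
    (hnosing : ∀ k ∈ contSpec, s11 q k ≠ 0 ∧ s22 q k ≠ 0)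
    (hrefl : ∀ k ∈ contSpec, rho q k = 0 ∧ rhoTilde q k = 0)
    (x t : ℝ) :
    (1 - matG (constA q) (constB q) (zeta lam) x t).det ≠ 0 ∧
    (1 - matGt (constA q) (constB q) (zeta lam) x t).det ≠ 0 ∧
    ((matR (constA q) (constB q) (zeta lam) x t).det = 0 ↔ q x t = 0) ∧
    ((matRt (constA q) (constB q) (zeta lam) x t).det = 0 ↔ q x t = 0) ∧
    q x t = 2 * Complex.I *
      ((1 - matG (constA q) (constB q) (zeta lam) x t).det
        / (matR (constA q) (constB q) (zeta lam) x t).det) *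
      ((matRt (constA q) (constB q) (zeta lam) x t).det
        / (1 - matGt (constA q) (constB q) (zeta lam) x t).det) ^ 2 := by
  have hlam : ∀ n, lam n ∈ firstQuadrant := fun n => ((hzeros _).2 ⟨n, rfl⟩).1
  obtain ⟨m₁₁, m₁₂, m₂₁, m₂₂, e, hM, h1, h0, he, hw⟩ := exists_isSolRHP hsol hzbc hzeros hdouble
    (fun k hk => (hnosing k hk).1) (fun k hk => (hrefl k hk).1) x t
  exact hM.conclusion (zeta_injective hlam hinj) (zeta_ne_conj hlam) (zeta_ne_zero hlam) h1 h0 he hw
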